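/- **Conventions.** $2=\{0,1\}$. Functions between ordinals are identified with their graphs. A map $\sigma:\mathbb A\to\mathbb B$ of forcings is a *dense embedding* if $p'\le p\Rightarrow\sigma(p')\le\sigma(p)$, if $p,p'$ are incompatible iff $\sigma(p),\sigma(p')$ are incompatible, and if every $q\in\mathbb B$ has some $\sigma(p)\le q$. A forcing is *ccc* if all its antichains (sets of pairwise incompatible conditions) are countable. **Simplified $(\omega_2,1)$-morass** $\langle\langle\varphi_\zeta\mid\zeta\le\omega_2\rangle,\langle\mathfrak G_{\zeta\xi}\mid\zeta<\xi\le\omega_2\rangle\rangle$: $\varphi_0=1$, $\varphi_{\omega_2}=\omega_3$, $0<\varphi_\zeta<\omega_2$ for $\zeta<\omega_2$; $\mathfrak G_{\zeta\xi}$ is a set of order-preserving maps $\varphi_\zeta\to\varphi_\xi$, with $|\mathfrak G_{\zeta\xi}|<\omega_2$ if $\xi<\omega_2$; $\mathfrak G_{\zeta\eta}=\{c\circ b\mid c\in\mathfrak G_{\xi\eta},b\in\mathfrak G_{\zeta\xi}\}$ for $\zeta<\xi<\eta$; $\mathfrak G_{\zeta,\zeta+1}=\{\mathrm{id}\restriction\varphi_\zeta,h_\zeta\}$,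 where for some $\delta<\varphi_\zeta$ the map $h_\zeta$ is the identity below $\delta$ and $h_\zeta(\delta)\ge\varphi_\zeta$ ($\delta=\delta_\zeta$ is the split point); if $\zeta\leq\omega_2$ is a limit, $\xi_1,\xi_2<\zeta$ and $f_i\in\mathfrak G_{\xi_i\zeta}$, then there are $\xi_1,\xi_2<\eta<\zeta$, $g\in\mathfrak G_{\eta\zeta}$, $j_i\in\mathfrak G_{\xi_i\eta}$ with $f_i=g\circ j_i$; and $\varphi_\zeta=\bigcup\{f[\varphi_\xi]\mid\xi<\zeta,f\in\mathfrak G_{\xi\zeta}\}$ for $\zeta>0$. For $\theta,\theta'\le\omega_2$ an *embedding* $f$ of the part of this structure up to $\theta$ into the part up to $\theta'$ consists of an order-preserving $f:\theta+1\to\theta'+1$ with $f(\theta)=\theta'$, order-preserving $f_\zeta:\varphi_\zeta\to\varphi_{f(\zeta)}$ ($\zeta\le\theta$) and maps $f_{\zeta\xi}:\mathfrak G_{\zeta\xi}\to\mathfrak G_{f(\zeta)f(\xi)}$ ($\zeta<\xi\le\theta$) such that $f_\zeta(\delta_\zeta)=\delta_{f(\zeta)}$ for $\zeta<\theta$, $f_{\zeta\eta}(c\circ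 b)=f_{\xi\eta}(c)\circ f_{\zeta\xi}(b)$ and $f_\xi\circ b=f_{\zeta\xi}(b)\circ f_\zeta$. It is *left-branching* if $f\restriction\theta$, all $f_\zeta$ ($\zeta<\theta$) and all $f_{\zeta\xi}$ ($\xi<\theta$) are identities, $f_\theta\in\mathfrak G_{\theta\theta'}$, and $f_{\zeta\theta}(b)=f_\theta\circ b$. It is *right-branching* if for some $\eta<\theta$: $f\restriction\eta$, $f_\zeta$ ($\zeta<\eta$), $f_{\zeta\xi}$ ($\xi<\eta$) are identities, $f(\eta+\zeta)=\theta+\zeta$ whenever $\eta+\zeta\le\theta$, $f_\eta\in\mathfrak G_{\eta\theta}$, and $f_{\zeta\xi}[\mathfrak G_{\zeta\xi}]=\mathfrak G_{f(\zeta)f(\xi)}$ for $\eta\le\zeta<\xi\le\theta$. An *amalgamation* consists of all left-branching embeddings and exactly one right-branching one. **Simplified $(\omega_1,2)$-morass**: a simplified $(\omega_2,1)$-morass with $\varphi_\zeta<\omega_1$ for $\zeta<\omega_1$, ordinals $\theta_\alpha$ ($\alpha\le\omega_1$) with $0<\theta_\alpha<\omega_1$ for $\alpha<\omega_1$ and $\theta_{\omega_1}=\omega_2$,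 and sets $\mathfrak F_{\alpha\beta}$ ($\alpha<\beta\le\omega_1$) of embeddings of the part up to $\theta_\alpha$ into the part up to $\theta_\beta$ such that: $\mathfrak F_{\alpha\beta}$ is countable for $\beta<\omega_1$; $\mathfrak F_{\alpha\gamma}=\{f\circ g\mid f\in\mathfrak F_{\beta\gamma},g\in\mathfrak F_{\alpha\beta}\}$ for $\alpha<\beta<\gamma$; $\mathfrak F_{\alpha,\alpha+1}$ is an amalgamation; for limit $\alpha\le\omega_1$, $\beta_i<\alpha$, $f_i\in\mathfrak F_{\beta_i\alpha}$ ($i=1,2$) there are $\beta_1,\beta_2<\gamma<\alpha$, $g\in\mathfrak F_{\gamma\alpha}$, $j_i\in\mathfrak F_{\beta_i\gamma}$ with $f_i=g\circ j_i$; and for limit $\alpha\le\omega_1$ the sets $\theta_\alpha$, $\varphi_\zeta$ ($\zeta\le\theta_\alpha$), $\mathfrak G_{\zeta\xi}$ ($\zeta<\xi\le\theta_\alpha$) are the unions of the sets $f[\theta_\beta]$, of the sets $f_{\bar\zeta}[\varphi_{\bar\zeta}]$ with $f(\bar\zeta)=\zeta$, and of the sets $f_{\bar\zeta\bar\xi}[\mathfrak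 G_{\bar\zeta\bar\xi}]$ with $f(\bar\zeta)=\zeta$, $f(\bar\xi)=\xi$, respectively, where $\beta<\alpha$ and $f\in\mathfrak F_{\beta\alpha}$. Fix such a morass. **The sets $P(\varphi_\beta)$**, $\beta\le\omega_2$. Let $P$ be the set of all finite functions $p:x_p\to2$ with $x_p\subseteq\omega_3\times\omega_2$, ordered by $p\le q$ iff $q\subseteq p$. A map $\pi$ of ordinals acts on $P$ through the first coordinate, $((\gamma,\mu),\epsilon)\mapsto((\pi(\gamma),\mu),\epsilon)$; $\pi[p]$ and $\pi^{-1}[p]$ are the image and the inverse image. Let $P(\varphi_0)=\{\emptyset\}$. Let $P(\varphi_{\alpha+1})$ be the set of all $p\in P$ with $x_p\subseteq\varphi_{\alpha+1}\times\omega(\alpha+1)$ such that $p\restriction(\varphi_\alpha\times\omega\alpha)$ and $h_\alpha^{-1}[p\restriction(\varphi_{\alpha+1}\times\omega\alpha)]$ belong to $P(\varphi_\alpha)$ and are compatible in $P(\varphi_\alpha)$. For limit $\beta$ let $P(\varphi_\beta)=\bigcup\{f[P(\varphi_\alpha)]\mid\alpha<\beta,f\in\mathfrak G_{\alpha\beta}\}$.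 Put $P(\omega_3)=P(\varphi_{\omega_2})$. Define $e_\alpha(p)$ for $p\in P(\varphi_{\alpha+1})$ as $h_\alpha^{-1}[p]$ if $p\in h_\alpha[P(\varphi_\alpha)]$, as $p$ if $p\in P(\varphi_\alpha)$, and otherwise as $p\restriction(\varphi_\alpha\times\omega\alpha)\cup h_\alpha^{-1}[p\restriction(\varphi_{\alpha+1}\times\omega\alpha)]$. **$p^*$ and $\mathrm{supp}(p)$**, for $p\in P(\omega_3)$. Put $p_0=p$, $\gamma_{-1}=\omega_2$. Given $p_n$, let $\nu_n$ be the least $\nu$ with $x_{p_n}\subseteq(\nu+1)\times\omega_2$. Let $p^{(n)}$ be the partial function on $\omega_2$ with $p^{(n)}(\alpha)=c$ iff $c\in P(\varphi_\alpha)$ and there are $\nu<\varphi_\alpha$, $f\in\mathfrak G_{\alpha\omega_2}$ with $f(\nu)=\nu_n$, $x_c\subseteq(\nu+1)\times\omega\alpha$ and $f[c]=p_n$. Let $\gamma_n=\min\mathrm{dom}(p^{(n)})$. If $\gamma_n$ is a successor $\alpha+1$, let $p_{n+1}=e_\alpha(p^{(n)}(\alpha+1))$; if $\gamma_n=0$,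 stop. Let $p^*=\bigcup_n p^{(n)}\restriction[\gamma_n,\gamma_{n-1})$ and $\mathrm{supp}(p)=\{\gamma_n\mid n\}$ (over the $n$ for which $p_n$ is defined). Let $Q=\{p^*\restriction\mathrm{supp}(p)\mid p\in P(\omega_3)\}$, ordered by $q\le q'$ iff $\mathrm{dom}(q')\subseteq\mathrm{dom}(q)$ and $q(\alpha)\le q'(\alpha)$ for all $\alpha\in\mathrm{dom}(q')$. **Thinning out.** For maps $u,f$ of ordinals let $u\otimes f$ be the map $\langle\gamma,\omega\delta+n\rangle\mapsto\langle u(\gamma),\omega f(\delta)+n\rangle$ ($n<\omega$) and the induced map on conditions. For $f\in\mathfrak F_{\alpha\beta}$ let $\bar f(\zeta)$ be the least ordinal including $f[\zeta]$, and let $\bar f_\zeta:\varphi_\zeta\to\varphi_{\bar f(\zeta)}$ be the unique map such that, for some $g\in\mathfrak G_{\bar f(\zeta)f(\zeta)}$ ($g=\mathrm{id}$ if $\bar f(\zeta)=f(\zeta)$), $f_\zeta=g\circ\bar f_\zeta$ and each $f_{\xi\zeta}(b)$ ($\xi<\zeta$, $b\in\mathfrak G_{\xi\zeta}$) has the form $g\circ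 c$ with $c\in\mathfrak G_{f(\xi)\bar f(\zeta)}$. For a function $q$ with ordinals as arguments and conditions as values, $\bar f[q]$ is the function with domain $\bar f[\mathrm{dom}(q)]$ and $\bar f[q](\bar f(\eta))=(\bar f_\eta\otimes f)[q(\eta)]$. Define $\mathbb P_{\varphi_{\theta_\beta}}$ for $\beta\le\omega_1$ by recursion. $\mathbb P_{\varphi_{\theta_0}}=P(\varphi_{\theta_0})$. If $h$ is the right-branching element of $\mathfrak F_{\alpha,\alpha+1}$, then $\mathbb P_{\varphi_{\theta_{\alpha+1}}}$ is the set of all $p\in P(\varphi_{\theta_{\alpha+1}})$ such that $(h_{\theta_\alpha}\otimes h)^{-1}[p]\in\mathbb P_{\varphi_{\theta_\alpha}}$ (where $h_{\theta_\alpha}\otimes h$ has domain $\varphi_{\theta_\alpha}\times\omega\theta_\alpha$), and such that $(h_{\theta_\alpha}\otimes h)^{-1}[p]$ together with all the $g^{-1}[p\restriction(\varphi_{\theta_{\alpha+1}}\times\omega\theta_\alpha)]$, $g\in\mathfrak G_{\theta_\alpha\theta_{\alpha+1}}$, has a common extension in $\mathbb P_{\varphi_{\theta_\alpha}}$. For limit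 $\beta$, $\mathbb P_{\varphi_{\theta_\beta}}=\bigcup\{(f_{\theta_\alpha}\otimes f)[\mathbb P_{\varphi_{\theta_\alpha}}]\mid\alpha<\beta,f\in\mathfrak F_{\alpha\beta}\}$. Define, for $\beta\le\omega_1$ and $\nu<\theta_\beta$, sets $\mathbb Q^\beta_{\nu+1}$. $\mathbb Q^0_{\nu+1}=\{q\in Q\mid\mathrm{dom}(q)\subseteq\nu+1\}$. $\mathbb Q^{\alpha+1}_{\nu+1}$ is the set of all $q=p^*\restriction(\mathrm{supp}(p)\cap\theta_{\alpha+1})$ with $p\in\mathbb P_{\varphi_{\theta_{\alpha+1}}}$ and $\mathrm{dom}(q)\subseteq\nu+1$. For limit $\beta$, $\mathbb Q^\beta_{\tau+1}$ is the set of all $\bar f[q]$ with $\alpha<\beta$, $f\in\mathfrak F_{\alpha\beta}$, $\nu<\theta_\alpha$, $f(\nu)=\tau$, $q\in\mathbb Q^\alpha_{\nu+1}$. Finally $\mathbb Q_{\omega_2}=\bigcup_{\nu<\omega_2}\mathbb Q^{\omega_1}_{\nu+1}$, with the order of $Q$, and $\mathbb P_{\omega_3}=\{p\in P(\omega_3)\mid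 p^*\restriction\mathrm{supp}(p)\in\mathbb Q_{\omega_2}\}$, with the order of $P$. **Lemma 4.8.** (a) The map $i:\mathbb P_{\omega_3}\to\mathbb Q_{\omega_2}$, $p\mapsto p^*\restriction\mathrm{supp}(p)$, is a dense embedding. (b) There are a ccc partial order $\bar{\mathbb P}$ of size $\omega_1$ and a dense embedding $j:\mathbb Q_{\omega_2}\to\bar{\mathbb P}$. Consequently $j\circ i:\mathbb P_{\omega_3}\to\bar{\mathbb P}$ is a dense embedding. Moreover $\bar{\mathbb P}$ and $j$ can be chosen such that, for some $S\subseteq\mathbb P_{\omega_3}$ of size $\omega_1$ with the induced order, $(j\circ i)\restriction S:S\to\bar{\mathbb P}$ is a dense embedding too. So $\mathbb P_{\omega_3}$ is forcing equivalent to its subforcing $S$ of size $\omega_1$. -/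

import Mathlib

open Ordinal Cardinal Set
open scoped Ordinal Cardinal

namespace MorassForcing

noncomputable section

/-! ### Forcing notions -/

/-- Two conditions are compatible if they have a common extension. -/
def Compatible {A : Type*} [Preorder A] (a b : A) : Prop := ∃ c, c ≤ a ∧ c ≤ b

/-- An embedding of forcings (order preserving, and preserving incompatibility in both
directions) whose range is dense. -/
structure IsDenseEmbedding {A B : Type*} [Preorder A] [Preorder B] (σ : A → B) : Prop where
  mono : ∀ p p', p' ≤ p → σ p' ≤ σ p
  incompatible_iff : ∀ p p', ¬ Compatible p p' ↔ ¬ Compatible (σ p) (σ p')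
  dense : ∀ q, ∃ p, σ p ≤ q

/-- The countable chain condition: every antichain is countable. -/
def CCC (A : Type*) [Preorder A] : Prop :=
  ∀ X : Set A, (∀ a ∈ X, ∀ b ∈ X, a ≠ b → ¬ Compatible a b) → X.Countable

/-! ### Maps between ordinals

A function with domain the ordinal `a` is coded by a total function on the ordinals which takes
the value `0` outside `a`, so that equality of codes is equality of functions. -/

/-- The restriction `f ↾ a`. -/
def cut (a : Ordinal.{0}) (f : Ordinal.{0} → Ordinal.{0}) : Ordinal.{0} → Ordinal.{0} :=
  fun γ => if γ < a then f γ else 0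

/-- `f` is (the code of) an order-preserving function from `a` to `b`. -/
structure IsOrdMap (a b : Ordinal.{0}) (f : Ordinal.{0} → Ordinal.{0}) : Prop where
  lt : ∀ γ < a, f γ < b
  strictMono : StrictMonoOn f (Iio a)
  outside : ∀ γ, a ≤ γ → f γ = 0

/-! ### Simplified gap-1 morasses -/

/-- `⟨⟨φ ζ | ζ ≤ ω₂⟩, ⟨G ζ ξ | ζ < ξ ≤ ω₂⟩⟩` is a (neat) simplified `(ω₂, 1)`-morass. -/
structure IsGapOneMorass (φ : Ordinal.{0} → Ordinal.{0})
    (G : Ordinal.{0} → Ordinal.{0} → Set (Ordinal.{0} → Ordinal.{0})) : Prop where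
  φ_zero : φ 0 = 1
  φ_top : φ (ω_ 2) = ω_ 3
  φ_pos : ∀ ζ < ω_ 2, 0 < φ ζ
  φ_lt : ∀ ζ < ω_ 2, φ ζ < ω_ 2
  maps : ∀ ζ ξ, ζ < ξ → ξ ≤ ω_ 2 → ∀ b ∈ G ζ ξ, IsOrdMap (φ ζ) (φ ξ) b
  card_lt : ∀ ζ ξ, ζ < ξ → ξ < ω_ 2 → #(G ζ ξ) < ℵ_ 2
  comp : ∀ ζ ξ η, ζ < ξ → ξ < η → η ≤ ω_ 2 →
    G ζ η = {k | ∃ c ∈ G ξ η, ∃ b ∈ G ζ ξ, k = cut (φ ζ) (c ∘ b)}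
  split : ∀ ζ < ω_ 2, ∃ h, G ζ (ζ + 1) = {cut (φ ζ) id, h} ∧
    ∃ δ < φ ζ, (∀ γ < δ, h γ = γ) ∧ φ ζ ≤ h δ
  amalg : ∀ ζ ≤ ω_ 2, Order.IsSuccLimit ζ → ∀ ξ₁ < ζ, ∀ ξ₂ < ζ,
    ∀ f₁ ∈ G ξ₁ ζ, ∀ f₂ ∈ G ξ₂ ζ,
    ∃ η, ξ₁ < η ∧ ξ₂ < η ∧ η < ζ ∧ ∃ g ∈ G η ζ, ∃ j₁ ∈ G ξ₁ η, ∃ j₂ ∈ G ξ₂ η,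
      f₁ = cut (φ ξ₁) (g ∘ j₁) ∧ f₂ = cut (φ ξ₂) (g ∘ j₂)
  cover : ∀ ζ ≤ ω_ 2, 0 < ζ → ∀ ν < φ ζ, ∃ ξ < ζ, ∃ f ∈ G ξ ζ, ∃ γ < φ ξ, f γ = ν

/-- The split point of `G ζ (ζ + 1) = {id, b}`: the critical point of `b`. -/
def splitPoint (φ : Ordinal.{0} → Ordinal.{0})
    (G : Ordinal.{0} → Ordinal.{0} → Set (Ordinal.{0} → Ordinal.{0}))
    (ζ : Ordinal.{0}) : Ordinal.{0} :=
  sInf {γ | γ < φ ζ ∧ ∃ b ∈ G ζ (ζ + 1), b γ ≠ γ}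

/-! ### Embeddings of initial segments of a gap-1 morass -/

/-- The data of an embedding `f`: `base ζ = f(ζ)`, `lvl ζ = f_ζ` and `arr ζ ξ = f_{ζξ}`. -/
@[ext]
structure Emb where
  base : Ordinal.{0} → Ordinal.{0}
  lvl : Ordinal.{0} → Ordinal.{0} → Ordinal.{0}
  arr : Ordinal.{0} → Ordinal.{0} → (Ordinal.{0} → Ordinal.{0}) → Ordinal.{0} → Ordinal.{0}

section Embeddings

variable (φ : Ordinal.{0} → Ordinal.{0})
  (G : Ordinal.{0} → Ordinal.{0} → Set (Ordinal.{0} → Ordinal.{0}))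

/-- `f` is an embedding of `⟨⟨φ ζ | ζ ≤ θ⟩, ⟨G ζ ξ | ζ < ξ ≤ θ⟩⟩` into
`⟨⟨φ ζ | ζ ≤ θ'⟩, ⟨G ζ ξ | ζ < ξ ≤ θ'⟩⟩`. The fields `base_outside`, `lvl_outside` and
`arr_outside` fix the values of the code outside the domain of the embedding. -/
structure IsEmbedding (θ θ' : Ordinal.{0}) (f : Emb) : Prop where
  base_strictMono : StrictMonoOn f.base (Iic θ)
  base_top : f.base θ = θ'
  base_outside : ∀ ζ, θ < ζ → f.base ζ = 0
  lvl_map : ∀ ζ ≤ θ, IsOrdMap (φ ζ) (φ (f.base ζ)) (f.lvl ζ)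
  lvl_outside : ∀ ζ, θ < ζ → f.lvl ζ = fun _ => 0
  arr_mem : ∀ ζ ξ, ζ < ξ → ξ ≤ θ → ∀ b ∈ G ζ ξ, f.arr ζ ξ b ∈ G (f.base ζ) (f.base ξ)
  arr_outside : ∀ ζ ξ b, ¬ (ζ < ξ ∧ ξ ≤ θ ∧ b ∈ G ζ ξ) → f.arr ζ ξ b = fun _ => 0
  split : ∀ ζ < θ, f.lvl ζ (splitPoint φ G ζ) = splitPoint φ G (f.base ζ)
  arr_comp : ∀ ζ ξ η, ζ < ξ → ξ < η → η ≤ θ → ∀ b ∈ G ζ ξ, ∀ c ∈ G ξ η,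
    f.arr ζ η (cut (φ ζ) (c ∘ b)) = cut (φ (f.base ζ)) (f.arr ξ η c ∘ f.arr ζ ξ b)
  comm : ∀ ζ ξ, ζ < ξ → ξ ≤ θ → ∀ b ∈ G ζ ξ, ∀ τ < φ ζ,
    f.lvl ξ (b τ) = f.arr ζ ξ b (f.lvl ζ τ)

open Classical in
/-- The composition `f ∘ g`, where `θ` is the length of the domain of `g`. -/
def Emb.comp (θ : Ordinal.{0}) (f g : Emb) : Emb where
  base ζ := if ζ ≤ θ then f.base (g.base ζ) else 0
  lvl ζ := if ζ ≤ θ then cut (φ ζ) (f.lvl (g.base ζ) ∘ g.lvl ζ) else fun _ => 0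
  arr ζ ξ b := if ζ < ξ ∧ ξ ≤ θ ∧ b ∈ G ζ ξ then
    f.arr (g.base ζ) (g.base ξ) (g.arr ζ ξ b) else fun _ => 0

/-- Left-branching embeddings. -/
structure IsLeftBranching (θ θ' : Ordinal.{0}) (f : Emb) : Prop where
  emb : IsEmbedding φ G θ θ' f
  base_eq : ∀ ζ < θ, f.base ζ = ζ
  lvl_eq : ∀ ζ < θ, ∀ τ < φ ζ, f.lvl ζ τ = τ
  arr_eq : ∀ ζ ξ, ζ < ξ → ξ < θ → ∀ b ∈ G ζ ξ, f.arr ζ ξ b = b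
  lvl_top : f.lvl θ ∈ G θ θ'
  arr_top : ∀ ζ < θ, ∀ b ∈ G ζ θ, f.arr ζ θ b = cut (φ ζ) (f.lvl θ ∘ b)

/-- Right-branching embeddings. -/
structure IsRightBranching (θ θ' : Ordinal.{0}) (f : Emb) : Prop where
  emb : IsEmbedding φ G θ θ' f
  branch : ∃ η < θ,
    (∀ ζ < η, f.base ζ = ζ) ∧
    (∀ ζ, η + ζ ≤ θ → f.base (η + ζ) = θ + ζ) ∧
    (∀ ζ < η, ∀ τ < φ ζ, f.lvl ζ τ = τ) ∧
    (∀ ζ ξ, ζ < ξ → ξ < η → ∀ b ∈ G ζ ξ, f.arr ζ ξ b = b) ∧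
    f.lvl η ∈ G η θ ∧
    (∀ ζ ξ, η ≤ ζ → ζ < ξ → ξ ≤ θ → f.arr ζ ξ '' G ζ ξ = G (f.base ζ) (f.base ξ))

/-- An amalgamation consists of all left-branching embeddings and exactly one right-branching
one. -/
def IsAmalgamation (θ θ' : Ordinal.{0}) (F : Set Emb) : Prop :=
  ∃ h, IsRightBranching φ G θ θ' h ∧ F = {f | IsLeftBranching φ G θ θ' f} ∪ {h}

end Embeddings

/-! ### Simplified gap-2 morasses -/

/-- Simplified `(ω₁, 2)`-morasses. -/
structure GapTwoMorass where
  φ : Ordinal.{0} → Ordinal.{0}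
  G : Ordinal.{0} → Ordinal.{0} → Set (Ordinal.{0} → Ordinal.{0})
  θ : Ordinal.{0} → Ordinal.{0}
  F : Ordinal.{0} → Ordinal.{0} → Set Emb
  gapOne : IsGapOneMorass φ G
  φ_lt : ∀ ζ < ω_ 1, φ ζ < ω_ 1
  θ_pos : ∀ α < ω_ 1, 0 < θ α
  θ_lt : ∀ α < ω_ 1, θ α < ω_ 1
  θ_top : θ (ω_ 1) = ω_ 2
  emb : ∀ α β, α < β → β ≤ ω_ 1 → ∀ f ∈ F α β, IsEmbedding φ G (θ α) (θ β) f
  countable : ∀ α β, α < β → β < ω_ 1 → (F α β).Countable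
  comp : ∀ α β γ, α < β → β < γ → γ ≤ ω_ 1 →
    F α γ = {k | ∃ f ∈ F β γ, ∃ g ∈ F α β, k = Emb.comp φ G (θ α) f g}
  amalgamation : ∀ α < ω_ 1, IsAmalgamation φ G (θ α) (θ (α + 1)) (F α (α + 1))
  amalg : ∀ α ≤ ω_ 1, Order.IsSuccLimit α → ∀ β₁ < α, ∀ β₂ < α,
    ∀ f₁ ∈ F β₁ α, ∀ f₂ ∈ F β₂ α,
    ∃ γ, β₁ < γ ∧ β₂ < γ ∧ γ < α ∧ ∃ g ∈ F γ α, ∃ j₁ ∈ F β₁ γ, ∃ j₂ ∈ F β₂ γ,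
      f₁ = Emb.comp φ G (θ β₁) g j₁ ∧ f₂ = Emb.comp φ G (θ β₂) g j₂
  cover_base : ∀ α ≤ ω_ 1, Order.IsSuccLimit α → ∀ ζ < θ α,
    ∃ β < α, ∃ f ∈ F β α, ∃ ζ' < θ β, f.base ζ' = ζ
  cover_lvl : ∀ α ≤ ω_ 1, Order.IsSuccLimit α → ∀ ζ ≤ θ α, ∀ τ < φ ζ,
    ∃ β < α, ∃ f ∈ F β α, ∃ ζ' ≤ θ β, f.base ζ' = ζ ∧ ∃ τ' < φ ζ', f.lvl ζ' τ' = τ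
  cover_arr : ∀ α ≤ ω_ 1, Order.IsSuccLimit α → ∀ ζ ξ, ζ < ξ → ξ ≤ θ α → ∀ b ∈ G ζ ξ,
    ∃ β < α, ∃ f ∈ F β α, ∃ ζ' ξ', ζ' < ξ' ∧ ξ' ≤ θ β ∧ f.base ζ' = ζ ∧ f.base ξ' = ξ ∧
      ∃ b' ∈ G ζ' ξ', f.arr ζ' ξ' b' = b

/-! ### Finite partial functions and their images -/

/-- A finite partial function from pairs of ordinals to `2` will be given by its graph; it is a
set of elements `((γ, μ), ε)`. -/
abbrev Cond : Type 1 := Set ((Ordinal.{0} × Ordinal.{0}) × Bool)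

/-- `p` is a finite function `x_p → 2` for some set `x_p` of pairs of ordinals. -/
def IsFinFun (p : Cond) : Prop :=
  p.Finite ∧ ∀ x ε ε', (x, ε) ∈ p → (x, ε') ∈ p → ε = ε'

/-- The restriction `p ↾ (a × b)`. -/
def restrictTo (a b : Ordinal.{0}) (p : Cond) : Cond := {e ∈ p | e.1.1 < a ∧ e.1.2 < b}

/-- The action `((γ, μ), ε) ↦ ((π γ, μ), ε)` of a map `π` of ordinals. -/
def shift (π : Ordinal.{0} → Ordinal.{0}) (e : (Ordinal.{0} × Ordinal.{0}) × Bool) :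
    (Ordinal.{0} × Ordinal.{0}) × Bool :=
  ((π e.1.1, e.1.2), e.2)

/-- The image `π[p]`. -/
def push (π : Ordinal.{0} → Ordinal.{0}) (p : Cond) : Cond := shift π '' p

/-- The inverse image `π⁻¹[p]` for a map `π` with domain `a`. -/
def pull (a : Ordinal.{0}) (π : Ordinal.{0} → Ordinal.{0}) (p : Cond) : Cond :=
  {e | e.1.1 < a ∧ shift π e ∈ p}

/-- The map `u ⊗ f`, which sends `((γ, ω δ + n), ε)` to `((u γ, ω f(δ) + n), ε)`. -/
def tensor (u f : Ordinal.{0} → Ordinal.{0}) (e : (Ordinal.{0} × Ordinal.{0}) × Bool) :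
    (Ordinal.{0} × Ordinal.{0}) × Bool :=
  ((u e.1.1, ω * f (e.1.2 / ω) + e.1.2 % ω), e.2)

/-- The image `(u ⊗ f)[p]`. -/
def tensorPush (u f : Ordinal.{0} → Ordinal.{0}) (p : Cond) : Cond := tensor u f '' p

/-- The inverse image `(u ⊗ f)⁻¹[p]`, where `u ⊗ f` has domain `a × ω b`. -/
def tensorPull (a b : Ordinal.{0}) (u f : Ordinal.{0} → Ordinal.{0}) (p : Cond) : Cond :=
  {e | e.1.1 < a ∧ e.1.2 < ω * b ∧ tensor u f e ∈ p}

/-- Functions whose values are conditions, such as `p* ↾ supp(p)`, are given by their graphs. -/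
abbrev Rep : Type 1 := Set (Ordinal.{0} × Cond)

/-- `p ≤ q` iff `dom(q) ⊆ dom(p)` and `p(α) ≤ q(α)`, that is `q(α) ⊆ p(α)`, for all
`α ∈ dom(q)`. -/
def Rep.Le (p q : Rep) : Prop := ∀ x ∈ q, ∃ c, (x.1, c) ∈ p ∧ x.2 ⊆ c

/-- `dom(q) ⊆ a`. -/
def Rep.DomSubset (q : Rep) (a : Ordinal.{0}) : Prop := ∀ x ∈ q, x.1 < a

namespace GapTwoMorass

variable (M : GapTwoMorass)

/-! ### The forcing along the gap-1 morass -/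

/-- The map `h_ζ` with `G ζ (ζ + 1) = {id, h_ζ}`. -/
def splitMap (ζ : Ordinal.{0}) : Ordinal.{0} → Ordinal.{0} :=
  Classical.epsilon fun h => h ∈ M.G ζ (ζ + 1) ∧ h ≠ cut (M.φ ζ) id

/-- `M.InP β p` says that `p ∈ P(φ_β)`. -/
inductive InP : Ordinal.{0} → Cond → Prop
  | zero (p : Cond) (fin : IsFinFun p)
      (dom : ∀ e ∈ p, e.1.1 < M.φ 0 ∧ e.1.2 < ω * 0) : InP 0 p
  | succ (α : Ordinal.{0}) (p r : Cond) (fin : IsFinFun p)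
      (dom : ∀ e ∈ p, e.1.1 < M.φ (α + 1) ∧ e.1.2 < ω * (α + 1))
      (left : InP α (restrictTo (M.φ α) (ω * α) p))
      (right : InP α
        (pull (M.φ α) (M.splitMap α) (restrictTo (M.φ (α + 1)) (ω * α) p)))
      (common : InP α r)
      (le_left : restrictTo (M.φ α) (ω * α) p ⊆ r)
      (le_right :
        pull (M.φ α) (M.splitMap α) (restrictTo (M.φ (α + 1)) (ω * α) p) ⊆ r) :
      InP (α + 1) p
  | limit (β α : Ordinal.{0}) (f : Ordinal.{0} → Ordinal.{0}) (p : Cond)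
      (isLimit : Order.IsSuccLimit β) (lt : α < β) (mem : f ∈ M.G α β) (inP : InP α p) :
      InP β (push f p)

open Classical in
/-- The map `e_α : P(φ_{α+1}) → P(φ_α)`. -/
def eMap (α : Ordinal.{0}) (p : Cond) : Cond :=
  if ∃ r, M.InP α r ∧ push (M.splitMap α) r = p then pull (M.φ α) (M.splitMap α) p
  else if M.InP α p then p
  else restrictTo (M.φ α) (ω * α) p ∪
    pull (M.φ α) (M.splitMap α) (restrictTo (M.φ (α + 1)) (ω * α) p)

/-! ### The function `p*` and the support -/

/-- The least `η` such that `x_p ⊆ (η + 1) × ω₂`. -/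
def topIndex (p : Cond) : Ordinal.{0} := sInf {η | ∀ e ∈ p, e.1.1 < η + 1}

/-- The partial function `α ↦ σ_{st}⁻¹(p)`, where `t = ⟨ω₂, topIndex p⟩` and `s ≺ t` lies on
level `α`. Here `s = ⟨α, ν⟩ ≺ t` is witnessed by `f ∈ G α ω₂`, the map `σ_{st}` is
`c ↦ f[c]`, and its domain consists of the `c ∈ P(φ_α)` with `x_c ⊆ (ν + 1) × ω α`. -/
def trace (p : Cond) : Rep :=
  {x | x.1 < ω_ 2 ∧ M.InP x.1 x.2 ∧ ∃ ν < M.φ x.1, ∃ f ∈ M.G x.1 (ω_ 2),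
    f ν = topIndex p ∧ (∀ e ∈ x.2, e.1.1 < ν + 1) ∧ push f x.2 = p}

/-- The least element of the domain of `trace p`. -/
def bottom (p : Cond) : Ordinal.{0} := sInf (Prod.fst '' M.trace p)

/-- `M.Descent p r u` says that `r = p_n` and `u = γ_{n-1}(p)` for some `n` for which `p_n` is
defined. Here `p_0 = p`, `γ_{-1}(p) = ω₂`, `γ_n(p)` is the least element of the domain of the
trace of `p_n`, and, if `γ_n(p)` is the successor `α + 1`, then `p_{n+1}` is the value of `e_α`
at the value of this trace at `α + 1`. -/
inductive Descent (p : Cond) : Cond → Ordinal.{0} → Prop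
  | start : Descent p p (ω_ 2)
  | step (r : Cond) (u α : Ordinal.{0}) (c : Cond) (prev : Descent p r u)
      (bottom_eq : M.bottom r = α + 1) (mem : (α + 1, c) ∈ M.trace r) :
      Descent p (M.eMap α c) (α + 1)

/-- The function `p*`, the union over `n` of the trace of `p_n` restricted to
`[γ_n(p), γ_{n-1}(p))`. -/
def star (p : Cond) : Rep :=
  {x | ∃ r u, M.Descent p r u ∧ x ∈ M.trace r ∧ M.bottom r ≤ x.1 ∧ x.1 < u}

/-- `supp(p) = {γ_n(p) | n}`. -/
def supp (p : Cond) : Set Ordinal.{0} := {γ | ∃ r u, M.Descent p r u ∧ M.bottom r = γ}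

/-- The function `p* ↾ supp(p)`. -/
def rep (p : Cond) : Rep := {x ∈ M.star p | x.1 ∈ M.supp p}

/-! ### The maps induced by the embeddings -/

/-- `f̄(ζ)`, the least ordinal that includes `f[ζ]`. -/
def barBase (f : Emb) (ζ : Ordinal.{0}) : Ordinal.{0} := sInf {α | ∀ ξ < ζ, f.base ξ < α}

/-- `u` is the map `f̄_ζ : φ_ζ → φ_{f̄(ζ)}`: there are `g = f^#(ζ) ∈ G (f̄(ζ)) (f(ζ))` (the
identity if `f̄(ζ) = f(ζ)`) and maps `f̄_{ξζ}` such that `f_ζ = g ∘ u` and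
`f_{ξζ}(b) = g ∘ f̄_{ξζ}(b)` for all `ξ < ζ` and `b ∈ G ξ ζ`. -/
def IsBarLvl (f : Emb) (ζ : Ordinal.{0}) (u : Ordinal.{0} → Ordinal.{0}) : Prop :=
  IsOrdMap (M.φ ζ) (M.φ (barBase f ζ)) u ∧
  ∃ g : Ordinal.{0} → Ordinal.{0},
    ((barBase f ζ < f.base ζ ∧ g ∈ M.G (barBase f ζ) (f.base ζ)) ∨
      (barBase f ζ = f.base ζ ∧ g = cut (M.φ (f.base ζ)) id)) ∧
    f.lvl ζ = cut (M.φ ζ) (g ∘ u) ∧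
    ∀ ξ < ζ, ∀ b ∈ M.G ξ ζ, ∃ c ∈ M.G (f.base ξ) (barBase f ζ),
      f.arr ξ ζ b = cut (M.φ (f.base ξ)) (g ∘ c)

/-- The map `f̄_ζ`. -/
def barLvl (f : Emb) (ζ : Ordinal.{0}) : Ordinal.{0} → Ordinal.{0} :=
  Classical.epsilon (M.IsBarLvl f ζ)

/-- `f̄[q]`, the function with domain `f̄[dom(q)]` and
`f̄[q](f̄(η)) = (f̄_η ⊗ f)[q(η)]` for `η ∈ dom(q)`. -/
def barImage (f : Emb) (q : Rep) : Rep :=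
  (fun x => (barBase f x.1, tensorPush (M.barLvl f x.1) f.base x.2)) '' q

/-! ### Thinning out along the gap-2 morass -/

/-- `M.InThinP β p` says that `p` belongs to the thinned out part of `P(φ_{θ_β})`. In the
successor step `r` is a common extension of `(h ⊗ h)⁻¹[p]` and of all the `g⁻¹[p]`. -/
inductive InThinP : Ordinal.{0} → Cond → Prop
  | zero (p : Cond) (inP : M.InP (M.θ 0) p) : InThinP 0 p
  | succ (α : Ordinal.{0}) (p r : Cond) (h : Emb) (inP : M.InP (M.θ (α + 1)) p)
      (mem : h ∈ M.F α (α + 1))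
      (right : IsRightBranching M.φ M.G (M.θ α) (M.θ (α + 1)) h)
      (inv : InThinP α
        (tensorPull (M.φ (M.θ α)) (M.θ α) (h.lvl (M.θ α)) h.base p))
      (common : InThinP α r)
      (le_right : tensorPull (M.φ (M.θ α)) (M.θ α) (h.lvl (M.θ α)) h.base p ⊆ r)
      (le_left : ∀ g ∈ M.G (M.θ α) (M.θ (α + 1)),
        pull (M.φ (M.θ α)) g
          (restrictTo (M.φ (M.θ (α + 1))) (ω * M.θ α) p) ⊆ r) :
      InThinP (α + 1) p
  | limit (β α : Ordinal.{0}) (f : Emb) (p : Cond) (isLimit : Order.IsSuccLimit β)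
      (lt : α < β) (mem : f ∈ M.F α β) (thin : InThinP α p) :
      InThinP β (tensorPush (f.lvl (M.θ α)) f.base p)

/-- `M.InThinQ β ν q`, for `ν < θ_β`, says that `q` belongs to the set `ℚ_{ν+1}` defined on
level `β`. -/
inductive InThinQ : Ordinal.{0} → Ordinal.{0} → Rep → Prop
  | zero (ν : Ordinal.{0}) (p : Cond) (lt : ν < M.θ 0) (inP : M.InP (ω_ 2) p)
      (dom : (M.rep p).DomSubset (ν + 1)) : InThinQ 0 ν (M.rep p)
  | succ (α ν : Ordinal.{0}) (p : Cond) (lt : ν < M.θ (α + 1)) (thin : M.InThinP (α + 1) p)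
      (dom : Rep.DomSubset {x ∈ M.rep p | x.1 < M.θ (α + 1)} (ν + 1)) :
      InThinQ (α + 1) ν {x ∈ M.rep p | x.1 < M.θ (α + 1)}
  | limit (β α ν : Ordinal.{0}) (f : Emb) (q : Rep) (isLimit : Order.IsSuccLimit β)
      (lt : α < β) (mem : f ∈ M.F α β) (lt_θ : ν < M.θ α) (thin : InThinQ α ν q) :
      InThinQ β (f.base ν) (M.barImage f q)

/-- `ℚ_{ω₂}`, the union of the sets `ℚ_{ν+1}` for `ν < ω₂ = θ_{ω₁}`. -/
def thinQ : Set Rep := {q | ∃ ν < ω_ 2, M.InThinQ (ω_ 1) ν q}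

/-- The forcing `ℚ_{ω₂}`. -/
@[ext]
structure QForcing where
  val : Rep
  mem : val ∈ M.thinQ

instance : Preorder M.QForcing where
  le p q := p.val.Le q.val
  le_refl _ x hx := ⟨x.2, hx, Subset.rfl⟩
  le_trans _ _ _ hpq hqr x hx := by
    obtain ⟨c, hc, hxc⟩ := hqr x hx
    obtain ⟨d, hd, hcd⟩ := hpq _ hc
    exact ⟨d, hd, hxc.trans hcd⟩

/-- The forcing `ℙ_{ω₃}`, that is the set of all `p ∈ P(ω₃)` with `p* ↾ supp(p) ∈ ℚ_{ω₂}`. -/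
@[ext]
structure PForcing where
  val : Cond
  inP : M.InP (ω_ 2) val
  thin : M.rep val ∈ M.thinQ

instance : PartialOrder M.PForcing where
  le p q := q.val ⊆ p.val
  le_refl _ := Subset.rfl
  le_trans _ _ _ hpq hqr := hqr.trans hpq
  le_antisymm _ _ hpq hqp := PForcing.ext (Subset.antisymm hqp hpq)

/-- The map `p ↦ p* ↾ supp(p)` from `ℙ_{ω₃}` to `ℚ_{ω₂}`. -/
def repMap (p : M.PForcing) : M.QForcing := ⟨M.rep p.val, p.thin⟩

end GapTwoMorass

end

end MorassForcing

/-!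
The first half of the argument computes `p*` and `supp(p)`. Every point `γ` of level `ω₂` of the
gap-1 morass has a unique predecessor `pr α γ` on each level `α` (`hom_tree`), and an ordinal
`γ < φ α` is its own predecessor on level `α` (`exists_hom_id`). Hence `P(φ_β)` consists of the
finite functions whose value at `(γ, ω δ + n)` depends only on the *node* of this point, that is on
`pr (δ + 1) γ` and `ω δ + n` (`inP_iff`), and `p*(α)` is the projection of `p` to level `α`
(`mem_star`). Apart from `0`, the support consists of the `α + 1` such that between the levels `α`
and `α + 1` two points of `p` move differently or points of `p` disappear (`mem_supp_succ`). From
this description it is evident that `p ↦ p* ↾ supp(p)` is monotone, and that `p* ↾ supp(p)`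
determines the values of `p` at all nodes (`exists_key_of_rep_le`).

The second half does the same one gap higher. An embedding `f` of the gap-2 morass acts on points by
`f ⊗ f`, it acts on nodes, and `f̄[p* ↾ supp(p)]` represents the image of `p` (`rep_tensorPush`).
The nodes form a tree along the gap-2 morass (`act_tree`), so that having a common predecessor is an
equivalence relation on the points of level `ω₁` (`Rel`). The thinned out sets consist exactly of
the conditions that give the same value to equivalent points (`InThinP.isThin`, `IsThin.inThinP`),
every element of `ℚ_{ω₂}` is represented by such a condition (`repMap_surjective`), and `ℙ_{ω₃}` is
the set of all these conditions on `ω₃ × ω₂` (`isThin_of_rep_mem`, `rep_mem_thinQ`).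

Therefore a condition in `ℙ_{ω₃}` amounts to a finite partial function on the equivalence classes,
and two conditions are compatible iff these functions are. There are `ℵ₁` classes: every class has
a member on one of the countable levels `α < ω₁`, and a new class appears at every successor level
(`mk_classes_le`, `le_mk_classes`). So the forcing `P̄` is Cohen forcing on the set of classes, and
`S` consists of the conditions whose points belong to a fixed set of representatives.
-/

open Ordinal Cardinal Set
open scoped Ordinal Cardinal

namespace MorassForcing

/-! ### Maps between ordinals -/

theorem cut_apply {a γ : Ordinal.{0}} (f : Ordinal.{0} → Ordinal.{0}) (h : γ < a) :
    cut a f γ = f γ := if_pos h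

theorem cut_of_le {a γ : Ordinal.{0}} (f : Ordinal.{0} → Ordinal.{0}) (h : a ≤ γ) :
    cut a f γ = 0 := if_neg h.not_gt

theorem IsOrdMap.le_apply {a b : Ordinal.{0}} {f : Ordinal.{0} → Ordinal.{0}}
    (hf : IsOrdMap a b f) {γ : Ordinal.{0}} (h : γ < a) : γ ≤ f γ := by
  induction γ using WellFoundedLT.induction with
  | _ γ ih =>
    by_contra! hlt
    have h1 := ih (f γ) hlt (hlt.trans h)
    exact absurd (hf.strictMono (hlt.trans h) h hlt) h1.not_gt

theorem IsOrdMap.le {a b : Ordinal.{0}} {f : Ordinal.{0} → Ordinal.{0}}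
    (hf : IsOrdMap a b f) : a ≤ b := by
  by_contra! h
  exact absurd (hf.le_apply h) (hf.lt b h).not_ge

theorem IsOrdMap.inj {a b : Ordinal.{0}} {f : Ordinal.{0} → Ordinal.{0}}
    (hf : IsOrdMap a b f) {γ γ' : Ordinal.{0}} (h : γ < a) (h' : γ' < a) (he : f γ = f γ') :
    γ = γ' :=
  hf.strictMono.injOn h h' he

theorem isOrdMap_id {a b : Ordinal.{0}} (h : a ≤ b) : IsOrdMap a b (cut a id) where
  lt γ hγ := by rw [cut_apply _ hγ]; exact hγ.trans_le h
  strictMono γ hγ γ' hγ' hlt := by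
    rw [cut_apply _ hγ, cut_apply _ hγ']; exact hlt
  outside γ hγ := cut_of_le _ hγ

theorem IsOrdMap.comp {a b c : Ordinal.{0}} {f g : Ordinal.{0} → Ordinal.{0}}
    (hg : IsOrdMap b c g) (hf : IsOrdMap a b f) : IsOrdMap a c (cut a (g ∘ f)) where
  lt γ hγ := by rw [cut_apply _ hγ]; exact hg.lt _ (hf.lt _ hγ)
  strictMono γ hγ γ' hγ' hlt := by
    rw [cut_apply _ hγ, cut_apply _ hγ']
    exact hg.strictMono (hf.lt _ hγ) (hf.lt _ hγ') (hf.strictMono hγ hγ' hlt)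
  outside γ hγ := cut_of_le _ hγ

theorem IsOrdMap.ext {a b b' : Ordinal.{0}} {f g : Ordinal.{0} → Ordinal.{0}}
    (hf : IsOrdMap a b f) (hg : IsOrdMap a b' g) (h : ∀ γ < a, f γ = g γ) : f = g := by
  funext γ
  rcases lt_or_ge γ a with hγ | hγ
  · exact h γ hγ
  · rw [hf.outside γ hγ, hg.outside γ hγ]

/-- The codes are extensional: a map agreeing with `k` on `a` has the same restriction to `a`. -/
theorem IsOrdMap.eq_cut {a b : Ordinal.{0}} {f k : Ordinal.{0} → Ordinal.{0}}
    (hf : IsOrdMap a b f) (h : ∀ γ < a, f γ = k γ) : f = cut a k := by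
  funext γ
  rcases lt_or_ge γ a with hγ | hγ
  · rw [cut_apply _ hγ, h γ hγ]
  · rw [hf.outside γ hγ, cut_of_le _ hγ]

theorem lt_omega_mul {μ a : Ordinal.{0}} : μ < ω * a ↔ μ / ω < a :=
  Ordinal.lt_mul_iff_div_lt omega0_ne_zero

theorem omega_mul_add_div (a b : Ordinal.{0}) : (ω * a + b % ω) / ω = a := by
  rw [Ordinal.mul_add_div _ omega0_ne_zero, Ordinal.div_eq_zero_of_lt
    (Ordinal.mod_lt _ omega0_ne_zero), add_zero]

theorem omega_mul_add_mod (a b : Ordinal.{0}) : (ω * a + b % ω) % ω = b % ω := by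
  rw [Ordinal.mul_add_mod_self, Ordinal.mod_eq_of_lt (Ordinal.mod_lt _ omega0_ne_zero)]

namespace GapTwoMorass

variable (M : GapTwoMorass)

/-! ### The tree of a simplified gap-1 morass -/

/-- The morass maps from level `α` to level `β ≥ α`: the elements of `G α β` if `α < β`, and the
identity if `α = β`. -/
def hom (α β : Ordinal.{0}) : Set (Ordinal.{0} → Ordinal.{0}) :=
  {b | (α < β ∧ b ∈ M.G α β) ∨ (α = β ∧ b = cut (M.φ α) id)}

variable {M} {α β γ δ ν ξ ζ ρ : Ordinal.{0}} {b c f g : Ordinal.{0} → Ordinal.{0}}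

theorem hom_of_mem (h : α < β) (hb : b ∈ M.G α β) : b ∈ M.hom α β := Or.inl ⟨h, hb⟩

theorem mem_of_hom (h : α < β) (hb : b ∈ M.hom α β) : b ∈ M.G α β := by
  rcases hb with hb | hb
  · exact hb.2
  · exact absurd hb.1 h.ne

theorem id_mem_hom : cut (M.φ α) id ∈ M.hom α α := Or.inr ⟨rfl, rfl⟩

theorem le_of_hom (hb : b ∈ M.hom α β) : α ≤ β := by
  rcases hb with hb | hb
  · exact hb.1.le
  · exact hb.1.le

theorem isOrdMap_of_hom (hβ : β ≤ ω_ 2) (hb : b ∈ M.hom α β) :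
    IsOrdMap (M.φ α) (M.φ β) b := by
  rcases hb with ⟨h, hb⟩ | ⟨rfl, rfl⟩
  · exact M.gapOne.maps _ _ h hβ _ hb
  · exact isOrdMap_id le_rfl

theorem hom_comp (hβ : β ≤ ω_ 2) (hc : c ∈ M.hom ξ β) (hb : b ∈ M.hom α ξ) :
    cut (M.φ α) (c ∘ b) ∈ M.hom α β := by
  rcases hb with ⟨hαξ, hb⟩ | ⟨rfl, rfl⟩
  · rcases hc with ⟨hξβ, hc⟩ | ⟨rfl, rfl⟩
    · refine Or.inl ⟨hαξ.trans hξβ, ?_⟩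
      rw [M.gapOne.comp α ξ β hαξ hξβ hβ]
      exact ⟨c, hc, b, hb, rfl⟩
    · have hm := M.gapOne.maps _ _ hαξ hβ _ hb
      have : b = cut (M.φ α) (cut (M.φ ξ) id ∘ b) :=
        hm.eq_cut fun γ hγ => (cut_apply id (hm.lt γ hγ)).symm
      rw [← this]
      exact Or.inl ⟨hαξ, hb⟩
  · have hm := isOrdMap_of_hom hβ hc
    have : c = cut (M.φ α) (c ∘ cut (M.φ α) id) :=
      hm.eq_cut fun γ hγ => by rw [Function.comp, cut_apply id hγ, id]
    rw [← this]
    exact hc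

theorem hom_decomp (hβ : β ≤ ω_ 2) (hαξ : α ≤ ξ) (hξβ : ξ ≤ β) (hf : f ∈ M.hom α β) :
    ∃ c ∈ M.hom ξ β, ∃ b ∈ M.hom α ξ, ∀ γ < M.φ α, f γ = c (b γ) := by
  rcases hαξ.eq_or_lt with rfl | h1
  · exact ⟨f, hf, _, id_mem_hom, fun γ hγ => by rw [cut_apply _ hγ, id]⟩
  rcases hξβ.eq_or_lt with rfl | h2
  · exact ⟨_, id_mem_hom, f, hf, fun γ hγ => by
      rw [cut_apply _ ((isOrdMap_of_hom hβ hf).lt γ hγ), id]⟩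
  have := mem_of_hom (h1.trans h2) hf
  rw [M.gapOne.comp α ξ β h1 h2 hβ] at this
  obtain ⟨c, hc, b, hb, rfl⟩ := this
  exact ⟨c, hom_of_mem h2 hc, b, hom_of_mem h1 hb, fun γ hγ => by rw [cut_apply _ hγ]; rfl⟩

theorem splitMap_spec (hζ : ζ < ω_ 2) : ∃ h, M.G ζ (ζ + 1) = {cut (M.φ ζ) id, h} ∧
    M.splitMap ζ = h ∧ ∃ δ < M.φ ζ, (∀ γ < δ, h γ = γ) ∧ M.φ ζ ≤ h δ := by
  obtain ⟨h, hG, δ, hδ, hid, hle⟩ := M.gapOne.split ζ hζ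
  refine ⟨h, hG, ?_, δ, hδ, hid, hle⟩
  have hne : h ≠ cut (M.φ ζ) id := by
    rintro rfl
    rw [cut_apply _ hδ] at hle
    exact absurd hδ hle.not_gt
  have hs := Classical.epsilon_spec (p := fun k => k ∈ M.G ζ (ζ + 1) ∧ k ≠ cut (M.φ ζ) id)
    ⟨h, by rw [hG]; simp, hne⟩
  have h1 : M.splitMap ζ ∈ M.G ζ (ζ + 1) := hs.1
  have h2 : M.splitMap ζ ≠ cut (M.φ ζ) id := hs.2
  rw [hG] at h1
  rcases h1 with h1 | h1
  · exact absurd h1 h2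
  · exact h1

theorem succ_lt_top (h : α < ω_ 2) : α + 1 < ω_ 2 :=
  (isSuccLimit_omega 2).succ_lt h

theorem id_mem_succ (hα : α < ω_ 2) : cut (M.φ α) id ∈ M.hom α (α + 1) := by
  obtain ⟨h, hG, -⟩ := splitMap_spec (M := M) hα
  exact hom_of_mem (lt_add_one α) (by rw [hG]; simp)

theorem splitMap_mem (hα : α < ω_ 2) : M.splitMap α ∈ M.hom α (α + 1) := by
  obtain ⟨h, hG, hs, -⟩ := splitMap_spec (M := M) hα
  exact hom_of_mem (lt_add_one α) (by rw [hG, hs]; simp)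

theorem hom_succ (hα : α < ω_ 2) (hb : b ∈ M.hom α (α + 1)) :
    b = cut (M.φ α) id ∨ b = M.splitMap α := by
  obtain ⟨h, hG, hs, -⟩ := splitMap_spec (M := M) hα
  have := mem_of_hom (lt_add_one α) hb
  rw [hG] at this
  rw [hs]
  exact this

theorem exists_splitMap_ne (hα : α < ω_ 2) :
    ∃ τ < M.φ α, M.φ α ≤ M.splitMap α τ := by
  obtain ⟨h, hG, hs, δ, hδ, -, hle⟩ := splitMap_spec (M := M) hα
  exact ⟨δ, hδ, hs ▸ hle⟩

theorem exists_hom_apply (hβ : β ≤ ω_ 2) (hα : α ≤ β) (hγ : γ < M.φ β) :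
    ∃ b ∈ M.hom α β, ∃ ν < M.φ α, b ν = γ := by
  induction β using WellFoundedLT.induction generalizing γ with
  | _ β ih =>
    rcases hα.eq_or_lt with rfl | hlt
    · exact ⟨_, id_mem_hom, γ, hγ, cut_apply _ hγ⟩
    obtain ⟨ξ, hξ, f, hf, γ', hγ', rfl⟩ := M.gapOne.cover β hβ (pos_of_gt hlt) γ hγ
    rcases le_total α ξ with h | h
    · obtain ⟨b, hb, ν, hν, rfl⟩ := ih ξ hξ (hξ.le.trans hβ) h hγ'
      exact ⟨_, hom_comp hβ (hom_of_mem hξ hf) hb, ν, hν, cut_apply _ hν⟩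
    · obtain ⟨c, hc, b, hb, he⟩ := hom_decomp hβ h hα (hom_of_mem hξ hf)
      exact ⟨c, hc, b γ', (isOrdMap_of_hom (hα.trans hβ) hb).lt _ hγ', (he γ' hγ').symm⟩

theorem φ_pos (hα : α ≤ ω_ 2) : 0 < M.φ α := by
  rcases hα.eq_or_lt with rfl | h
  · rw [M.gapOne.φ_top]; exact omega_pos 3
  · exact M.gapOne.φ_pos α h

theorem hom_nonempty (hβ : β ≤ ω_ 2) (hα : α ≤ β) : (M.hom α β).Nonempty := by
  obtain ⟨b, hb, -⟩ := exists_hom_apply (M := M) hβ hα (φ_pos hβ)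
  exact ⟨b, hb⟩

theorem φ_mono (hβ : β ≤ ω_ 2) (hα : α ≤ β) : M.φ α ≤ M.φ β := by
  obtain ⟨b, hb⟩ := hom_nonempty (M := M) hβ hα
  exact (isOrdMap_of_hom hβ hb).le

theorem hom_amalg (hβ : β ≤ ω_ 2) (hl : Order.IsSuccLimit β) (hα : α < β) (hξ : ξ < β)
    (hf : f ∈ M.hom α β) (hg : g ∈ M.hom ξ β) :
    ∃ η, α < η ∧ ξ < η ∧ η < β ∧ ∃ k ∈ M.hom η β, ∃ b ∈ M.hom α η, ∃ c ∈ M.hom ξ η,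
      (∀ γ < M.φ α, f γ = k (b γ)) ∧ (∀ γ < M.φ ξ, g γ = k (c γ)) := by
  obtain ⟨η, h1, h2, h3, k, hk, b, hb, c, hc, rfl, rfl⟩ :=
    M.gapOne.amalg β hβ hl α hα ξ hξ f (mem_of_hom hα hf) g (mem_of_hom hξ hg)
  exact ⟨η, h1, h2, h3, k, hom_of_mem h3 hk, b, hom_of_mem h1 hb, c, hom_of_mem h2 hc,
    fun γ hγ => cut_apply _ hγ, fun γ hγ => cut_apply _ hγ⟩

/-- The tree property: a point of level `β` has at most one predecessor on level `α`. -/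
theorem hom_tree (hβ : β ≤ ω_ 2) (hf : f ∈ M.hom α β) (hg : g ∈ M.hom α β) {ν ν' : Ordinal.{0}}
    (hν : ν < M.φ α) (hν' : ν' < M.φ α) (h : f ν = g ν') : ν = ν' := by
  induction β using Ordinal.limitRecOn generalizing f g ν ν' α with
  | zero =>
    obtain rfl : α = 0 := le_antisymm (le_of_hom hf) bot_le
    rcases hf with ⟨h1, -⟩ | ⟨-, rfl⟩
    · exact absurd h1 (lt_irrefl _)
    rcases hg with ⟨h1, -⟩ | ⟨-, rfl⟩
    · exact absurd h1 (lt_irrefl _)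
    simpa [cut_apply _ hν, cut_apply _ hν'] using h
  | add_one β ih =>
    have hβ2 : β < ω_ 2 := (lt_add_one β).trans_le hβ
    rcases (le_of_hom hf).eq_or_lt with rfl | hlt
    · rcases hf with ⟨h1, -⟩ | ⟨-, rfl⟩
      · exact absurd h1 (lt_irrefl _)
      rcases hg with ⟨h1, -⟩ | ⟨-, rfl⟩
      · exact absurd h1 (lt_irrefl _)
      simpa [cut_apply _ hν, cut_apply _ hν'] using h
    have hle : α ≤ β := Order.lt_add_one_iff.1 hlt
    obtain ⟨c, hc, b, hb, he⟩ := hom_decomp hβ hle (lt_add_one β).le hf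
    obtain ⟨c', hc', b', hb', he'⟩ := hom_decomp hβ hle (lt_add_one β).le hg
    rw [he ν hν, he' ν' hν'] at h
    refine ih hβ2.le hb hb' hν hν' ?_
    have hbl := (isOrdMap_of_hom hβ2.le hb).lt _ hν
    have hbl' := (isOrdMap_of_hom hβ2.le hb').lt _ hν'
    -- An image under the splitting map that lies below `φ β` is a fixed point.
    have key : ∀ x < M.φ β, ∀ y < M.φ β, x = M.splitMap β y → x = y := by
      intro x hx y hy hxy
      obtain ⟨h, -, hs, δ, hδ, hid, hle⟩ := splitMap_spec (M := M) hβ2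
      rw [hs] at hxy
      rcases lt_or_ge y δ with h1 | h1
      · rw [hxy, hid y h1]
      · exfalso
        have hm := (isOrdMap_of_hom hβ (splitMap_mem (M := M) hβ2)).strictMono.monotoneOn hδ hy h1
        rw [hs, ← hxy] at hm
        exact absurd (hle.trans hm) hx.not_ge
    rcases hom_succ hβ2 hc with rfl | rfl <;> rcases hom_succ hβ2 hc' with rfl | rfl
    · simpa [cut_apply _ hbl, cut_apply _ hbl'] using h
    · rw [cut_apply _ hbl] at h
      exact key _ hbl _ hbl' h
    · rw [cut_apply _ hbl'] at h
      exact (key _ hbl' _ hbl h.symm).symm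
    · exact (isOrdMap_of_hom hβ (splitMap_mem hβ2)).inj hbl hbl' h
  | limit β hl ih =>
    rcases (le_of_hom hf).eq_or_lt with rfl | hlt
    · rcases hf with ⟨h1, -⟩ | ⟨-, rfl⟩
      · exact absurd h1 (lt_irrefl _)
      rcases hg with ⟨h1, -⟩ | ⟨-, rfl⟩
      · exact absurd h1 (lt_irrefl _)
      simpa [cut_apply _ hν, cut_apply _ hν'] using h
    obtain ⟨η, h1, -, h3, k, hk, b, hb, c, hc, he, he'⟩ := hom_amalg hβ hl hlt hlt hf hg
    rw [he ν hν, he' ν' hν'] at h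
    have hη := h3.le.trans hβ
    exact ih η h3 hη hb hc hν hν' ((isOrdMap_of_hom hβ hk).inj
      ((isOrdMap_of_hom hη hb).lt _ hν) ((isOrdMap_of_hom hη hc).lt _ hν') h)

/-- Every ordinal `ν < φ α` is a predecessor of itself on every higher level. At limit levels
this is a consequence of the amalgamation property and of the covering property. -/
theorem exists_hom_id (hβ : β ≤ ω_ 2) (hα : α ≤ β) (hν : ν < M.φ α) :
    ∃ b ∈ M.hom α β, ∀ ν' ≤ ν, b ν' = ν' := by
  induction β using Ordinal.limitRecOn generalizing α ν with
  | zero =>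
    obtain rfl : α = 0 := le_antisymm hα bot_le
    exact ⟨_, id_mem_hom, fun ν' h => cut_apply _ (h.trans_lt hν)⟩
  | add_one β ih =>
    rcases hα.eq_or_lt with rfl | hlt
    · exact ⟨_, id_mem_hom, fun ν' h => cut_apply _ (h.trans_lt hν)⟩
    have hβ2 : β < ω_ 2 := (lt_add_one β).trans_le hβ
    have hle := Order.lt_add_one_iff.1 hlt
    obtain ⟨b, hb, he⟩ := ih hβ2.le hle hν
    refine ⟨_, hom_comp hβ (id_mem_succ hβ2) hb, fun ν' h => ?_⟩
    have h' := h.trans_lt hν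
    rw [cut_apply _ h', Function.comp, he ν' h, cut_apply _ (h'.trans_le (φ_mono hβ2.le hle)), id]
  | limit β hl ih =>
    rcases hα.eq_or_lt with rfl | hlt
    · exact ⟨_, id_mem_hom, fun ν' h => cut_apply _ (h.trans_lt hν)⟩
    induction ν using WellFoundedLT.induction with
    | _ ν ihν =>
      obtain ⟨f, hf, γ, hγ, hfγ⟩ := exists_hom_apply (M := M) hβ hα
        (hν.trans_le (φ_mono hβ hα))
      have hfm := isOrdMap_of_hom hβ hf
      have hγν : γ = ν := by
        refine le_antisymm (hfγ ▸ hfm.le_apply hγ) ?_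
        by_contra! hlt'
        obtain ⟨f', hf', he⟩ := ihν γ hlt' hγ
        obtain ⟨η, h1, -, h3, k, hk, b, hb, c, hc, hfb, hfc⟩ := hom_amalg hβ hl hlt hlt hf hf'
        have hη := h3.le.trans hβ
        have hkm := isOrdMap_of_hom hβ hk
        have hbl := (isOrdMap_of_hom hη hb).lt _ hγ
        have hcl := (isOrdMap_of_hom hη hc).lt _ hγ
        obtain ⟨i, hi, hid⟩ := ih η h3 hη h1.le hν
        have e1 := hkm.le_apply hbl
        rw [← hfb γ hγ, hfγ] at e1
        have e2 := hkm.le_apply hcl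
        rw [← hfc γ hγ, he γ le_rfl] at e2
        have e3 : b γ = γ := (hom_tree hη hi hb (e1.trans_lt hν) hγ (hid _ e1))
        have e4 : c γ = γ :=
          (hom_tree hη hi hc (e2.trans_lt hγ) hγ (hid _ (e2.trans hlt'.le)))
        have : ν = γ := by rw [← hfγ, hfb γ hγ, e3, ← e4, ← hfc γ hγ, he γ le_rfl, e4]
        exact hlt'.ne' this
      subst hγν
      refine ⟨f, hf, fun ν' h => ?_⟩
      rcases h.eq_or_lt with rfl | h
      · exact hfγ
      have hν' := h.trans hγ
      have hlt' : f ν' < γ := hfγ ▸ hfm.strictMono hν' hγ h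
      obtain ⟨f'', hf'', he⟩ := ihν (f ν') hlt' (hlt'.trans hγ)
      exact hom_tree hβ hf'' hf (hlt'.trans hγ) hν' (he _ le_rfl)

variable (M) in
open Classical in
/-- The predecessor on level `α` of the point `γ` of level `ω₂`; on the levels from `ω₂` on this
is `γ` itself. By `exists_hom_id` it is also the predecessor of the point `γ` of every level `β`
with `α ≤ β` and `γ < φ β`. -/
noncomputable def pr (α γ : Ordinal.{0}) : Ordinal.{0} :=
  if α < ω_ 2 then sInf {ν | ν < M.φ α ∧ ∃ b ∈ M.hom α (ω_ 2), b ν = γ} else γ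

theorem pr_map_top (hα : α ≤ ω_ 2) (hb : b ∈ M.hom α (ω_ 2)) (hν : ν < M.φ α) :
    M.pr α (b ν) = ν := by
  rcases hα.eq_or_lt with rfl | hlt
  · rcases hb with ⟨h1, -⟩ | ⟨-, rfl⟩
    · exact absurd h1 (lt_irrefl _)
    simp [pr, cut_apply _ hν]
  · have : {ν' | ν' < M.φ α ∧ ∃ b' ∈ M.hom α (ω_ 2), b' ν' = b ν} = {ν} := by
      ext ν'
      constructor
      · rintro ⟨h1, b', hb', he⟩
        exact hom_tree le_rfl hb' hb h1 hν he
      · rintro rfl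
        exact ⟨hν, b, hb, rfl⟩
    rw [pr, if_pos hlt, this]
    exact csInf_singleton ν

theorem pr_map (hβ : β ≤ ω_ 2) (hb : b ∈ M.hom α β) (hν : ν < M.φ α) : M.pr α (b ν) = ν := by
  obtain ⟨i, hi, hid⟩ := exists_hom_id (M := M) le_rfl hβ ((isOrdMap_of_hom hβ hb).lt _ hν)
  have := pr_map_top ((le_of_hom hb).trans hβ) (hom_comp le_rfl hi hb) hν
  rwa [cut_apply _ hν, Function.comp, hid _ le_rfl] at this

theorem pr_of_lt (hα : α ≤ ω_ 2) (hγ : γ < M.φ α) : M.pr α γ = γ := by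
  have := pr_map hα (id_mem_hom (M := M)) hγ
  rwa [cut_apply _ hγ] at this

theorem exists_hom_pr (hβ : β ≤ ω_ 2) (hα : α ≤ β) (hγ : γ < M.φ β) :
    ∃ b ∈ M.hom α β, b (M.pr α γ) = γ := by
  obtain ⟨b, hb, ν, hν, rfl⟩ := exists_hom_apply (M := M) hβ hα hγ
  exact ⟨b, hb, by rw [pr_map hβ hb hν]⟩

theorem pr_lt (hβ : β ≤ ω_ 2) (hα : α ≤ β) (hγ : γ < M.φ β) : M.pr α γ < M.φ α := by
  obtain ⟨b, hb, ν, hν, rfl⟩ := exists_hom_apply (M := M) hβ hα hγ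
  rwa [pr_map hβ hb hν]

theorem pr_pr (hξ : ξ ≤ ω_ 2) (hβ : β ≤ ξ) (hα : α ≤ β) (hγ : γ < M.φ ξ) :
    M.pr α (M.pr β γ) = M.pr α γ := by
  obtain ⟨b, hb, ν, hν, rfl⟩ := exists_hom_apply (M := M) hξ hβ hγ
  have hβ2 := hβ.trans hξ
  rw [pr_map hξ hb hν]
  obtain ⟨c, hc, ν', hν', rfl⟩ := exists_hom_apply (M := M) hβ2 hα hν
  have := pr_map hξ (hom_comp hξ hb hc) hν'
  rw [cut_apply _ hν'] at this
  rw [pr_map hβ2 hc hν']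
  exact this.symm

/-- Applying a morass map does not change the predecessors. -/
theorem pr_hom (hξ : ξ ≤ ω_ 2) (hb : b ∈ M.hom β ξ) (hα : α ≤ β) (hν : ν < M.φ β) :
    M.pr α (b ν) = M.pr α ν := by
  rw [← pr_pr hξ (le_of_hom hb) hα ((isOrdMap_of_hom hξ hb).lt _ hν), pr_map hξ hb hν]

/-- At a limit level, finitely many points lie in the range of a single morass map. -/
theorem exists_hom_pr_finite (hβ : β ≤ ω_ 2) (hl : Order.IsSuccLimit β) {s : Set Ordinal.{0}}
    (hs : s.Finite) (hlt : ∀ γ ∈ s, γ < M.φ β) (hξ : ξ < β) :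
    ∃ α, ξ ≤ α ∧ α < β ∧ ∃ b ∈ M.hom α β, ∀ γ ∈ s, b (M.pr α γ) = γ := by
  induction s, hs using Set.Finite.induction_on with
  | empty =>
    obtain ⟨b, hb⟩ := hom_nonempty (M := M) hβ hξ.le
    exact ⟨ξ, le_rfl, hξ, b, hb, by simp⟩
  | @insert γ s _ _ ih =>
    obtain ⟨α, h1, h2, b, hb, he⟩ := ih fun γ' h => hlt γ' (mem_insert_of_mem _ h)
    have hγ := hlt γ (mem_insert _ _)
    obtain ⟨f, hf, hfγ⟩ := exists_hom_pr hβ h2.le hγ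
    obtain ⟨η, h3, -, h4, k, hk, c, hc, d, hd, hc', hd'⟩ := hom_amalg hβ hl h2 h2 hb hf
    have hη := h4.le.trans hβ
    refine ⟨η, h1.trans h3.le, h4, k, hk, ?_⟩
    have aux : ∀ x ∈ M.hom α η, ∀ y < M.φ α, k (M.pr η (k (x y))) = k (x y) := by
      intro x hx y hy
      rw [pr_map hβ hk ((isOrdMap_of_hom hη hx).lt _ hy)]
    rintro γ' (rfl | h)
    · have hp := pr_lt hβ h2.le hγ
      have := aux d hd _ hp
      rwa [← hd' _ hp, hfγ] at this
    · have hp := pr_lt hβ h2.le (hlt γ' (mem_insert_of_mem _ h))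
      have := aux c hc _ hp
      rwa [← hc' _ hp, he _ h] at this

end GapTwoMorass
end MorassForcing

namespace MorassForcing
namespace GapTwoMorass

variable {M : GapTwoMorass} {α β γ ν ξ ρ : Ordinal.{0}}
  {b : Ordinal.{0} → Ordinal.{0}} {p q r : Cond}

/-! ### Conditions along the gap-1 morass -/

theorem shift_mem_push (π : Ordinal.{0} → Ordinal.{0}) {e : (Ordinal.{0} × Ordinal.{0}) × Bool}
    (he : e ∈ p) : shift π e ∈ push π p := mem_image_of_mem _ he

variable (M) in
/-- The node of the morass tree that decides the value of a condition at the point `(γ, μ)`: if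
`μ = ω δ + n`, then this is the predecessor of `γ` on level `δ + 1` (together with `μ`). -/
noncomputable def key (x : Ordinal.{0} × Ordinal.{0}) : Ordinal.{0} × Ordinal.{0} :=
  (M.pr (x.2 / ω + 1) x.1, x.2)

variable (M) in
/-- An explicit description of `P(φ_β)`: the finite sets of elements of `(φ_β × ωβ) × 2` that give
the same value to all points with the same node. -/
structure IsCond (β : Ordinal.{0}) (p : Cond) : Prop where
  finite : p.Finite
  fst_lt : ∀ e ∈ p, e.1.1 < M.φ β
  snd_lt : ∀ e ∈ p, e.1.2 / ω < β
  coherent : ∀ e ∈ p, ∀ e' ∈ p, M.key e.1 = M.key e'.1 → e.2 = e'.2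

theorem IsCond.mono (hp : M.IsCond β p) (h : q ⊆ p) : M.IsCond β q where
  finite := hp.finite.subset h
  fst_lt e he := hp.fst_lt e (h he)
  snd_lt e he := hp.snd_lt e (h he)
  coherent e he e' he' := hp.coherent e (h he) e' (h he')

theorem IsCond.isFinFun (hp : M.IsCond β p) : IsFinFun p :=
  ⟨hp.finite, fun x ε ε' h h' => hp.coherent (x, ε) h (x, ε') h' rfl⟩

theorem IsCond.empty : M.IsCond β ∅ :=
  ⟨finite_empty, by simp, by simp, by simp⟩

theorem IsCond.of_le (hβ : β ≤ ω_ 2) (h : α ≤ β) (hp : M.IsCond α p) : M.IsCond β p where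
  finite := hp.finite
  fst_lt e he := (hp.fst_lt e he).trans_le (φ_mono hβ h)
  snd_lt e he := (hp.snd_lt e he).trans_le h
  coherent := hp.coherent

theorem key_map (hβ : β ≤ ω_ 2) (hb : b ∈ M.hom α β) {μ : Ordinal.{0}} (hν : ν < M.φ α)
    (hμ : μ / ω < α) : M.key (b ν, μ) = M.key (ν, μ) :=
  Prod.ext (pr_hom hβ hb (Order.add_one_le_of_lt hμ) hν) rfl

theorem key_pr (hβ : β ≤ ω_ 2) (h : α ≤ β) {μ : Ordinal.{0}} (hγ : γ < M.φ β) (hμ : μ / ω < α) :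
    M.key (M.pr α γ, μ) = M.key (γ, μ) :=
  Prod.ext (pr_pr hβ h (Order.add_one_le_of_lt hμ) hγ) rfl

/-- Transport of coherence along a map of conditions that preserves nodes and values. -/
theorem coherent_of_map (hp : ∀ e ∈ p, ∀ e' ∈ p, M.key e.1 = M.key e'.1 → e.2 = e'.2)
    (h : ∀ a ∈ q, ∃ e ∈ p, M.key e.1 = M.key a.1 ∧ e.2 = a.2) :
    ∀ e ∈ q, ∀ e' ∈ q, M.key e.1 = M.key e'.1 → e.2 = e'.2 := by
  intro a ha a' ha' hk
  obtain ⟨e, he, h1, h2⟩ := h a ha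
  obtain ⟨e', he', h1', h2'⟩ := h a' ha'
  rw [← h2, ← h2']
  exact hp e he e' he' (by rw [h1, h1', hk])

protected theorem IsCond.push (hβ : β ≤ ω_ 2) (hb : b ∈ M.hom α β) (hp : M.IsCond α p) :
    M.IsCond β (push b p) where
  finite := hp.finite.image _
  fst_lt := by
    rintro _ ⟨e, he, rfl⟩
    exact (isOrdMap_of_hom hβ hb).lt _ (hp.fst_lt e he)
  snd_lt := by
    rintro _ ⟨e, he, rfl⟩
    exact (hp.snd_lt e he).trans_le (le_of_hom hb)
  coherent := by
    refine coherent_of_map hp.coherent ?_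
    rintro _ ⟨e, he, rfl⟩
    exact ⟨e, he, (key_map hβ hb (hp.fst_lt e he) (hp.snd_lt e he)).symm, rfl⟩

variable (M) in
/-- The projection of a condition to level `α`: the points with second coordinate below `ωα` are
moved to their predecessors on level `α`, the others are deleted. -/
noncomputable def proj (α : Ordinal.{0}) (p : Cond) : Cond :=
  push (M.pr α) {e ∈ p | e.1.2 / ω < α}

theorem mem_proj {e : (Ordinal.{0} × Ordinal.{0}) × Bool} :
    e ∈ M.proj α p ↔ ∃ a ∈ p, a.1.2 / ω < α ∧ M.pr α a.1.1 = e.1.1 ∧ a.1.2 = e.1.2 ∧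
      a.2 = e.2 := by
  constructor
  · rintro ⟨a, ⟨ha, h⟩, rfl⟩
    exact ⟨a, ha, h, rfl, rfl, rfl⟩
  · rintro ⟨a, ha, h, h1, h2, h3⟩
    exact ⟨a, ⟨ha, h⟩, Prod.ext (Prod.ext h1 h2) h3⟩

theorem mem_proj_of_mem {e : (Ordinal.{0} × Ordinal.{0}) × Bool} (he : e ∈ p)
    (h : e.1.2 / ω < α) : ((M.pr α e.1.1, e.1.2), e.2) ∈ M.proj α p := ⟨e, ⟨he, h⟩, rfl⟩

theorem proj_mono (h : p ⊆ q) : M.proj α p ⊆ M.proj α q :=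
  image_mono fun _ he => ⟨h he.1, he.2⟩

protected theorem IsCond.proj (hβ : β ≤ ω_ 2) (h : α ≤ β) (hp : M.IsCond β p) :
    M.IsCond α (M.proj α p) where
  finite := (hp.finite.subset (sep_subset _ _)).image _
  fst_lt := by
    rintro _ ⟨e, he, rfl⟩
    exact pr_lt hβ h (hp.fst_lt e he.1)
  snd_lt := by
    rintro _ ⟨e, he, rfl⟩
    exact he.2
  coherent := by
    refine coherent_of_map hp.coherent ?_
    rintro _ ⟨e, he, rfl⟩
    exact ⟨e, he.1, (key_pr hβ h (hp.fst_lt e he.1) he.2).symm, rfl⟩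

theorem proj_proj (hξ : ξ ≤ ω_ 2) (hβ : β ≤ ξ) (hα : α ≤ β) (hp : M.IsCond ξ p) :
    M.proj α (M.proj β p) = M.proj α p := by
  ext e
  simp only [mem_proj]
  constructor
  · rintro ⟨a, ⟨d, hd, h1, h2, h3, h4⟩, h5, h6, h7, h8⟩
    refine ⟨d, hd, by rwa [h3], ?_, h3.trans h7, h4.trans h8⟩
    rw [← h6, ← h2, pr_pr hξ hβ hα (hp.fst_lt d hd)]
  · rintro ⟨d, hd, h1, h2, h3, h4⟩
    exact ⟨((M.pr β d.1.1, d.1.2), d.2), ⟨d, hd, h1.trans_le hα, rfl, rfl, rfl⟩, h1,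
      by rw [← h2, pr_pr hξ hβ hα (hp.fst_lt d hd)], h3, h4⟩

theorem proj_of_isCond (hα : α ≤ ω_ 2) (hp : M.IsCond α p) : M.proj α p = p := by
  ext e
  rw [mem_proj]
  constructor
  · rintro ⟨a, ha, -, h2, h3, h4⟩
    rw [pr_of_lt hα (hp.fst_lt a ha)] at h2
    rwa [← Prod.ext (Prod.ext h2 h3) h4]
  · intro he
    exact ⟨e, he, hp.snd_lt e he, pr_of_lt hα (hp.fst_lt e he), rfl, rfl⟩

/-- The conditions that come from level `α` are those whose points lie in the range of one
morass map. -/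
theorem push_proj (hβ : β ≤ ω_ 2) (hb : b ∈ M.hom α β) (hp : M.IsCond β p) :
    push b (M.proj α p) = p ↔ ∀ e ∈ p, e.1.2 / ω < α ∧ b (M.pr α e.1.1) = e.1.1 := by
  constructor
  · intro h e he
    rw [← h] at he
    obtain ⟨a, ha, rfl⟩ := he
    obtain ⟨d, hd, h1, h2, h3, -⟩ := mem_proj.1 ha
    have hlt := pr_lt hβ (le_of_hom hb) (hp.fst_lt d hd)
    refine ⟨by simpa [shift, ← h3] using h1, ?_⟩
    simp only [shift]
    rw [← h2, pr_map hβ hb hlt]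
  · intro h
    ext e
    constructor
    · rintro ⟨a, ha, rfl⟩
      obtain ⟨d, hd, h1, h2, h3, h4⟩ := mem_proj.1 ha
      have : shift b a = d :=
        Prod.ext (Prod.ext (by simp only [shift]; rw [← h2, (h d hd).2]) h3.symm) h4.symm
      rwa [this]
    · intro he
      exact ⟨_, mem_proj_of_mem he (h e he).1, Prod.ext (Prod.ext (h e he).2 rfl) rfl⟩

theorem IsCond.exists_push (hβ : β ≤ ω_ 2) (hl : Order.IsSuccLimit β) (hp : M.IsCond β p) :
    ∃ α < β, ∃ b ∈ M.hom α β, push b (M.proj α p) = p := by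
  -- A bound for the second coordinates comes first.
  have hbound : ∃ ξ < β, ∀ e ∈ p, e.1.2 / ω < ξ := by
    have := hp.snd_lt
    clear * - hl this hp
    have hfin := hp.finite
    clear hp
    induction p, hfin using Set.Finite.induction_on with
    | empty => exact ⟨0, hl.bot_lt, by simp⟩
    | @insert e s _ _ ih =>
      obtain ⟨ξ, hξ, h⟩ := ih fun e he => this e (mem_insert_of_mem _ he)
      refine ⟨max ξ (e.1.2 / ω + 1), max_lt hξ (hl.succ_lt (this e (mem_insert _ _))), ?_⟩
      rintro e' (rfl | he')
      · exact (lt_add_one _).trans_le (le_max_right _ _)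
      · exact (h e' he').trans_le (le_max_left _ _)
  obtain ⟨ξ, hξ, hlt⟩ := hbound
  obtain ⟨α, h1, h2, b, hb, he⟩ := exists_hom_pr_finite hβ hl
    (s := (fun e : (Ordinal.{0} × Ordinal.{0}) × Bool => e.1.1) '' p)
    (hp.finite.image _) (by rintro _ ⟨e, he, rfl⟩; exact hp.fst_lt e he) hξ
  exact ⟨α, h2, b, hb, (push_proj hβ hb hp).2 fun e h =>
    ⟨(hlt e h).trans_le h1, he _ (mem_image_of_mem _ h)⟩⟩

theorem restrictTo_subset_proj (hα : α ≤ ω_ 2) :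
    restrictTo (M.φ α) (ω * α) p ⊆ M.proj α p := by
  rintro e ⟨he, h1, h2⟩
  exact mem_proj.2 ⟨e, he, lt_omega_mul.1 h2, pr_of_lt hα h1, rfl, rfl⟩

theorem pull_subset_proj (hβ : β ≤ ω_ 2) (hb : b ∈ M.hom α β) :
    pull (M.φ α) b (restrictTo (M.φ β) (ω * α) p) ⊆ M.proj α p := by
  rintro e ⟨he, h, h1, h2⟩
  exact mem_proj.2 ⟨_, h, lt_omega_mul.1 h2, pr_map hβ hb he, rfl, rfl⟩

theorem restrictTo_union_pull (hα : α < ω_ 2) (hp : M.IsCond (α + 1) p) :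
    restrictTo (M.φ α) (ω * α) p ∪
      pull (M.φ α) (M.splitMap α) (restrictTo (M.φ (α + 1)) (ω * α) p) = M.proj α p := by
  have h2 := (succ_lt_top hα).le
  refine Subset.antisymm (union_subset (restrictTo_subset_proj hα.le)
    (pull_subset_proj h2 (splitMap_mem hα))) ?_
  intro e he
  obtain ⟨a, ha, h1, h3, h4, h5⟩ := mem_proj.1 he
  have hlt := hp.fst_lt a ha
  have hpr := pr_lt h2 (lt_add_one α).le hlt
  obtain ⟨b, hb, hba⟩ := exists_hom_pr h2 (lt_add_one α).le hlt
  rcases hom_succ hα hb with rfl | rfl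
  · left
    rw [cut_apply _ hpr, id] at hba
    have : a = e := Prod.ext (Prod.ext (hba.symm.trans h3) h4) h5
    subst this
    exact ⟨ha, hba ▸ hpr, lt_omega_mul.2 h1⟩
  · right
    rw [h3] at hba hpr
    have : shift (M.splitMap α) e = a := Prod.ext (Prod.ext hba h4.symm) h5.symm
    refine ⟨hpr, ?_⟩
    rw [this]
    exact ⟨ha, hlt, lt_omega_mul.2 h1⟩

theorem InP.isCond (hβ : β ≤ ω_ 2) (h : M.InP β p) : M.IsCond β p := by
  induction h with
  | zero p fin dom =>
    have : p = ∅ := by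
      refine eq_empty_of_forall_notMem fun e he => ?_
      have := (dom e he).2
      rw [mul_zero] at this
      exact not_lt_bot this
    subst this
    exact IsCond.empty
  | succ α p r fin dom left right common le_left le_right _ _ ih =>
    have hα : α < ω_ 2 := (lt_add_one α).trans_le hβ
    refine ⟨fin.1, fun e he => (dom e he).1, fun e he => lt_omega_mul.1 (dom e he).2, ?_⟩
    intro e he e' he' hk
    have hμ : e.1.2 = e'.1.2 := (Prod.ext_iff.1 hk).2
    rcases (Order.lt_add_one_iff.1 (lt_omega_mul.1 (dom e he).2)).eq_or_lt with h1 | h1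
    · have h1' : M.pr _ _ = M.pr _ _ := (Prod.ext_iff.1 hk).1
      rw [← hμ, h1, pr_of_lt hβ (dom e he).1, pr_of_lt hβ (dom e' he').1] at h1'
      exact fin.2 e.1 _ _ he (by rw [Prod.ext h1' hμ]; exact he')
    · have hr := ih hα.le
      have aux : ∀ a ∈ p, a.1.2 / ω < α → ∃ d ∈ r, M.key d.1 = M.key a.1 ∧ d.2 = a.2 := by
        intro a ha hlt
        have hφ := (dom a ha).1
        obtain ⟨b, hb, hba⟩ := exists_hom_pr hβ (lt_add_one α).le hφ
        have hpr := pr_lt hβ (lt_add_one α).le hφ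
        rcases hom_succ hα hb with rfl | rfl
        · rw [cut_apply _ hpr, id] at hba
          exact ⟨a, le_left ⟨ha, hba ▸ hpr, lt_omega_mul.2 hlt⟩, rfl, rfl⟩
        · refine ⟨((M.pr α a.1.1, a.1.2), a.2), le_right ⟨hpr, ?_⟩,
            key_pr hβ (lt_add_one α).le hφ hlt, rfl⟩
          have : shift (M.splitMap α) ((M.pr α a.1.1, a.1.2), a.2) = a :=
            Prod.ext (Prod.ext hba rfl) rfl
          rw [this]
          exact ⟨ha, hφ, lt_omega_mul.2 hlt⟩
      obtain ⟨d, hd, h2, h3⟩ := aux e he h1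
      obtain ⟨d', hd', h2', h3'⟩ := aux e' he' (hμ ▸ h1)
      rw [← h3, ← h3']
      exact hr.coherent d hd d' hd' (by rw [h2, h2', hk])
  | limit β α f p isLimit lt mem inP ih =>
    exact (ih (lt.le.trans hβ)).push hβ (hom_of_mem lt mem)

theorem IsCond.inP (hβ : β ≤ ω_ 2) (h : M.IsCond β p) : M.InP β p := by
  induction β using Ordinal.limitRecOn generalizing p with
  | zero => exact .zero p h.isFinFun fun e he => absurd (h.snd_lt e he) not_lt_bot
  | add_one α ih =>
    have hα : α < ω_ 2 := (lt_add_one α).trans_le hβ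
    have hr := h.proj hβ (lt_add_one α).le
    have hl := restrictTo_subset_proj (M := M) (p := p) hα.le
    have hr' := pull_subset_proj (M := M) (p := p) hβ (splitMap_mem hα)
    exact .succ α p (M.proj α p) h.isFinFun
      (fun e he => ⟨h.fst_lt e he, lt_omega_mul.2 (h.snd_lt e he)⟩)
      (ih hα.le (hr.mono hl)) (ih hα.le (hr.mono hr')) (ih hα.le hr) hl hr'
  | limit β hl ih =>
    obtain ⟨α, hα, b, hb, he⟩ := h.exists_push hβ hl
    rw [← he]
    exact .limit β α b _ hl hα (mem_of_hom hα hb)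
      (ih α hα (hα.le.trans hβ) (h.proj hβ hα.le))

theorem inP_iff (hβ : β ≤ ω_ 2) : M.InP β p ↔ M.IsCond β p :=
  ⟨InP.isCond hβ, IsCond.inP hβ⟩

theorem pull_push {a : Ordinal.{0}} (hb : IsOrdMap a β b) (hp : ∀ e ∈ p, e.1.1 < a) :
    pull a b (push b p) = p := by
  ext e
  constructor
  · rintro ⟨h, a, ha, he⟩
    have h1 : a.1.1 = e.1.1 := hb.inj (hp a ha) h (congrArg (fun x => x.1.1) he)
    have : a = e := Prod.ext (Prod.ext h1 (congrArg (fun x => x.1.2) he :))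
      (congrArg (fun x => x.2) he :)
    rwa [← this]
  · intro he
    exact ⟨hp e he, shift_mem_push b he⟩

/-- In each of the three cases of its definition, `e_α` is the projection to level `α`. -/
theorem eMap_eq (hα : α < ω_ 2) (hp : M.IsCond (α + 1) p) : M.eMap α p = M.proj α p := by
  have h2 := (succ_lt_top hα).le
  unfold eMap
  split_ifs with h h'
  · obtain ⟨r, hr, rfl⟩ := h
    have hr' := hr.isCond hα.le
    rw [pull_push (isOrdMap_of_hom h2 (splitMap_mem hα)) hr'.fst_lt]
    ext e
    rw [mem_proj]
    constructor
    · intro he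
      exact ⟨_, shift_mem_push _ he, hr'.snd_lt e he,
        pr_map h2 (splitMap_mem hα) (hr'.fst_lt e he), rfl, rfl⟩
    · rintro ⟨_, ⟨a, ha, rfl⟩, -, h3, h4, h5⟩
      have h3' := pr_map h2 (splitMap_mem hα) (hr'.fst_lt a ha)
      have : a = e := Prod.ext (Prod.ext (h3'.symm.trans h3) h4) h5
      rwa [← this]
  · exact (proj_of_isCond hα.le (h'.isCond hα.le)).symm
  · exact restrictTo_union_pull hα hp

/-! ### The function `p*` and the support -/

variable (M) in
/-- `p` lies in the range of the map on conditions induced by some morass map from level `α` to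
level `ω₂`. -/
def Lifts (α : Ordinal.{0}) (p : Cond) : Prop :=
  ∃ f ∈ M.hom α (ω_ 2), ∀ e ∈ p, e.1.2 / ω < α ∧ f (M.pr α e.1.1) = e.1.1

theorem Lifts.mono (hp : M.IsCond (ω_ 2) p) (hβ : β ≤ ω_ 2) (h : α ≤ β) (hl : M.Lifts α p) :
    M.Lifts β p := by
  obtain ⟨f, hf, hl⟩ := hl
  obtain ⟨c, hc, b, hb, he⟩ := hom_decomp le_rfl h hβ hf
  refine ⟨c, hc, fun e h' => ⟨(hl e h').1.trans_le h, ?_⟩⟩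
  have hlt := pr_lt le_rfl (h.trans hβ) (hp.fst_lt e h')
  have h1 := (hl e h').2
  rw [he _ hlt] at h1
  rw [← h1, pr_map le_rfl hc ((isOrdMap_of_hom hβ hb).lt _ hlt)]

/-- A condition on level `α` lifts from level `α`. -/
theorem IsCond.lifts (hα : α ≤ ω_ 2) (hp : M.IsCond α p) : M.Lifts α p := by
  have hbound : ∃ ν < M.φ α, ∀ e ∈ p, e.1.1 ≤ ν := by
    rcases p.eq_empty_or_nonempty with rfl | hne
    · exact ⟨0, φ_pos hα, by simp⟩
    · obtain ⟨e, he, hmax⟩ := exists_max_image p (fun e => e.1.1) hp.finite hne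
      exact ⟨e.1.1, hp.fst_lt e he, hmax⟩
  obtain ⟨ν, hν, hle⟩ := hbound
  obtain ⟨b, hb, hid⟩ := exists_hom_id (M := M) le_rfl hα hν
  refine ⟨b, hb, fun e he => ⟨hp.snd_lt e he, ?_⟩⟩
  rw [pr_of_lt hα (hp.fst_lt e he), hid _ (hle e he)]

theorem le_topIndex (hp : p.Finite) {e : (Ordinal.{0} × Ordinal.{0}) × Bool} (he : e ∈ p) :
    e.1.1 ≤ topIndex p := by
  have hne : {η | ∀ e ∈ p, e.1.1 < η + 1}.Nonempty := by
    obtain ⟨d, hd, hmax⟩ := exists_max_image p (fun e => e.1.1) hp ⟨e, he⟩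
    exact ⟨d.1.1, fun a ha => Order.lt_add_one_iff.2 (hmax a ha)⟩
  exact Order.lt_add_one_iff.1 (csInf_mem hne e he)

theorem topIndex_empty : topIndex (∅ : Cond) = 0 :=
  le_antisymm (csInf_le' (by simp)) bot_le

theorem exists_topIndex (hp : p.Finite) (hne : p.Nonempty) : ∃ e ∈ p, e.1.1 = topIndex p := by
  obtain ⟨d, hd, hmax⟩ := exists_max_image p (fun e => e.1.1) hp hne
  exact ⟨d, hd, le_antisymm (le_topIndex hp hd)
    (csInf_le' fun a ha => Order.lt_add_one_iff.2 (hmax a ha))⟩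

theorem mem_trace (hp : M.IsCond (ω_ 2) p) :
    (α, q) ∈ M.trace p ↔ α < ω_ 2 ∧ q = M.proj α p ∧ M.Lifts α p := by
  constructor
  · rintro ⟨hα, hq, ν, hν, f, hf, htop, hle, rfl⟩
    have hα : α < ω_ 2 := hα
    have hf : f ∈ M.hom α (ω_ 2) := hom_of_mem hα hf
    have hq : M.IsCond α q := InP.isCond hα.le hq
    have hl : ∀ e ∈ push f q, e.1.2 / ω < α ∧ f (M.pr α e.1.1) = e.1.1 := by
      rintro _ ⟨e, he, rfl⟩
      exact ⟨hq.snd_lt e he, congrArg f (pr_map le_rfl hf (hq.fst_lt e he))⟩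
    refine ⟨hα, ?_, f, hf, hl⟩
    ext e
    rw [mem_proj]
    constructor
    · intro he
      exact ⟨_, shift_mem_push f he, hq.snd_lt e he, pr_map le_rfl hf (hq.fst_lt e he), rfl, rfl⟩
    · rintro ⟨_, ⟨a, ha, rfl⟩, -, h3, h4, h5⟩
      have : a = e := Prod.ext (Prod.ext ((pr_map le_rfl hf (hq.fst_lt a ha)).symm.trans h3) h4) h5
      rwa [← this]
  · rintro ⟨hα, rfl, f, hf, hl⟩
    have hc := hp.proj le_rfl hα.le
    have hpush : push f (M.proj α p) = p := (push_proj le_rfl hf hp).2 hl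
    rcases p.eq_empty_or_nonempty with rfl | hne
    · obtain ⟨b, hb, hid⟩ := exists_hom_id (M := M) le_rfl hα.le (φ_pos hα.le)
      have h0 : M.proj α ∅ = ∅ :=
        eq_empty_of_forall_notMem fun e he => by obtain ⟨a, ha, -⟩ := mem_proj.1 he; exact ha
      refine ⟨hα, hc.inP hα.le, 0, φ_pos hα.le, b, mem_of_hom hα hb, ?_, ?_, ?_⟩
      · rw [topIndex_empty]; exact hid 0 le_rfl
      · change ∀ e ∈ M.proj α ∅, _
        simp [h0]
      · change push b (M.proj α ∅) = ∅
        simp [h0, push]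
    · obtain ⟨d, hd, htop⟩ := exists_topIndex hp.finite hne
      refine ⟨hα, hc.inP hα.le, M.pr α d.1.1, pr_lt le_rfl hα.le (hp.fst_lt d hd), f,
        mem_of_hom hα hf, ?_, ?_, hpush⟩
      · rw [(hl d hd).2, htop]
      · intro e he
        obtain ⟨a, ha, -, h2, -, -⟩ := mem_proj.1 he
        rw [Order.lt_add_one_iff, ← h2]
        have hle := le_topIndex hp.finite ha
        rw [← htop, ← (hl d hd).2, ← (hl a ha).2] at hle
        exact ((isOrdMap_of_hom le_rfl hf).strictMono.le_iff_le
          (pr_lt le_rfl hα.le (hp.fst_lt a ha)) (pr_lt le_rfl hα.le (hp.fst_lt d hd))).1 hle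

theorem bottom_eq (hp : M.IsCond (ω_ 2) p) :
    M.bottom p = sInf {α | α < ω_ 2 ∧ M.Lifts α p} := by
  unfold bottom
  congr 1
  ext α
  constructor
  · rintro ⟨⟨_, q⟩, h, rfl⟩
    have := (mem_trace hp).1 h
    exact ⟨this.1, this.2.2⟩
  · rintro ⟨h1, h2⟩
    exact ⟨(α, M.proj α p), (mem_trace hp).2 ⟨h1, rfl, h2⟩, rfl⟩

theorem bottom_spec (hp : M.IsCond (ω_ 2) p) :
    M.bottom p < ω_ 2 ∧ M.Lifts (M.bottom p) p := by
  rw [bottom_eq hp]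
  refine csInf_mem (s := {α | α < ω_ 2 ∧ M.Lifts α p}) ?_
  obtain ⟨α, hα, b, hb, he⟩ := hp.exists_push le_rfl (isSuccLimit_omega 2)
  exact ⟨α, hα, b, hb, (push_proj le_rfl hb hp).1 he⟩

theorem bottom_le (hp : M.IsCond (ω_ 2) p) (hα : α < ω_ 2) (h : M.Lifts α p) : M.bottom p ≤ α := by
  rw [bottom_eq hp]
  exact csInf_le' ⟨hα, h⟩

theorem lifts_iff (hp : M.IsCond (ω_ 2) p) (hα : α < ω_ 2) : M.Lifts α p ↔ M.bottom p ≤ α :=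
  ⟨bottom_le hp hα, fun h => (bottom_spec hp).2.mono hp hα.le h⟩

theorem bottom_cases (hp : M.IsCond (ω_ 2) p) :
    M.bottom p = 0 ∨ ∃ α < ω_ 2, M.bottom p = α + 1 := by
  obtain ⟨hlt, hl⟩ := bottom_spec hp
  rcases Ordinal.zero_or_succ_or_isSuccLimit (M.bottom p) with h | ⟨α, h⟩ | h
  · exact Or.inl h
  · exact Or.inr ⟨α, ((Order.lt_succ α).trans_eq h).trans hlt, h.symm⟩
  · exfalso
    obtain ⟨f, hf, he⟩ := hl
    have hc := hp.proj le_rfl hlt.le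
    obtain ⟨ξ, hξ, b, hb, hpush⟩ := hc.exists_push hlt.le h
    rw [push_proj hlt.le hb hc] at hpush
    refine absurd (bottom_le hp (hξ.trans hlt) ⟨_, hom_comp le_rfl hf hb, ?_⟩) hξ.not_ge
    intro e h'
    have h1 := hpush _ (mem_proj_of_mem h' (he e h').1)
    refine ⟨h1.1, ?_⟩
    have hφ := hp.fst_lt e h'
    rw [cut_apply _ (pr_lt le_rfl (hξ.trans hlt).le hφ), Function.comp]
    have h2 := h1.2
    simp only at h2
    rw [pr_pr le_rfl hlt.le hξ.le hφ] at h2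
    rw [h2, (he e h').2]

variable (M) in
/-- Between the levels `α` and `α + 1` nothing happens to `p`: `p` has no points of height `α`, and
a single map of `G α (α + 1)` moves the projection of `p` to level `α` to its projection to
level `α + 1`. -/
def Smooth (p : Cond) (α : Ordinal.{0}) : Prop :=
  ∃ b ∈ M.hom α (α + 1), ∀ e ∈ p, e.1.2 / ω < α + 1 →
    e.1.2 / ω < α ∧ M.pr (α + 1) e.1.1 = b (M.pr α e.1.1)

theorem Smooth.mono (h : p ⊆ q) (hs : M.Smooth q α) : M.Smooth p α := by
  obtain ⟨b, hb, he⟩ := hs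
  exact ⟨b, hb, fun e h' => he e (h h')⟩

/-- Smoothness at `α` in terms of the projection to a level above `α`. -/
theorem smooth_proj (hβ : β ≤ ω_ 2) (hp : M.IsCond (ω_ 2) p) (hα : α + 1 ≤ β) :
    M.Smooth (M.proj β p) α ↔ M.Smooth p α := by
  have hα' : α ≤ β := (lt_add_one α).le.trans hα
  constructor
  · rintro ⟨b, hb, he⟩
    refine ⟨b, hb, fun e h h' => ?_⟩
    have h1 := he _ (mem_proj_of_mem h (h'.trans_le hα)) h'
    have hφ := hp.fst_lt e h
    rw [pr_pr le_rfl hβ hα hφ, pr_pr le_rfl hβ hα' hφ] at h1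
    exact h1
  · rintro ⟨b, hb, he⟩
    refine ⟨b, hb, fun e h h' => ?_⟩
    obtain ⟨a, ha, -, h2, h3, -⟩ := mem_proj.1 h
    have hφ := hp.fst_lt a ha
    rw [← h2, pr_pr le_rfl hβ hα hφ, pr_pr le_rfl hβ hα' hφ, ← h3]
    exact he a ha (by rwa [h3])

theorem Lifts.smooth (hp : M.IsCond (ω_ 2) p) (hα : α < ω_ 2) (h : M.Lifts α p) :
    M.Smooth p α := by
  obtain ⟨f, hf, he⟩ := h
  have h2 := (succ_lt_top hα).le
  obtain ⟨c, hc, b, hb, hd⟩ := hom_decomp le_rfl (lt_add_one α).le h2 hf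
  refine ⟨b, hb, fun e h _ => ⟨(he e h).1, ?_⟩⟩
  have hlt := pr_lt le_rfl hα.le (hp.fst_lt e h)
  have h1 := (he e h).2
  rw [hd _ hlt] at h1
  conv_lhs => rw [← h1]
  exact pr_map le_rfl hc ((isOrdMap_of_hom h2 hb).lt _ hlt)

theorem Lifts.of_smooth (hp : M.IsCond (ω_ 2) p) (hα : α < ω_ 2) (h : M.Lifts (α + 1) p)
    (hs : M.Smooth p α) : M.Lifts α p := by
  obtain ⟨f, hf, he⟩ := h
  obtain ⟨b, hb, hd⟩ := hs
  refine ⟨_, hom_comp le_rfl hf hb, fun e h => ?_⟩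
  obtain ⟨h1, h2⟩ := hd e h (he e h).1
  rw [cut_apply _ (pr_lt le_rfl hα.le (hp.fst_lt e h)), Function.comp, ← h2]
  exact ⟨h1, (he e h).2⟩

/-- The stages of the recursion that defines `p*` are projections of `p`. -/
theorem Descent.eq_proj {u : Ordinal.{0}} (hp : M.IsCond (ω_ 2) p) (h : M.Descent p r u) :
    (u = ω_ 2 ∧ r = p) ∨ ∃ α < ω_ 2, u = α + 1 ∧ r = M.proj α p := by
  induction h with
  | start => exact Or.inl ⟨rfl, rfl⟩
  | step r u α c prev bot mem ih =>
    right
    have hr : M.IsCond (ω_ 2) r := by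
      rcases ih with ⟨-, rfl⟩ | ⟨β, hβ, -, rfl⟩
      · exact hp
      · exact (hp.proj le_rfl hβ.le).of_le le_rfl hβ.le
    obtain ⟨hα, rfl, hl⟩ := (mem_trace hr).1 mem
    have hα' : α < ω_ 2 := (lt_add_one α).trans hα
    refine ⟨α, hα', rfl, ?_⟩
    rw [eMap_eq hα' (hr.proj le_rfl hα.le), proj_proj le_rfl hα.le (lt_add_one α).le hr]
    rcases ih with ⟨-, rfl⟩ | ⟨β, hβ, -, rfl⟩
    · rfl
    · have hc := hp.proj le_rfl hβ.le
      have : α + 1 ≤ β := bot ▸ bottom_le hr hβ (hc.lifts hβ.le)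
      exact proj_proj le_rfl hβ.le ((lt_add_one α).le.trans this) hp

theorem Descent.isCond {u : Ordinal.{0}} (hp : M.IsCond (ω_ 2) p) (h : M.Descent p r u) :
    M.IsCond (ω_ 2) r := by
  rcases h.eq_proj hp with ⟨-, rfl⟩ | ⟨β, hβ, -, rfl⟩
  · exact hp
  · exact (hp.proj le_rfl hβ.le).of_le le_rfl hβ.le

theorem Descent.bottom_lt {u : Ordinal.{0}} (hp : M.IsCond (ω_ 2) p) (h : M.Descent p r u) :
    M.bottom r < u := by
  have hr := h.isCond hp
  rcases h.eq_proj hp with ⟨rfl, rfl⟩ | ⟨β, hβ, rfl, rfl⟩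
  · exact (bottom_spec hr).1
  · exact Order.lt_add_one_iff.2 (bottom_le hr hβ ((hp.proj le_rfl hβ.le).lifts hβ.le))

theorem Descent.proj_eq {u : Ordinal.{0}} (hp : M.IsCond (ω_ 2) p) (h : M.Descent p r u)
    (hα : α < u) : M.proj α r = M.proj α p := by
  rcases h.eq_proj hp with ⟨-, rfl⟩ | ⟨β, hβ, rfl, rfl⟩
  · rfl
  · exact proj_proj le_rfl hβ.le (Order.lt_add_one_iff.1 hα) hp

theorem Descent.smooth_iff {u : Ordinal.{0}} (hp : M.IsCond (ω_ 2) p) (h : M.Descent p r u)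
    (hα : α + 1 < u) : M.Smooth r α ↔ M.Smooth p α := by
  rcases h.eq_proj hp with ⟨-, rfl⟩ | ⟨β, hβ, rfl, rfl⟩
  · rfl
  · exact smooth_proj hβ.le hp (Order.lt_add_one_iff.1 hα)

/-- The intervals `[γ_n, γ_{n-1})` cover `ω₂`. -/
theorem exists_descent (hp : M.IsCond (ω_ 2) p) (hα : α < ω_ 2) :
    ∃ r u, M.Descent p r u ∧ M.bottom r ≤ α ∧ α < u := by
  have hne : {u | α < u ∧ ∃ r, M.Descent p r u}.Nonempty := ⟨ω_ 2, hα, p, .start⟩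
  obtain ⟨hu, r, hr⟩ := csInf_mem hne
  refine ⟨r, _, hr, ?_, hu⟩
  by_contra! hlt
  have hrc := hr.isCond hp
  obtain ⟨hb2, hbl⟩ := bottom_spec hrc
  rcases bottom_cases hrc with h0 | ⟨ξ, hξ, h1⟩
  · rw [h0] at hlt
    exact not_lt_bot hlt
  · have hmem : (ξ + 1, M.proj (ξ + 1) r) ∈ M.trace r :=
      (mem_trace hrc).2 ⟨h1 ▸ hb2, rfl, h1 ▸ hbl⟩
    have hstep := Descent.step r _ ξ _ hr h1 hmem
    have hle : sInf {u | α < u ∧ ∃ r, M.Descent p r u} ≤ ξ + 1 :=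
      csInf_le' ⟨h1 ▸ hlt, _, hstep⟩
    exact absurd (h1 ▸ hr.bottom_lt hp) hle.not_gt

theorem mem_star (hp : M.IsCond (ω_ 2) p) :
    (α, q) ∈ M.star p ↔ α < ω_ 2 ∧ q = M.proj α p := by
  constructor
  · rintro ⟨r, u, hr, ht, -, hlt⟩
    obtain ⟨h1, h2, -⟩ := (mem_trace (hr.isCond hp)).1 ht
    exact ⟨h1, h2.trans (hr.proj_eq hp hlt)⟩
  · rintro ⟨hα, rfl⟩
    obtain ⟨r, u, hr, hle, hlt⟩ := exists_descent hp hα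
    have hrc := hr.isCond hp
    exact ⟨r, u, hr, (mem_trace hrc).2 ⟨hα, (hr.proj_eq hp hlt).symm, (lifts_iff hrc hα).2 hle⟩,
      hle, hlt⟩

theorem zero_mem_supp (hp : M.IsCond (ω_ 2) p) : 0 ∈ M.supp p := by
  obtain ⟨r, u, hr, hle, -⟩ := exists_descent hp (omega_pos 2)
  exact ⟨r, u, hr, le_antisymm hle bot_le⟩

theorem mem_supp_succ (hp : M.IsCond (ω_ 2) p) (hα : α < ω_ 2) :
    α + 1 ∈ M.supp p ↔ ¬ M.Smooth p α := by
  constructor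
  · rintro ⟨r, u, hr, hb⟩ hs
    have hrc := hr.isCond hp
    have hlt := hr.bottom_lt hp
    rw [hb] at hlt
    have hs' := (hr.smooth_iff hp hlt).2 hs
    have hl := (bottom_spec hrc).2
    rw [hb] at hl
    have := bottom_le hrc hα (hl.of_smooth hrc hα hs')
    rw [hb] at this
    exact absurd (lt_add_one α) this.not_gt
  · intro hs
    obtain ⟨r, u, hr, hle, hlt⟩ := exists_descent hp (succ_lt_top hα)
    have hrc := hr.isCond hp
    refine ⟨r, u, hr, hle.antisymm ?_⟩
    by_contra! hlt'
    have hl := (lifts_iff hrc hα).2 (Order.lt_add_one_iff.1 hlt')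
    exact hs ((hr.smooth_iff hp hlt).1 (hl.smooth hrc hα))

theorem lt_top_of_mem_supp (hp : M.IsCond (ω_ 2) p) (h : α ∈ M.supp p) : α < ω_ 2 := by
  obtain ⟨r, u, hr, rfl⟩ := h
  exact (bottom_spec (hr.isCond hp)).1

theorem mem_supp_iff (hp : M.IsCond (ω_ 2) p) :
    α ∈ M.supp p ↔ α = 0 ∨ ∃ δ < ω_ 2, α = δ + 1 ∧ ¬ M.Smooth p δ := by
  constructor
  · intro h
    obtain ⟨r, u, hr, rfl⟩ := id h
    rcases bottom_cases (hr.isCond hp) with h0 | ⟨δ, hδ, h1⟩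
    · exact Or.inl h0
    · exact Or.inr ⟨δ, hδ, h1, (mem_supp_succ hp hδ).1 (h1 ▸ h)⟩
  · rintro (rfl | ⟨δ, hδ, rfl, h⟩)
    · exact zero_mem_supp hp
    · exact (mem_supp_succ hp hδ).2 h

theorem mem_rep (hp : M.IsCond (ω_ 2) p) :
    (α, q) ∈ M.rep p ↔ α ∈ M.supp p ∧ q = M.proj α p := by
  unfold rep
  rw [mem_sep_iff, mem_star hp]
  exact ⟨fun h => ⟨h.2, h.1.2⟩, fun h => ⟨⟨lt_top_of_mem_supp hp h.1, h.2⟩, h.1⟩⟩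

theorem supp_mono (hp : M.IsCond (ω_ 2) p) (hq : M.IsCond (ω_ 2) q) (h : p ⊆ q) :
    M.supp p ⊆ M.supp q := by
  intro α hα
  rw [mem_supp_iff hp] at hα
  rw [mem_supp_iff hq]
  exact hα.imp_right fun ⟨δ, h1, h2, h3⟩ => ⟨δ, h1, h2, fun h' => h3 (h'.mono h)⟩

theorem rep_le_of_subset (hp : M.IsCond (ω_ 2) p) (hq : M.IsCond (ω_ 2) q) (h : p ⊆ q) :
    (M.rep q).Le (M.rep p) := by
  rintro ⟨α, c⟩ hx
  obtain ⟨h1, rfl⟩ := (mem_rep hp).1 hx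
  exact ⟨M.proj α q, (mem_rep hq).2 ⟨supp_mono hp hq h h1, rfl⟩, proj_mono h⟩

/-- The support of `p` is bounded by any level from which `p` lifts. -/
theorem supp_le_of_lifts (hp : M.IsCond (ω_ 2) p) (h : M.Lifts β p) (hα : α ∈ M.supp p) :
    α ≤ β := by
  rcases (mem_supp_iff hp).1 hα with rfl | ⟨δ, hδ, rfl, hs⟩
  · exact bot_le
  · by_contra! hlt
    exact hs ((h.mono hp hδ.le (Order.lt_add_one_iff.1 hlt)).smooth hp hδ)

/-- The representation of `p` determines the values of `p` at all nodes. -/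
theorem exists_key_of_rep_le (hp : M.IsCond (ω_ 2) p) (hq : M.IsCond (ω_ 2) q)
    (h : (M.rep q).Le (M.rep p)) {e : (Ordinal.{0} × Ordinal.{0}) × Bool} (he : e ∈ p) :
    ∃ d ∈ q, M.key d.1 = M.key e.1 ∧ d.2 = e.2 := by
  have hδ := hp.snd_lt e he
  have hs : ¬ M.Smooth p (e.1.2 / ω) := by
    rintro ⟨b, -, h⟩
    exact (h e he (lt_add_one _)).1.false
  obtain ⟨c, hc, hsub⟩ := h _ ((mem_rep hp).2 ⟨(mem_supp_succ hp hδ).2 hs, rfl⟩)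
  obtain ⟨-, rfl⟩ := (mem_rep hq).1 hc
  obtain ⟨d, hd, -, h2, h3, h4⟩ :=
    mem_proj.1 (hsub (mem_proj_of_mem (M := M) he (lt_add_one (e.1.2 / ω))))
  refine ⟨d, hd, Prod.ext ?_ h3, h4⟩
  have h3 : d.1.2 = e.1.2 := h3
  simp only [key, h3]
  exact h2

/-- Cutting off the representation of `p` at `ρ` is the same as projecting `p` to level `ρ`. -/
theorem rep_proj (hp : M.IsCond (ω_ 2) p) (hρ : ρ < ω_ 2) :
    M.rep (M.proj ρ p) = {x ∈ M.rep p | x.1 ≤ ρ} := by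
  have hc := hp.proj le_rfl hρ.le
  have hc' := hc.of_le le_rfl hρ.le
  have hsupp : ∀ α ≤ ρ, (α ∈ M.supp (M.proj ρ p) ↔ α ∈ M.supp p) := by
    intro α hα
    rw [mem_supp_iff hc', mem_supp_iff hp]
    refine or_congr_right (exists_congr fun δ => and_congr_right fun hδ =>
      and_congr_right fun h => not_congr (smooth_proj hρ.le hp (h ▸ hα)))
  ext ⟨α, q⟩
  rw [mem_sep_iff, mem_rep hc', mem_rep hp]
  constructor
  · rintro ⟨h1, rfl⟩
    have hle := supp_le_of_lifts hc' (hc.lifts hρ.le) h1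
    exact ⟨⟨(hsupp α hle).1 h1, proj_proj le_rfl hρ.le hle hp⟩, hle⟩
  · rintro ⟨⟨h1, rfl⟩, hle⟩
    exact ⟨(hsupp α hle).2 h1, (proj_proj le_rfl hρ.le hle hp).symm⟩

end GapTwoMorass
end MorassForcing

namespace MorassForcing
namespace GapTwoMorass

variable {M : GapTwoMorass} {α β γ δ ξ ζ ρ θ θ' θ'' : Ordinal.{0}}
  {a u v : Ordinal.{0} → Ordinal.{0}} {f g : Emb} {p : Cond}

/-! ### Embeddings and the maps `f̄` -/

theorem θ_lt_top (hα : α < ω_ 1) : M.θ α < ω_ 2 :=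
  (M.θ_lt α hα).trans (omega_lt_omega.2 one_lt_two)

theorem θ_le_top (hα : α ≤ ω_ 1) : M.θ α ≤ ω_ 2 := by
  rcases hα.eq_or_lt with rfl | h
  · exact M.θ_top.le
  · exact (θ_lt_top h).le

theorem _root_.MorassForcing.IsEmbedding.base_lt_iff (hf : IsEmbedding M.φ M.G θ θ' f)
    (hξ : ξ ≤ θ) (hζ : ζ ≤ θ) : f.base ξ < f.base ζ ↔ ξ < ζ :=
  hf.base_strictMono.lt_iff_lt hξ hζ

theorem _root_.MorassForcing.IsEmbedding.base_le_iff (hf : IsEmbedding M.φ M.G θ θ' f)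
    (hξ : ξ ≤ θ) (hζ : ζ ≤ θ) : f.base ξ ≤ f.base ζ ↔ ξ ≤ ζ :=
  hf.base_strictMono.le_iff_le hξ hζ

theorem _root_.MorassForcing.IsEmbedding.base_le (hf : IsEmbedding M.φ M.G θ θ' f)
    (hζ : ζ ≤ θ) : f.base ζ ≤ θ' := by
  rw [← hf.base_top]; exact (hf.base_le_iff hζ le_rfl).2 hζ

theorem _root_.MorassForcing.IsEmbedding.base_lt (hf : IsEmbedding M.φ M.G θ θ' f)
    (hζ : ζ < θ) : f.base ζ < θ' := by
  rw [← hf.base_top]; exact (hf.base_lt_iff hζ.le le_rfl).2 hζ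

/-- An embedding acts on the extended set of morass maps. -/
theorem _root_.MorassForcing.IsEmbedding.exists_hom (hf : IsEmbedding M.φ M.G θ θ' f)
    (hθ : θ ≤ ω_ 2) (hθ' : θ' ≤ ω_ 2) (hζ : ζ ≤ θ) (ha : a ∈ M.hom ξ ζ) :
    ∃ a' ∈ M.hom (f.base ξ) (f.base ζ),
      (∀ τ < M.φ ξ, f.lvl ζ (a τ) = a' (f.lvl ξ τ)) ∧
      ∀ x < ξ, ∀ c ∈ M.G x ξ, f.arr x ζ (cut (M.φ x) (a ∘ c)) =
        cut (M.φ (f.base x)) (a' ∘ f.arr x ξ c) := by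
  rcases ha with ⟨hlt, ha⟩ | ⟨rfl, rfl⟩
  · exact ⟨_, hom_of_mem ((hf.base_lt_iff (hlt.le.trans hζ) hζ).2 hlt)
      (hf.arr_mem ξ ζ hlt hζ a ha), hf.comm ξ ζ hlt hζ a ha,
      fun x hx c hc => hf.arr_comp x ξ ζ hx hlt hζ c hc a ha⟩
  · refine ⟨_, id_mem_hom, fun τ hτ => ?_, fun x hx c hc => ?_⟩
    · rw [cut_apply _ hτ, cut_apply _ ((hf.lvl_map ξ hζ).lt τ hτ)]; rfl
    · have h1 := M.gapOne.maps x ξ hx (hζ.trans hθ) c hc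
      rw [← h1.eq_cut fun τ hτ => by rw [Function.comp, cut_apply _ (h1.lt τ hτ), id]]
      have h2 := M.gapOne.maps _ _ ((hf.base_lt_iff (hx.le.trans hζ) hζ).2 hx)
        ((hf.base_le hζ).trans hθ') _ (hf.arr_mem x ξ hx hζ c hc)
      exact h2.eq_cut fun τ hτ => by rw [Function.comp, cut_apply _ (h2.lt τ hτ), id]

/-- Embeddings commute with taking predecessors. -/
theorem _root_.MorassForcing.IsEmbedding.pr_lvl (hf : IsEmbedding M.φ M.G θ θ' f)
    (hθ : θ ≤ ω_ 2) (hθ' : θ' ≤ ω_ 2) (hζ : ζ ≤ θ) (hγ : γ < M.φ θ) :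
    M.pr (f.base ζ) (f.lvl θ γ) = f.lvl ζ (M.pr ζ γ) := by
  obtain ⟨b, hb, hbγ⟩ := exists_hom_pr hθ hζ hγ
  obtain ⟨b', hb', h1, -⟩ := hf.exists_hom hθ hθ' le_rfl hb
  have hlt := pr_lt hθ hζ hγ
  conv_lhs => rw [← hbγ]
  rw [h1 _ hlt]
  rw [hf.base_top] at hb'
  exact pr_map hθ' hb' ((hf.lvl_map ζ hζ).lt _ hlt)

theorem _root_.MorassForcing.IsEmbedding.lt_barBase (hf : IsEmbedding M.φ M.G θ θ' f)
    (hζ : ζ ≤ θ) (hξ : ξ < ζ) : f.base ξ < barBase f ζ :=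
  csInf_mem (s := {α | ∀ ξ < ζ, f.base ξ < α})
    ⟨f.base ζ, fun _ hx => (hf.base_lt_iff (hx.le.trans hζ) hζ).2 hx⟩ ξ hξ

theorem barBase_le_of_forall (h : ∀ ξ < ζ, f.base ξ < α) : barBase f ζ ≤ α := csInf_le' h

theorem _root_.MorassForcing.IsEmbedding.barBase_le (hf : IsEmbedding M.φ M.G θ θ' f)
    (hζ : ζ ≤ θ) : barBase f ζ ≤ f.base ζ :=
  barBase_le_of_forall fun _ hx => (hf.base_lt_iff (hx.le.trans hζ) hζ).2 hx

theorem exists_le_of_lt_barBase (h : ρ < barBase f ζ) : ∃ ξ < ζ, ρ ≤ f.base ξ := by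
  by_contra! hc
  exact absurd h (barBase_le_of_forall hc).not_gt

theorem barBase_zero : barBase f 0 = 0 :=
  le_antisymm (barBase_le_of_forall fun _ h => absurd h not_lt_bot) bot_le

theorem _root_.MorassForcing.IsEmbedding.barBase_succ (hf : IsEmbedding M.φ M.G θ θ' f)
    (hδ : δ < θ) : barBase f (δ + 1) = f.base δ + 1 := by
  refine le_antisymm (barBase_le_of_forall fun ξ h => ?_)
    (Order.add_one_le_of_lt (hf.lt_barBase (Order.add_one_le_of_lt hδ) (lt_add_one δ)))
  have h := Order.lt_add_one_iff.1 h
  exact Order.lt_add_one_iff.2 ((hf.base_le_iff (h.trans hδ.le) hδ.le).2 h)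

theorem isBarLvl_iff : M.IsBarLvl f ζ u ↔ IsOrdMap (M.φ ζ) (M.φ (barBase f ζ)) u ∧
    ∃ g ∈ M.hom (barBase f ζ) (f.base ζ), f.lvl ζ = cut (M.φ ζ) (g ∘ u) ∧
      ∀ ξ < ζ, ∀ b ∈ M.G ξ ζ, ∃ c ∈ M.G (f.base ξ) (barBase f ζ),
        f.arr ξ ζ b = cut (M.φ (f.base ξ)) (g ∘ c) := by
  refine and_congr_right fun _ => exists_congr fun g => and_congr_left fun _ => ?_
  exact or_congr_right (and_congr_right fun h => by rw [h])

/-- If `f` is continuous at `ζ`, then `f̄_ζ = f_ζ`. -/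
theorem _root_.MorassForcing.IsEmbedding.isBarLvl_of_eq (hf : IsEmbedding M.φ M.G θ θ' f)
    (hθ' : θ' ≤ ω_ 2) (hζ : ζ ≤ θ) (h : barBase f ζ = f.base ζ) : M.IsBarLvl f ζ (f.lvl ζ) := by
  rw [isBarLvl_iff, h]
  refine ⟨hf.lvl_map ζ hζ, _, id_mem_hom, ?_, fun ξ hξ b hb => ?_⟩
  · exact (hf.lvl_map ζ hζ).eq_cut fun τ hτ => by
      rw [Function.comp, cut_apply _ ((hf.lvl_map ζ hζ).lt τ hτ), id]
  · have hm := hf.arr_mem ξ ζ hξ hζ b hb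
    have h2 := M.gapOne.maps _ _ ((hf.base_lt_iff (hξ.le.trans hζ) hζ).2 hξ)
      ((hf.base_le hζ).trans hθ') _ hm
    exact ⟨_, hm, h2.eq_cut fun τ hτ => by rw [Function.comp, cut_apply _ (h2.lt τ hτ), id]⟩

theorem _root_.MorassForcing.IsEmbedding.barBase_of_id (hf : IsEmbedding M.φ M.G θ θ' f)
    (hζ : ζ ≤ θ) (h : ∀ ξ < ζ, f.base ξ = ξ) : barBase f ζ = ζ := by
  refine le_antisymm (barBase_le_of_forall fun ξ hξ => by rwa [h ξ hξ]) ?_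
  by_contra! hlt
  have := hf.lt_barBase hζ hlt
  rw [h _ hlt] at this
  exact lt_irrefl _ this

/-- If `f` is the identity below `ζ` and `f_ζ` is a morass map, then `f̄_ζ` is the identity. -/
theorem _root_.MorassForcing.IsEmbedding.isBarLvl_of_id (hf : IsEmbedding M.φ M.G θ θ' f)
    (hθ' : θ' ≤ ω_ 2) (hζ : ζ ≤ θ) (h : ∀ ξ < ζ, f.base ξ = ξ)
    (h' : ∀ ξ < ζ, ∀ τ < M.φ ξ, f.lvl ξ τ = τ) (hm : f.lvl ζ ∈ M.hom ζ (f.base ζ)) :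
    M.IsBarLvl f ζ (cut (M.φ ζ) id) := by
  rw [isBarLvl_iff, hf.barBase_of_id hζ h]
  refine ⟨isOrdMap_id le_rfl, _, hm, ?_, fun ξ hξ b hb => ⟨b, by rwa [h ξ hξ], ?_⟩⟩
  · exact (hf.lvl_map ζ hζ).eq_cut fun τ hτ => by rw [Function.comp, cut_apply _ hτ, id]
  · have h2 := M.gapOne.maps _ _ ((hf.base_lt_iff (hξ.le.trans hζ) hζ).2 hξ)
      ((hf.base_le hζ).trans hθ') _ (hf.arr_mem ξ ζ hξ hζ b hb)
    refine h2.eq_cut fun τ hτ => ?_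
    rw [h ξ hξ] at hτ
    have := hf.comm ξ ζ hξ hζ b hb τ hτ
    rw [h' ξ hξ τ hτ] at this
    exact this.symm

theorem exists_isBarLvl_left (hθ : θ < θ') (hθ' : θ' ≤ ω_ 2)
    (hf : IsLeftBranching M.φ M.G θ θ' f) (hζ : ζ ≤ θ) : ∃ u, M.IsBarLvl f ζ u := by
  rcases hζ.eq_or_lt with rfl | hlt
  · refine ⟨_, hf.emb.isBarLvl_of_id hθ' le_rfl hf.base_eq hf.lvl_eq ?_⟩
    rw [hf.emb.base_top]
    exact hom_of_mem hθ hf.lvl_top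
  · refine ⟨_, hf.emb.isBarLvl_of_eq hθ' hζ ?_⟩
    rw [hf.base_eq ζ hlt]
    exact hf.emb.barBase_of_id hζ fun ξ hξ => hf.base_eq ξ (hξ.trans hlt)

theorem exists_isBarLvl_right (hθ' : θ' ≤ ω_ 2)
    (hf : IsRightBranching M.φ M.G θ θ' f) (hζ : ζ ≤ θ) : ∃ u, M.IsBarLvl f ζ u := by
  obtain ⟨η, hη, h1, h2, h3, -, h5, -⟩ := hf.branch
  have hη' : f.base η = θ := by
    have := h2 0 (by rw [add_zero]; exact hη.le)
    rwa [add_zero, add_zero] at this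
  rcases lt_trichotomy ζ η with hlt | rfl | hlt
  · refine ⟨_, hf.emb.isBarLvl_of_eq hθ' hζ ?_⟩
    rw [h1 ζ hlt]
    exact hf.emb.barBase_of_id hζ fun ξ hξ => h1 ξ (hξ.trans hlt)
  · refine ⟨_, hf.emb.isBarLvl_of_id hθ' hζ h1 h3 ?_⟩
    rw [hη']
    exact hom_of_mem hη h5
  · refine ⟨_, hf.emb.isBarLvl_of_eq hθ' hζ ((hf.emb.barBase_le hζ).antisymm ?_)⟩
    by_contra! hlt'
    obtain ⟨x, rfl⟩ := exists_add_of_le hlt.le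
    have hθb := hf.emb.lt_barBase hζ hlt
    rw [hη'] at hθb
    obtain ⟨y, hy⟩ := exists_add_of_le hθb.le
    rw [h2 x hζ, hy] at hlt'
    have hyx : y < x := lt_of_add_lt_add_left hlt'
    have := hf.emb.lt_barBase hζ (add_lt_add_right hyx η)
    rw [h2 y ((add_le_add_right hyx.le η).trans hζ), hy] at this
    exact lt_irrefl _ this

theorem comp_base (hζ : ζ ≤ θ) : (Emb.comp M.φ M.G θ f g).base ζ = f.base (g.base ζ) := if_pos hζ

theorem comp_lvl (hζ : ζ ≤ θ) {τ : Ordinal.{0}} (hτ : τ < M.φ ζ) :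
    (Emb.comp M.φ M.G θ f g).lvl ζ τ = f.lvl (g.base ζ) (g.lvl ζ τ) := by
  simp only [Emb.comp]
  rw [if_pos hζ, cut_apply _ hτ]; rfl

theorem barBase_comp (hf : IsEmbedding M.φ M.G θ' θ'' f) (hg : IsEmbedding M.φ M.G θ θ' g)
    (hζ : ζ ≤ θ) : barBase (Emb.comp M.φ M.G θ f g) ζ = barBase f (barBase g ζ) := by
  have hb := (hg.barBase_le hζ).trans (hg.base_le hζ)
  refine le_antisymm (barBase_le_of_forall fun ξ hξ => ?_) (barBase_le_of_forall fun κ hκ => ?_)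
  · rw [comp_base (hξ.le.trans hζ)]
    exact hf.lt_barBase hb (hg.lt_barBase hζ hξ)
  · obtain ⟨ξ, hξ, hle⟩ := exists_le_of_lt_barBase hκ
    have hlt : (Emb.comp M.φ M.G θ f g).base ξ < barBase (Emb.comp M.φ M.G θ f g) ζ := by
      refine csInf_mem (s := {α | ∀ ξ < ζ, (Emb.comp M.φ M.G θ f g).base ξ < α})
        ⟨f.base (g.base ζ), fun x hx => ?_⟩ ξ hξ
      rw [comp_base (hx.le.trans hζ)]
      exact (hf.base_lt_iff (hg.base_le (hx.le.trans hζ)) (hg.base_le hζ)).2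
        ((hg.base_lt_iff (hx.le.trans hζ) hζ).2 hx)
    refine lt_of_le_of_lt ?_ hlt
    rw [comp_base (hξ.le.trans hζ)]
    exact (hf.base_le_iff (hκ.le.trans hb) (hg.base_le (hξ.le.trans hζ))).2 hle

theorem exists_isBarLvl_comp (hθ' : θ' ≤ ω_ 2) (hθ'' : θ'' ≤ ω_ 2)
    (hf : IsEmbedding M.φ M.G θ' θ'' f) (hg : IsEmbedding M.φ M.G θ θ' g) (hζ : ζ ≤ θ)
    (hu : M.IsBarLvl g ζ u) (hv : M.IsBarLvl f (barBase g ζ) v) :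
    ∃ w, M.IsBarLvl (Emb.comp M.φ M.G θ f g) ζ w := by
  obtain ⟨hum, a, ha, hua, huc⟩ := isBarLvl_iff.1 hu
  obtain ⟨hvm, k, hk, hvk, hvc⟩ := isBarLvl_iff.1 hv
  have hgζ := hg.base_le hζ
  obtain ⟨a', ha', h1, h2⟩ := hf.exists_hom hθ' hθ'' hgζ ha
  have hfg := (hf.base_le hgζ).trans hθ''
  have hb := (hg.barBase_le hζ).trans hgζ
  refine ⟨cut (M.φ ζ) (v ∘ u), ?_⟩
  rw [isBarLvl_iff, barBase_comp hf hg hζ, comp_base hζ]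
  refine ⟨hvm.comp hum, _, hom_comp hfg ha' hk, ?_, fun ξ hξ b hbm => ?_⟩
  · have hm : IsOrdMap (M.φ ζ) (M.φ (f.base (g.base ζ))) ((Emb.comp M.φ M.G θ f g).lvl ζ) := by
      simp only [Emb.comp]
      rw [if_pos hζ]
      exact (hf.lvl_map _ hgζ).comp (hg.lvl_map ζ hζ)
    refine hm.eq_cut fun τ hτ => ?_
    have hlt := hum.lt τ hτ
    rw [comp_lvl hζ hτ, hua, cut_apply _ hτ, Function.comp, h1 _ hlt, hvk, cut_apply _ hlt]
    simp only [Function.comp]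
    rw [cut_apply _ hτ, Function.comp, cut_apply _ (hvm.lt _ hlt), Function.comp]
  · obtain ⟨c, hc, hgb⟩ := huc ξ hξ b hbm
    have hξθ := hξ.le.trans hζ
    obtain ⟨c', hc', hfc⟩ := hvc (g.base ξ) (hg.lt_barBase hζ hξ) c hc
    rw [comp_base hξθ]
    refine ⟨c', hc', ?_⟩
    have hlt : f.base (g.base ξ) < barBase f (barBase g ζ) :=
      hf.lt_barBase hb (hg.lt_barBase hζ hξ)
    have hc'm := M.gapOne.maps _ _ hlt ((le_of_hom hk).trans
      ((hf.base_le hb).trans hθ'')) c' hc'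
    have : (Emb.comp M.φ M.G θ f g).arr ξ ζ b = f.arr (g.base ξ) (g.base ζ) (g.arr ξ ζ b) := by
      simp only [Emb.comp]
      rw [if_pos ⟨hξ, hζ, hbm⟩]
    rw [this, hgb, h2 _ (hg.lt_barBase hζ hξ) c hc, hfc]
    funext τ
    rcases lt_or_ge τ (M.φ (f.base (g.base ξ))) with hτ | hτ
    · rw [cut_apply _ hτ, cut_apply _ hτ, Function.comp, Function.comp, cut_apply _ hτ,
        Function.comp, cut_apply _ (hc'm.lt τ hτ)]
      rfl
    · rw [cut_of_le _ hτ, cut_of_le _ hτ]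

theorem succ_le_omega_one (h : α < ω_ 1) : α + 1 ≤ ω_ 1 := Order.add_one_le_of_lt h

theorem F_decomp (hγ : γ ≤ ω_ 1) (hα : α < β) (hβ : β < γ) (hf : f ∈ M.F α γ) :
    ∃ g ∈ M.F β γ, ∃ h ∈ M.F α β, f = Emb.comp M.φ M.G (M.θ α) g h := by
  rw [M.comp α β γ hα hβ hγ] at hf
  exact hf

theorem F_succ (hα : α < ω_ 1) (hf : f ∈ M.F α (α + 1)) :
    IsLeftBranching M.φ M.G (M.θ α) (M.θ (α + 1)) f ∨
      IsRightBranching M.φ M.G (M.θ α) (M.θ (α + 1)) f := by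
  obtain ⟨h, hh, hF⟩ := M.amalgamation α hα
  rw [hF] at hf
  rcases hf with hf | rfl
  · exact Or.inl hf
  · exact Or.inr hh

theorem exists_right (hα : α < ω_ 1) : ∃ h ∈ M.F α (α + 1),
    IsRightBranching M.φ M.G (M.θ α) (M.θ (α + 1)) h := by
  obtain ⟨h, hh, hF⟩ := M.amalgamation α hα
  exact ⟨h, by rw [hF]; simp, hh⟩

theorem θ_lt_succ (hα : α < ω_ 1) : M.θ α < M.θ (α + 1) := by
  obtain ⟨h, -, hh⟩ := exists_right (M := M) hα
  obtain ⟨η, hη, -, h2, -⟩ := hh.branch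
  have := h2 0 (by rw [add_zero]; exact hη.le)
  rw [add_zero, add_zero] at this
  rw [← this]
  exact hh.emb.base_lt hη

/-- The maps `f̄_ζ` exist. At a limit level, `f` factors through an embedding that is continuous
at the relevant place, because `f̄(ζ)` lies in the range of some embedding. -/
theorem exists_isBarLvl (hβ : β ≤ ω_ 1) (hα : α < β) (hf : f ∈ M.F α β) (hζ : ζ ≤ M.θ α) :
    ∃ u, M.IsBarLvl f ζ u := by
  induction β using Ordinal.limitRecOn generalizing f α ζ with
  | zero => exact absurd hα not_lt_bot
  | add_one β ih =>
    have hβ1 : β < ω_ 1 := (lt_add_one β).trans_le hβ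
    have hstep : ∀ f ∈ M.F β (β + 1), ∀ ζ ≤ M.θ β, ∃ u, M.IsBarLvl f ζ u := by
      intro f hf ζ hζ
      rcases F_succ hβ1 hf with h | h
      · exact exists_isBarLvl_left (θ_lt_succ hβ1) (θ_le_top hβ) h hζ
      · exact exists_isBarLvl_right (θ_le_top hβ) h hζ
    rcases (Order.lt_add_one_iff.1 hα).eq_or_lt with rfl | hlt
    · exact hstep f hf ζ hζ
    obtain ⟨g, hg, k, hk, rfl⟩ := F_decomp hβ hlt (lt_add_one β) hf
    have hge := M.emb _ _ (lt_add_one β) hβ g hg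
    have hke := M.emb _ _ hlt hβ1.le k hk
    obtain ⟨u, hu⟩ := ih hβ1.le hlt hk hζ
    obtain ⟨v, hv⟩ := hstep g hg _ ((hke.barBase_le hζ).trans (hke.base_le hζ))
    exact exists_isBarLvl_comp (θ_le_top hβ1.le) (θ_le_top hβ) hge hke hζ hu hv
  | limit β hl ih =>
    have hfe := M.emb _ _ hα hβ f hf
    rcases (hfe.barBase_le hζ).eq_or_lt with heq | hlt
    · exact ⟨_, hfe.isBarLvl_of_eq (θ_le_top hβ) hζ heq⟩
    obtain ⟨γ, hγ, k, hk, x', hx', hkx⟩ :=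
      M.cover_base β hβ hl _ (hlt.trans_le (hfe.base_le hζ))
    obtain ⟨η, h1, h2, h3, g, hg, j, hj, i, hi, rfl, rfl⟩ :=
      M.amalg β hβ hl α hα γ hγ f hf k hk
    have hη := h3.le.trans hβ
    have hge := M.emb _ _ h3 hβ g hg
    have hje := M.emb _ _ h1 hη j hj
    have hie := M.emb _ _ h2 hη i hi
    obtain ⟨u, hu⟩ := ih η h3 hη h1 hj hζ
    have hb := (hje.barBase_le hζ).trans (hje.base_le hζ)
    refine exists_isBarLvl_comp (θ_le_top hη) (θ_le_top hβ) hge hje hζ hu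
      (hge.isBarLvl_of_eq (θ_le_top hβ) hb ((hge.barBase_le hb).antisymm ?_))
    rw [barBase_comp hge hje hζ, comp_base hx'.le] at hkx
    rw [← hkx, hge.base_le_iff hb (hie.base_le hx'.le)]
    refine barBase_le_of_forall fun ξ hξ => ?_
    rw [← hge.base_lt_iff (hje.base_le (hξ.le.trans hζ)) (hie.base_le hx'.le), hkx]
    exact hge.lt_barBase hb (hje.lt_barBase hζ hξ)

theorem isBarLvl_barLvl (hβ : β ≤ ω_ 1) (hα : α < β) (hf : f ∈ M.F α β) (hζ : ζ ≤ M.θ α) :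
    M.IsBarLvl f ζ (M.barLvl f ζ) :=
  Classical.epsilon_spec (exists_isBarLvl hβ hα hf hζ)

theorem pr_barBase (hβ : β ≤ ω_ 1) (hα : α < β) (hf : f ∈ M.F α β) (hζ : ζ ≤ M.θ α)
    (hγ : γ < M.φ (M.θ α)) :
    M.pr (barBase f ζ) (f.lvl (M.θ α) γ) = M.barLvl f ζ (M.pr ζ γ) := by
  obtain ⟨hm, g, hg, he, -⟩ := isBarLvl_iff.1 (isBarLvl_barLvl hβ hα hf hζ)
  have hfe := M.emb _ _ hα hβ f hf
  have hθ := θ_le_top (M := M) hβ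
  have hθα := θ_le_top (M := M) (hα.le.trans hβ)
  have hlt := pr_lt hθα hζ hγ
  rw [← pr_pr hθ (hfe.base_le hζ) (hfe.barBase_le hζ)
    (by have := (hfe.lvl_map _ le_rfl).lt γ hγ; rwa [hfe.base_top] at this),
    hfe.pr_lvl hθα hθ hζ hγ, he, cut_apply _ hlt, Function.comp]
  exact pr_map ((hfe.base_le hζ).trans hθ) hg (hm.lt _ hlt)

/-! ### The action of the embeddings on points and conditions -/

variable (M) in
/-- `x` is an element of `φ_{θ_α} × ωθ_α`. -/
def IsPt (α : Ordinal.{0}) (x : Ordinal.{0} × Ordinal.{0}) : Prop :=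
  x.1 < M.φ (M.θ α) ∧ x.2 / ω < M.θ α

variable (M) in
/-- The map `f_{θ_α} ⊗ f` on points. -/
noncomputable def act (f : Emb) (α : Ordinal.{0}) (x : Ordinal.{0} × Ordinal.{0}) :
    Ordinal.{0} × Ordinal.{0} :=
  (f.lvl (M.θ α) x.1, ω * f.base (x.2 / ω) + x.2 % ω)

theorem tensor_eq (e : (Ordinal.{0} × Ordinal.{0}) × Bool) :
    tensor (f.lvl (M.θ α)) f.base e = (M.act f α e.1, e.2) := rfl

theorem act_snd_div (x : Ordinal.{0} × Ordinal.{0}) : (M.act f α x).2 / ω = f.base (x.2 / ω) :=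
  omega_mul_add_div _ _

theorem act_snd_mod (x : Ordinal.{0} × Ordinal.{0}) : (M.act f α x).2 % ω = x.2 % ω :=
  omega_mul_add_mod _ _

theorem eq_of_div_mod {μ μ' : Ordinal.{0}} (h : μ / ω = μ' / ω) (h' : μ % ω = μ' % ω) :
    μ = μ' := by
  rw [← Ordinal.div_add_mod μ ω, ← Ordinal.div_add_mod μ' ω, h, h']


theorem isPt_act (hβ : β ≤ ω_ 1) (hα : α < β) (hf : f ∈ M.F α β)
    {x : Ordinal.{0} × Ordinal.{0}} (hx : M.IsPt α x) : M.IsPt β (M.act f α x) := by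
  have hfe := M.emb _ _ hα hβ f hf
  refine ⟨?_, ?_⟩
  · have := (hfe.lvl_map _ le_rfl).lt _ hx.1
    rwa [hfe.base_top] at this
  · rw [act_snd_div]
    exact hfe.base_lt hx.2

theorem act_snd_inj (hf : IsEmbedding M.φ M.G (M.θ α) θ' f) {x y : Ordinal.{0} × Ordinal.{0}}
    (hx : M.IsPt α x) (hy : M.IsPt α y) (h : (M.act f α x).2 = (M.act f α y).2) : x.2 = y.2 := by
  refine eq_of_div_mod (hf.base_strictMono.injOn hx.2.le hy.2.le ?_) ?_
  · rw [← act_snd_div (M := M) (α := α), ← act_snd_div (M := M) (α := α), h]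
  · rw [← act_snd_mod (M := M) (f := f) (α := α) x, ← act_snd_mod (M := M) (f := f) (α := α) y, h]

theorem act_inj (hf : IsEmbedding M.φ M.G (M.θ α) θ' f) {x y : Ordinal.{0} × Ordinal.{0}}
    (hx : M.IsPt α x) (hy : M.IsPt α y) (h : M.act f α x = M.act f α y) : x = y :=
  Prod.ext ((hf.lvl_map _ le_rfl).inj hx.1 hy.1 (Prod.ext_iff.1 h).1)
    (act_snd_inj hf hx hy (Prod.ext_iff.1 h).2)

theorem key_act (hβ : β ≤ ω_ 1) (hα : α < β) (hf : f ∈ M.F α β)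
    {x : Ordinal.{0} × Ordinal.{0}} (hx : M.IsPt α x) :
    M.key (M.act f α x) =
      (M.barLvl f (x.2 / ω + 1) (M.pr (x.2 / ω + 1) x.1), (M.act f α x).2) := by
  have hfe := M.emb _ _ hα hβ f hf
  have := pr_barBase hβ hα hf (Order.add_one_le_of_lt hx.2) hx.1
  rw [hfe.barBase_succ hx.2] at this
  unfold key
  rw [act_snd_div]
  exact Prod.ext this rfl

theorem key_act_iff (hβ : β ≤ ω_ 1) (hα : α < β) (hf : f ∈ M.F α β)
    {x y : Ordinal.{0} × Ordinal.{0}} (hx : M.IsPt α x) (hy : M.IsPt α y) :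
    M.key (M.act f α x) = M.key (M.act f α y) ↔ M.key x = M.key y := by
  have hfe := M.emb _ _ hα hβ f hf
  rw [key_act hβ hα hf hx, key_act hβ hα hf hy]
  constructor
  · intro h
    have h2 := act_snd_inj hfe hx hy (Prod.ext_iff.1 h).2
    have h1 := (Prod.ext_iff.1 h).1
    simp only [h2] at h1
    refine Prod.ext ?_ h2
    simp only [key, h2]
    have hθ := θ_le_top (M := M) (hα.le.trans hβ)
    have hle := Order.add_one_le_of_lt hy.2
    obtain ⟨hm, -⟩ := isBarLvl_barLvl hβ hα hf hle
    exact hm.inj (pr_lt hθ hle hx.1) (pr_lt hθ hle hy.1) h1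
  · intro h
    have h2 : x.2 = y.2 := (Prod.ext_iff.1 h).2
    have h1 : M.pr _ x.1 = M.pr _ y.1 := (Prod.ext_iff.1 h).1
    rw [h2] at h1
    simp only [act, h2, h1]

theorem act_comp (hγ : γ ≤ ω_ 1) (hα : α < β) (hβ : β < γ) (hg : g ∈ M.F α β)
    {x : Ordinal.{0} × Ordinal.{0}} (hx : M.IsPt α x) :
    M.act (Emb.comp M.φ M.G (M.θ α) f g) α x = M.act f β (M.act g α x) := by
  have hge := M.emb _ _ hα (hβ.le.trans hγ) g hg
  refine Prod.ext ?_ ?_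
  · simp only [act]
    rw [comp_lvl le_rfl hx.1, hge.base_top]
  · change ω * (Emb.comp M.φ M.G (M.θ α) f g).base (x.2 / ω) + x.2 % ω =
      ω * f.base ((M.act g α x).2 / ω) + (M.act g α x).2 % ω
    rw [act_snd_div, act_snd_mod, comp_base hx.2.le]

theorem IsCond.isPt (hp : M.IsCond (M.θ α) p) {e : (Ordinal.{0} × Ordinal.{0}) × Bool}
    (he : e ∈ p) : M.IsPt α e.1 := ⟨hp.fst_lt e he, hp.snd_lt e he⟩

theorem IsCond.tensorPush (hβ : β ≤ ω_ 1) (hα : α < β) (hf : f ∈ M.F α β)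
    (hp : M.IsCond (M.θ α) p) : M.IsCond (M.θ β) (tensorPush (f.lvl (M.θ α)) f.base p) where
  finite := hp.finite.image _
  fst_lt := by
    rintro _ ⟨e, he, rfl⟩
    exact (isPt_act hβ hα hf (hp.isPt he)).1
  snd_lt := by
    rintro _ ⟨e, he, rfl⟩
    exact (isPt_act hβ hα hf (hp.isPt he)).2
  coherent := by
    rintro _ ⟨e, he, rfl⟩ _ ⟨e', he', rfl⟩ h
    exact hp.coherent e he e' he' ((key_act_iff hβ hα hf (hp.isPt he) (hp.isPt he')).1 h)

/-- The maps `b ∈ G δ (δ + 1)` and the maps `b' ∈ G (f δ) (f δ + 1)` correspond to each other under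
`f̄_{δ+1}`: the two maps in `G δ (δ + 1)` differ somewhere, so they correspond to different maps. -/
theorem exists_hom_succ (hβ : β ≤ ω_ 1) (hα : α < β) (hf : f ∈ M.F α β) (hδ : δ < M.θ α) :
    (∀ b ∈ M.hom δ (δ + 1), ∃ b' ∈ M.hom (f.base δ) (f.base δ + 1),
      ∀ τ < M.φ δ, M.barLvl f (δ + 1) (b τ) = b' (f.lvl δ τ)) ∧
    (∀ b' ∈ M.hom (f.base δ) (f.base δ + 1), ∃ b ∈ M.hom δ (δ + 1),
      ∀ τ < M.φ δ, M.barLvl f (δ + 1) (b τ) = b' (f.lvl δ τ)) := by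
  have hfe := M.emb _ _ hα hβ f hf
  have hθ := θ_le_top (M := M) hβ
  have hθα := θ_le_top (M := M) (hα.le.trans hβ)
  have hle := Order.add_one_le_of_lt hδ
  have hδ2 : δ < ω_ 2 := hδ.trans_le hθα
  have hfδ : f.base δ < ω_ 2 := (hfe.base_lt hδ).trans_le hθ
  obtain ⟨hm, g, hg, he, harr⟩ := isBarLvl_iff.1 (isBarLvl_barLvl hβ hα hf hle)
  rw [hfe.barBase_succ hδ] at hm hg harr
  have hgm := isOrdMap_of_hom ((hfe.base_le hle).trans hθ) hg
  have hfwd : ∀ b ∈ M.hom δ (δ + 1), ∃ b' ∈ M.hom (f.base δ) (f.base δ + 1),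
      ∀ τ < M.φ δ, M.barLvl f (δ + 1) (b τ) = b' (f.lvl δ τ) := by
    intro b hb
    have hbG := mem_of_hom (lt_add_one δ) hb
    obtain ⟨c, hc, hbc⟩ := harr δ (lt_add_one δ) b hbG
    have hc' := hom_of_mem (lt_add_one _) hc
    refine ⟨c, hc', fun τ hτ => ?_⟩
    have hbτ := (isOrdMap_of_hom (hle.trans hθα) hb).lt τ hτ
    have hfτ := (hfe.lvl_map δ hδ.le).lt τ hτ
    have h1 := hfe.comm δ (δ + 1) (lt_add_one δ) hle b hbG τ hτ
    rw [he, hbc, cut_apply _ hbτ, cut_apply _ hfτ] at h1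
    exact hgm.inj (hm.lt _ hbτ)
      ((isOrdMap_of_hom (succ_lt_top hfδ).le hc').lt _ hfτ) h1
  refine ⟨hfwd, ?_⟩
  obtain ⟨c₁, hc₁, h₁⟩ := hfwd _ (id_mem_succ hδ2)
  obtain ⟨c₂, hc₂, h₂⟩ := hfwd _ (splitMap_mem hδ2)
  have hne : c₁ ≠ c₂ := by
    rintro rfl
    obtain ⟨τ, hτ, hlt⟩ := exists_splitMap_ne (M := M) hδ2
    have hid := isOrdMap_of_hom (hle.trans hθα) (id_mem_succ (M := M) hδ2)
    have hsp := isOrdMap_of_hom (hle.trans hθα) (splitMap_mem (M := M) hδ2)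
    have h3 := hm.inj (hid.lt τ hτ) (hsp.lt τ hτ) ((h₁ τ hτ).trans (h₂ τ hτ).symm)
    rw [cut_apply _ hτ, id] at h3
    rw [← h3] at hlt
    exact absurd hτ hlt.not_gt
  intro b' hb'
  by_cases h1 : b' = c₁
  · exact ⟨_, id_mem_succ hδ2, h1 ▸ h₁⟩
  · refine ⟨_, splitMap_mem hδ2, ?_⟩
    have : b' = c₂ := by
      rcases hom_succ hfδ hb' with h | h <;> rcases hom_succ hfδ hc₁ with h' | h' <;>
        rcases hom_succ hfδ hc₂ with h'' | h'' <;> simp_all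
    exact this ▸ h₂

theorem smooth_tensorPush_base (hβ : β ≤ ω_ 1) (hα : α < β) (hf : f ∈ M.F α β)
    (hp : M.IsCond (M.θ α) p) (hδ : δ < M.θ α) :
    M.Smooth (tensorPush (f.lvl (M.θ α)) f.base p) (f.base δ) ↔ M.Smooth p δ := by
  have hfe := M.emb _ _ hα hβ f hf
  have hθ := θ_le_top (M := M) hβ
  have hθα := θ_le_top (M := M) (hα.le.trans hβ)
  have hle := Order.add_one_le_of_lt hδ
  obtain ⟨h1, h2⟩ := exists_hom_succ hβ hα hf hδ
  obtain ⟨hm, -⟩ := isBarLvl_barLvl hβ hα hf hle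
  have e1 : ∀ e ∈ p, M.pr (f.base δ + 1) (M.act f α e.1).1 =
      M.barLvl f (δ + 1) (M.pr (δ + 1) e.1.1) := fun e he => by
    rw [← hfe.barBase_succ hδ]; exact pr_barBase hβ hα hf hle (hp.fst_lt e he)
  have e2 : ∀ e ∈ p, M.pr (f.base δ) (M.act f α e.1).1 = f.lvl δ (M.pr δ e.1.1) :=
    fun e he => hfe.pr_lvl hθα hθ hδ.le (hp.fst_lt e he)
  have e3 : ∀ e ∈ p, ((M.act f α e.1).2 / ω < f.base δ ↔ e.1.2 / ω < δ) := fun e he => by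
    rw [act_snd_div, hfe.base_lt_iff (hp.snd_lt e he).le hδ.le]
  have e4 : ∀ e ∈ p, ((M.act f α e.1).2 / ω < f.base δ + 1 ↔ e.1.2 / ω < δ + 1) :=
    fun e he => by
      rw [act_snd_div, Order.lt_add_one_iff, Order.lt_add_one_iff,
        hfe.base_le_iff (hp.snd_lt e he).le hδ.le]
  constructor
  · rintro ⟨b', hb', hs⟩
    obtain ⟨b, hb, hbb⟩ := h2 b' hb'
    refine ⟨b, hb, fun e he hlt => ?_⟩
    obtain ⟨h3, h4⟩ := hs _ (mem_image_of_mem _ he) ((e4 e he).2 hlt)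
    have hpr := pr_lt hθα hδ.le (hp.fst_lt e he)
    rw [tensor_eq, e1 e he, e2 e he, ← hbb _ hpr] at h4
    exact ⟨(e3 e he).1 h3, hm.inj (pr_lt hθα hle (hp.fst_lt e he))
      ((isOrdMap_of_hom (hle.trans hθα) hb).lt _ hpr) h4⟩
  · rintro ⟨b, hb, hs⟩
    obtain ⟨b', hb', hbb⟩ := h1 b hb
    refine ⟨b', hb', ?_⟩
    rintro _ ⟨e, he, rfl⟩ hlt
    obtain ⟨h3, h4⟩ := hs e he ((e4 e he).1 hlt)
    refine ⟨(e3 e he).2 h3, ?_⟩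
    have hpr := pr_lt hθα hδ.le (hp.fst_lt e he)
    rw [tensor_eq, e1 e he, e2 e he, ← hbb _ hpr, h4]

/-- Outside the range of `f` nothing happens to the image of a condition under `f`. -/
theorem smooth_tensorPush_of_notMem (hβ : β ≤ ω_ 1) (hα : α < β) (hf : f ∈ M.F α β)
    (hp : M.IsCond (M.θ α) p) (hρ2 : ρ < ω_ 2) (hρ : ∀ δ < M.θ α, f.base δ ≠ ρ) :
    M.Smooth (tensorPush (f.lvl (M.θ α)) f.base p) ρ := by
  have hfe := M.emb _ _ hα hβ f hf
  have hθ := θ_le_top (M := M) hβ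
  have hθα := θ_le_top (M := M) (hα.le.trans hβ)
  have hc := hp.tensorPush hβ hα hf
  rcases le_or_gt (M.θ β) ρ with h | h
  · have := hc.of_le hρ2.le h
    exact (this.lifts hρ2.le).smooth (this.of_le le_rfl hρ2.le) hρ2
  -- The least `ζ` with `ρ < f ζ` satisfies `f̄ ζ ≤ ρ < f ζ`.
  have hne : {ζ | ζ ≤ M.θ α ∧ ρ < f.base ζ}.Nonempty := ⟨M.θ α, le_rfl, by rwa [hfe.base_top]⟩
  obtain ⟨hζ, hlt⟩ := csInf_mem hne
  have hmin : ∀ ξ < sInf {ζ | ζ ≤ M.θ α ∧ ρ < f.base ζ}, f.base ξ < ρ := by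
    intro ξ hξ
    have h1 : ¬ ρ < f.base ξ := fun h' => notMem_of_lt_csInf' hξ ⟨hξ.le.trans hζ, h'⟩
    exact (not_lt.1 h1).lt_of_ne (hρ ξ (hξ.trans_le hζ))
  generalize sInf {ζ | ζ ≤ M.θ α ∧ ρ < f.base ζ} = ζ at hζ hlt hmin
  have hbar : barBase f ζ ≤ ρ := barBase_le_of_forall hmin
  obtain ⟨hm, g, hg, he, -⟩ := isBarLvl_iff.1 (isBarLvl_barLvl hβ hα hf hζ)
  have hfζ := (hfe.base_le hζ).trans hθ
  have hρ1 := Order.add_one_le_of_lt hlt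
  obtain ⟨k, hk, d, hd, hgd⟩ := hom_decomp hfζ (hbar.trans (lt_add_one ρ).le) hρ1 hg
  have hρ3 := hρ1.trans hfζ
  obtain ⟨b, hb, c, hc', hdc⟩ := hom_decomp hρ3 hbar (lt_add_one ρ).le hd
  refine ⟨b, hb, ?_⟩
  rintro _ ⟨e, hep, rfl⟩ hlt'
  rw [tensor_eq] at hlt' ⊢
  refine ⟨?_, ?_⟩
  · rw [act_snd_div] at hlt' ⊢
    exact (Order.lt_add_one_iff.1 hlt').lt_of_ne (hρ _ (hp.snd_lt e hep))
  · have hγ := hp.fst_lt e hep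
    have hν := pr_lt hθα hζ hγ
    have hu := hm.lt _ hν
    have hcu := (isOrdMap_of_hom hρ2.le hc').lt _ hu
    have hbu := (isOrdMap_of_hom hρ3 hb).lt _ hcu
    have hact := (isPt_act hβ hα hf (hp.isPt hep)).1
    have hbase : M.pr (f.base ζ) (M.act f α e.1).1 =
        k (b (c (M.barLvl f ζ (M.pr ζ e.1.1)))) := by
      have := hfe.pr_lvl hθα hθ hζ hγ
      rw [he, cut_apply _ hν, Function.comp, hgd _ hu, hdc _ hu] at this
      exact this
    rw [← pr_pr hθ (hfe.base_le hζ) hρ1 hact, ← pr_pr hθ (hfe.base_le hζ) hlt.le hact, hbase,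
      pr_map hfζ hk hbu, pr_hom hfζ hk (lt_add_one ρ).le hbu, pr_map hρ3 hb hcu]

theorem proj_tensorPush (hβ : β ≤ ω_ 1) (hα : α < β) (hf : f ∈ M.F α β)
    (hp : M.IsCond (M.θ α) p) (hδ : δ < M.θ α) :
    M.proj (f.base δ + 1) (tensorPush (f.lvl (M.θ α)) f.base p) =
      tensorPush (M.barLvl f (δ + 1)) f.base (M.proj (δ + 1) p) := by
  have hfe := M.emb _ _ hα hβ f hf
  have hle := Order.add_one_le_of_lt hδ
  have e1 : ∀ e ∈ p, M.pr (f.base δ + 1) (M.act f α e.1).1 =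
      M.barLvl f (δ + 1) (M.pr (δ + 1) e.1.1) := fun e he => by
    rw [← hfe.barBase_succ hδ]; exact pr_barBase hβ hα hf hle (hp.fst_lt e he)
  have e4 : ∀ e ∈ p, ((M.act f α e.1).2 / ω < f.base δ + 1 ↔ e.1.2 / ω < δ + 1) :=
    fun e he => by
      rw [act_snd_div, Order.lt_add_one_iff, Order.lt_add_one_iff,
        hfe.base_le_iff (hp.snd_lt e he).le hδ.le]
  ext e
  constructor
  · rintro ⟨_, ⟨⟨a, ha, rfl⟩, hlt⟩, rfl⟩
    rw [tensor_eq] at hlt ⊢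
    refine ⟨_, mem_proj_of_mem ha ((e4 a ha).1 hlt), ?_⟩
    exact Prod.ext (Prod.ext (e1 a ha).symm rfl) rfl
  · rintro ⟨_, ⟨a, ⟨ha, hlt⟩, rfl⟩, rfl⟩
    exact ⟨tensor (f.lvl (M.θ α)) f.base a, ⟨mem_image_of_mem _ ha, (e4 a ha).2 hlt⟩,
      Prod.ext (Prod.ext (e1 a ha) rfl) rfl⟩

/-- The embeddings `f` act on representations by `f̄`. -/
theorem rep_tensorPush (hβ : β ≤ ω_ 1) (hα : α < β) (hf : f ∈ M.F α β)
    (hp : M.IsCond (M.θ α) p) :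
    M.rep (tensorPush (f.lvl (M.θ α)) f.base p) = M.barImage f (M.rep p) := by
  have hfe := M.emb _ _ hα hβ f hf
  have hθ := θ_le_top (M := M) hβ
  have hθα := θ_le_top (M := M) (hα.le.trans hβ)
  have hp2 := hp.of_le le_rfl hθα
  have hc := (hp.tensorPush hβ hα hf).of_le le_rfl hθ
  have h0 : ∀ r : Cond, M.proj 0 r = ∅ := fun r =>
    eq_empty_of_forall_notMem fun e he => by
      obtain ⟨a, -, h, -⟩ := mem_proj.1 he
      exact absurd h not_lt_bot
  have hlt : ∀ δ < ω_ 2, ¬ M.Smooth p δ → δ < M.θ α := by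
    intro δ hδ hs
    by_contra! hle
    have := hp.of_le hδ.le hle
    exact hs ((this.lifts hδ.le).smooth hp2 hδ)
  ext ⟨ζ, q⟩
  rw [mem_rep hc, mem_supp_iff hc]
  constructor
  · rintro ⟨rfl | ⟨ρ, hρ, rfl, hs⟩, rfl⟩
    · refine ⟨(0, ∅), (mem_rep hp2).2 ⟨zero_mem_supp hp2, (h0 p).symm⟩, ?_⟩
      simp [barBase_zero, h0, MorassForcing.tensorPush]
    · have : ∃ δ < M.θ α, f.base δ = ρ := by
        by_contra! hno
        exact hs (smooth_tensorPush_of_notMem hβ hα hf hp hρ hno)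
      obtain ⟨δ, hδ, rfl⟩ := this
      rw [smooth_tensorPush_base hβ hα hf hp hδ] at hs
      refine ⟨(δ + 1, M.proj (δ + 1) p), (mem_rep hp2).2
        ⟨(mem_supp_succ hp2 (hδ.trans_le hθα)).2 hs, rfl⟩, ?_⟩
      simp only
      rw [hfe.barBase_succ hδ, proj_tensorPush hβ hα hf hp hδ]
  · rintro ⟨⟨ζ', q'⟩, hx, heq⟩
    obtain ⟨hs, rfl⟩ := (mem_rep hp2).1 hx
    obtain ⟨rfl, rfl⟩ := Prod.mk.inj heq
    rcases (mem_supp_iff hp2).1 hs with rfl | ⟨δ, hδ, rfl, hsm⟩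
    · simp [barBase_zero, h0, MorassForcing.tensorPush]
    · have hδθ := hlt δ hδ hsm
      simp only
      rw [hfe.barBase_succ hδθ, proj_tensorPush hβ hα hf hp hδθ]
      refine ⟨Or.inr ⟨_, (hfe.base_lt hδθ).trans_le hθ, rfl, ?_⟩, rfl⟩
      rwa [smooth_tensorPush_base hβ hα hf hp hδθ]

end GapTwoMorass
end MorassForcing

namespace MorassForcing
namespace GapTwoMorass

variable {M : GapTwoMorass} {α β γ δ η ν ρ θ θ' : Ordinal.{0}}
  {c : Ordinal.{0} → Ordinal.{0}} {f g h : Emb} {p q r : Cond}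
  {x y w : Ordinal.{0} × Ordinal.{0}}

/-! ### The tree of a simplified gap-2 morass -/

theorem key_snd (h : M.key x = M.key y) : x.2 = y.2 := (Prod.ext_iff.1 h).2

theorem pr_eq_of_key_eq (h : M.key x = M.key y) :
    M.pr (x.2 / ω + 1) x.1 = M.pr (x.2 / ω + 1) y.1 := by
  have h1 : M.pr _ x.1 = M.pr _ y.1 := (Prod.ext_iff.1 h).1
  rwa [← key_snd h] at h1

/-- Left-branching embeddings do not move nodes. -/
theorem key_act_left (hα : α < ω_ 1) (hf : IsLeftBranching M.φ M.G (M.θ α) (M.θ (α + 1)) f)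
    (hx : M.IsPt α x) : M.key (M.act f α x) = M.key x := by
  have hθ := θ_le_top (M := M) (succ_le_omega_one hα)
  have h2 : (M.act f α x).2 = x.2 := by
    refine eq_of_div_mod ?_ (act_snd_mod _)
    rw [act_snd_div, hf.base_eq _ hx.2]
  refine Prod.ext ?_ h2
  simp only [key, h2]
  exact pr_hom hθ (hom_of_mem (θ_lt_succ hα) hf.lvl_top) (Order.add_one_le_of_lt hx.2) hx.1

theorem right_base_eq (hη : η < θ) (h : ∀ ζ, η + ζ ≤ θ → f.base (η + ζ) = θ + ζ) :
    f.base η = θ := by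
  have := h 0 (by rw [add_zero]; exact hη.le)
  rwa [add_zero, add_zero] at this

/-- The right-branching embedding does not move the nodes below its branching point `η`, and moves
the other nodes to levels above `θ_α`. -/
theorem key_act_right (hα : α < ω_ 1) (hf : IsRightBranching M.φ M.G (M.θ α) (M.θ (α + 1)) f)
    (hx : M.IsPt α x) :
    M.key (M.act f α x) = M.key x ∨ M.θ α ≤ (M.act f α x).2 / ω := by
  have hθ' := θ_le_top (M := M) (succ_le_omega_one hα)
  have hθ := θ_le_top (M := M) hα.le
  obtain ⟨η, hη, h1, h2, -, -, h5, -⟩ := hf.branch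
  have hb := right_base_eq hη h2
  rcases lt_or_ge (x.2 / ω) η with hlt | hle
  · left
    have h3 : (M.act f α x).2 = x.2 := by
      refine eq_of_div_mod ?_ (act_snd_mod _)
      rw [act_snd_div, h1 _ hlt]
    refine Prod.ext ?_ h3
    simp only [key, h3]
    have hact : (M.act f α x).1 < M.φ (M.θ (α + 1)) := by
      have := (hf.emb.lvl_map _ le_rfl).lt _ hx.1
      rwa [hf.emb.base_top] at this
    have hle := Order.add_one_le_of_lt hlt
    have hpr := hf.emb.pr_lvl hθ hθ' hη.le hx.1
    rw [hb] at hpr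
    have e1 : M.pr (M.θ α) (M.act f α x).1 = f.lvl η (M.pr η x.1) := hpr
    rw [← pr_pr hθ' (θ_lt_succ hα).le (hle.trans hη.le) hact, e1,
      pr_hom hθ (hom_of_mem hη h5) hle (pr_lt hθ hη.le hx.1), pr_pr hθ hη.le hle hx.1]
  · right
    obtain ⟨κ, hκ⟩ := exists_add_of_le hle
    rw [act_snd_div, hκ, h2 κ (hκ ▸ hx.2.le)]
    exact le_self_add

theorem right_unique (hα : α < ω_ 1) (hf : f ∈ M.F α (α + 1)) (hg : g ∈ M.F α (α + 1))
    (hfr : IsRightBranching M.φ M.G (M.θ α) (M.θ (α + 1)) f)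
    (hgr : IsRightBranching M.φ M.G (M.θ α) (M.θ (α + 1)) g) : f = g := by
  obtain ⟨h, -, hF⟩ := M.amalgamation α hα
  have aux : ∀ f ∈ M.F α (α + 1), IsRightBranching M.φ M.G (M.θ α) (M.θ (α + 1)) f → f = h := by
    intro f hf hr
    rw [hF] at hf
    rcases hf with hl | hf
    · obtain ⟨η, hη, -, h2, -⟩ := hr.branch
      exact absurd ((hl.base_eq η hη).symm.trans (right_base_eq hη h2)) hη.ne
    · exact hf
  rw [aux f hf hfr, aux g hg hgr]

theorem key_act_succ (hα : α < ω_ 1) (hf : f ∈ M.F α (α + 1)) (hx : M.IsPt α x) :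
    M.key (M.act f α x) = M.key x ∨
      (IsRightBranching M.φ M.G (M.θ α) (M.θ (α + 1)) f ∧ M.θ α ≤ (M.act f α x).2 / ω) := by
  rcases F_succ hα hf with h | h
  · exact Or.inl (key_act_left hα h hx)
  · exact (key_act_right hα h hx).imp_right fun h' => ⟨h, h'⟩

/-- The tree property for nodes: a node on level `β` has at most one predecessor on level `α`. -/
theorem act_tree (hβ : β ≤ ω_ 1) (hα : α < β) (hf : f ∈ M.F α β) (hg : g ∈ M.F α β)
    (hx : M.IsPt α x) (hy : M.IsPt α y) (h : M.key (M.act f α x) = M.key (M.act g α y)) :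
    M.key x = M.key y := by
  induction β using Ordinal.limitRecOn generalizing f g α x y with
  | zero => exact absurd hα not_lt_bot
  | add_one β ih =>
    have hβ1 : β < ω_ 1 := (lt_add_one β).trans_le hβ
    have hstep : ∀ f ∈ M.F β (β + 1), ∀ g ∈ M.F β (β + 1), ∀ x y, M.IsPt β x → M.IsPt β y →
        M.key (M.act f β x) = M.key (M.act g β y) → M.key x = M.key y := by
      intro f hf g hg x y hx hy h
      have h2 := key_snd h
      rcases key_act_succ hβ1 hf hx with hk | ⟨hr, hk⟩ <;>
        rcases key_act_succ hβ1 hg hy with hk' | ⟨hr', hk'⟩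
      · rw [← hk, ← hk', h]
      · rw [← h2, key_snd hk] at hk'
        exact absurd hx.2 hk'.not_gt
      · rw [h2, key_snd hk'] at hk
        exact absurd hy.2 hk.not_gt
      · obtain rfl := right_unique hβ1 hf hg hr hr'
        exact (key_act_iff hβ (lt_add_one β) hf hx hy).1 h
    rcases (Order.lt_add_one_iff.1 hα).eq_or_lt with rfl | hlt
    · exact hstep f hf g hg x y hx hy h
    obtain ⟨f₁, hf₁, f₂, hf₂, rfl⟩ := F_decomp hβ hlt (lt_add_one β) hf
    obtain ⟨g₁, hg₁, g₂, hg₂, rfl⟩ := F_decomp hβ hlt (lt_add_one β) hg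
    rw [act_comp hβ hlt (lt_add_one β) hf₂ hx, act_comp hβ hlt (lt_add_one β) hg₂ hy] at h
    exact ih hβ1.le hlt hf₂ hg₂ hx hy (hstep _ hf₁ _ hg₁ _ _ (isPt_act hβ1.le hlt hf₂ hx)
      (isPt_act hβ1.le hlt hg₂ hy) h)
  | limit β hl ih =>
    obtain ⟨η, h1, -, h3, k, hk, j, hj, i, hi, rfl, rfl⟩ :=
      M.amalg β hβ hl α hα α hα f hf g hg
    have hη := h3.le.trans hβ
    rw [act_comp hβ h1 h3 hj hx, act_comp hβ h1 h3 hi hy,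
      key_act_iff hβ h3 hk (isPt_act hη h1 hj hx) (isPt_act hη h1 hi hy)] at h
    exact ih η h3 hη h1 hj hi hx hy h

theorem F_comp (hγ : γ ≤ ω_ 1) (hα : α < β) (hβ : β < γ) (hf : f ∈ M.F β γ) (hg : g ∈ M.F α β) :
    Emb.comp M.φ M.G (M.θ α) f g ∈ M.F α γ := by
  rw [M.comp α β γ hα hβ hγ]
  exact ⟨f, hf, g, hg, rfl⟩

variable (M) in
/-- Two points of level `β` are related if they have the same node, or if their nodes have a common
predecessor on some level `α < β` of the gap-2 morass. -/
def Rel (β : Ordinal.{0}) (x y : Ordinal.{0} × Ordinal.{0}) : Prop :=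
  M.key x = M.key y ∨ ∃ α < β, ∃ f ∈ M.F α β, ∃ g ∈ M.F α β, ∃ z, M.IsPt α z ∧
    M.key x = M.key (M.act f α z) ∧ M.key y = M.key (M.act g α z)

theorem Rel.of_key (h : M.key x = M.key y) : M.Rel β x y := Or.inl h

theorem Rel.symm (h : M.Rel β x y) : M.Rel β y x := by
  rcases h with h | ⟨α, hα, f, hf, g, hg, z, hz, h1, h2⟩
  · exact Or.inl h.symm
  · exact Or.inr ⟨α, hα, g, hg, f, hf, z, hz, h2, h1⟩

theorem Rel.trans (hβ : β ≤ ω_ 1) (h : M.Rel β x y) (h' : M.Rel β y w) : M.Rel β x w := by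
  rcases h with h | ⟨α, hα, f, hf, g, hg, z, hz, h1, h2⟩
  · rcases h' with h' | ⟨α', hα', f', hf', g', hg', z', hz', h1', h2'⟩
    · exact Or.inl (h.trans h')
    · exact Or.inr ⟨α', hα', f', hf', g', hg', z', hz', h.trans h1', h2'⟩
  rcases h' with h' | ⟨α', hα', f', hf', g', hg', z', hz', h1', h2'⟩
  · exact Or.inr ⟨α, hα, f, hf, g, hg, z, hz, h1, h'.symm.trans h2⟩
  have h := h2.symm.trans h1'
  rcases lt_trichotomy α α' with hlt | rfl | hlt
  · have hα1 := hα'.le.trans hβ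
    obtain ⟨k, hk, j, hj, rfl⟩ := F_decomp hβ hlt hα' hg
    have hzj := isPt_act hα1 hlt hj hz
    rw [act_comp hβ hlt hα' hj hz] at h
    have h3 := act_tree hβ hα' hk hf' hzj hz' h
    refine Or.inr ⟨α, hα, f, hf, _, F_comp hβ hlt hα' hg' hj, z, hz, h1, ?_⟩
    rw [h2', act_comp hβ hlt hα' hj hz, key_act_iff hβ hα' hg' hz' hzj, h3]
  · have h3 := act_tree hβ hα hg hf' hz hz' h
    refine Or.inr ⟨α, hα, f, hf, g', hg', z, hz, h1, ?_⟩
    rw [h2', key_act_iff hβ hα hg' hz' hz, h3]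
  · have hα1 := hα.le.trans hβ
    obtain ⟨k, hk, j, hj, rfl⟩ := F_decomp hβ hlt hα hf'
    have hzj := isPt_act hα1 hlt hj hz'
    rw [act_comp hβ hlt hα hj hz'] at h
    have h3 := act_tree hβ hα hg hk hz hzj h
    refine Or.inr ⟨α', hα', _, F_comp hβ hlt hα hf hj, g', hg', z', hz', ?_, h2'⟩
    rw [h1, act_comp hβ hlt hα hj hz', key_act_iff hβ hα hf hz hzj, h3]

/-- The relations on the levels cohere, even along two different embeddings. -/
theorem rel_act (hβ : β ≤ ω_ 1) (hα : α < β) (hf : f ∈ M.F α β) (hg : g ∈ M.F α β)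
    (hx : M.IsPt α x) (hy : M.IsPt α y) :
    M.Rel β (M.act f α x) (M.act g α y) ↔ M.Rel α x y := by
  have hα1 := hα.le.trans hβ
  constructor
  · rintro (h | ⟨γ, hγ, k, hk, k', hk', z, hz, h1, h2⟩)
    · exact Or.inl (act_tree hβ hα hf hg hx hy h)
    rcases lt_trichotomy γ α with hlt | rfl | hlt
    · obtain ⟨i, hi, j, hj, rfl⟩ := F_decomp hβ hlt hα hk
      obtain ⟨i', hi', j', hj', rfl⟩ := F_decomp hβ hlt hα hk'
      rw [act_comp hβ hlt hα hj hz] at h1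
      rw [act_comp hβ hlt hα hj' hz] at h2
      exact Or.inr ⟨γ, hlt, j, hj, j', hj', z, hz,
        act_tree hβ hα hf hi hx (isPt_act hα1 hlt hj hz) h1,
        act_tree hβ hα hg hi' hy (isPt_act hα1 hlt hj' hz) h2⟩
    · exact Or.inl ((act_tree hβ hα hf hk hx hz h1).trans
        (act_tree hβ hα hg hk' hy hz h2).symm)
    · have hγ1 := hγ.le.trans hβ
      obtain ⟨i, hi, j, hj, rfl⟩ := F_decomp hβ hlt hγ hf
      obtain ⟨i', hi', j', hj', rfl⟩ := F_decomp hβ hlt hγ hg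
      rw [act_comp hβ hlt hγ hj hx] at h1
      rw [act_comp hβ hlt hγ hj' hy] at h2
      have e1 := act_tree hβ hγ hi hk (isPt_act hγ1 hlt hj hx) hz h1
      have e2 := act_tree hβ hγ hi' hk' (isPt_act hγ1 hlt hj' hy) hz h2
      exact Or.inl (act_tree hγ1 hlt hj hj' hx hy (e1.trans e2.symm))
  · rintro (h | ⟨γ, hγ, k, hk, k', hk', z, hz, h1, h2⟩)
    · exact Or.inr ⟨α, hα, f, hf, g, hg, x, hx, rfl, (key_act_iff hβ hα hg hy hx).2 h.symm⟩
    · refine Or.inr ⟨γ, hγ.trans hα, _, F_comp hβ hγ hα hf hk, _, F_comp hβ hγ hα hg hk', z, hz,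
        ?_, ?_⟩
      · rw [act_comp hβ hγ hα hk hz]
        exact (key_act_iff hβ hα hf hx (isPt_act hα1 hγ hk hz)).2 h1
      · rw [act_comp hβ hγ hα hk' hz]
        exact (key_act_iff hβ hα hg hy (isPt_act hα1 hγ hk' hz)).2 h2

theorem rel_succ (hα : α < ω_ 1) (h : M.Rel (α + 1) x y) :
    M.key x = M.key y ∨ ∃ f ∈ M.F α (α + 1), ∃ g ∈ M.F α (α + 1), ∃ z w, M.IsPt α z ∧ M.IsPt α w ∧
      M.Rel α z w ∧ M.key x = M.key (M.act f α z) ∧ M.key y = M.key (M.act g α w) := by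
  rcases h with h | ⟨γ, hγ, f, hf, g, hg, z, hz, h1, h2⟩
  · exact Or.inl h
  right
  rcases (Order.lt_add_one_iff.1 hγ).eq_or_lt with rfl | hlt
  · exact ⟨f, hf, g, hg, z, z, hz, hz, Or.inl rfl, h1, h2⟩
  · have hs := succ_le_omega_one hα
    obtain ⟨i, hi, j, hj, rfl⟩ := F_decomp hs hlt (lt_add_one α) hf
    obtain ⟨i', hi', j', hj', rfl⟩ := F_decomp hs hlt (lt_add_one α) hg
    rw [act_comp hs hlt (lt_add_one α) hj hz] at h1
    rw [act_comp hs hlt (lt_add_one α) hj' hz] at h2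
    exact ⟨i, hi, i', hi', _, _, isPt_act hα.le hlt hj hz, isPt_act hα.le hlt hj' hz,
      Or.inr ⟨γ, hlt, j, hj, j', hj', z, hz, rfl, rfl⟩, h1, h2⟩

/-! ### Existence of left-branching embeddings -/

variable (M) in
open Classical in
/-- The left-branching embedding with top map `g`. -/
noncomputable def leftEmb (θ θ' : Ordinal.{0}) (g : Ordinal.{0} → Ordinal.{0}) : Emb where
  base ζ := if ζ < θ then ζ else if ζ = θ then θ' else 0
  lvl ζ := if ζ < θ then cut (M.φ ζ) id else if ζ = θ then g else fun _ => 0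
  arr ζ ξ b := if ζ < ξ ∧ ξ ≤ θ ∧ b ∈ M.G ζ ξ then
    (if ξ < θ then b else cut (M.φ ζ) (g ∘ b)) else fun _ => 0

theorem splitPoint_lt (hζ : ζ < ω_ 2) : splitPoint M.φ M.G ζ < M.φ ζ := by
  obtain ⟨τ, hτ, hle⟩ := exists_splitMap_ne (M := M) hζ
  have hne : {γ | γ < M.φ ζ ∧ ∃ b ∈ M.G ζ (ζ + 1), b γ ≠ γ}.Nonempty :=
    ⟨τ, hτ, M.splitMap ζ, mem_of_hom (lt_add_one ζ) (splitMap_mem hζ), fun h => by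
      rw [h] at hle; exact absurd hτ hle.not_gt⟩
  exact (csInf_mem hne).1

theorem isLeftBranching_leftEmb (hθ : θ < θ') (hθ' : θ' ≤ ω_ 2) (hg : c ∈ M.G θ θ') :
    IsLeftBranching M.φ M.G θ θ' (M.leftEmb θ θ' c) := by
  have hθ2 : θ ≤ ω_ 2 := hθ.le.trans hθ'
  have hgm := M.gapOne.maps _ _ hθ hθ' c hg
  have hb : ∀ ζ < θ, (M.leftEmb θ θ' c).base ζ = ζ := fun ζ hζ => if_pos hζ
  have hbt : (M.leftEmb θ θ' c).base θ = θ' := by simp [leftEmb]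
  have hl : ∀ ζ < θ, (M.leftEmb θ θ' c).lvl ζ = cut (M.φ ζ) id := fun ζ hζ => if_pos hζ
  have hlt : (M.leftEmb θ θ' c).lvl θ = c := by simp [leftEmb]
  have ha : ∀ ζ ξ, ζ < ξ → ξ < θ → ∀ b ∈ M.G ζ ξ, (M.leftEmb θ θ' c).arr ζ ξ b = b :=
    fun ζ ξ h h' b hb => by simp only [leftEmb]; rw [if_pos ⟨h, h'.le, hb⟩, if_pos h']
  have hat : ∀ ζ < θ, ∀ b ∈ M.G ζ θ, (M.leftEmb θ θ' c).arr ζ θ b = cut (M.φ ζ) (c ∘ b) :=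
    fun ζ h b hb => by
      simp only [leftEmb]; rw [if_pos ⟨h, le_rfl, hb⟩, if_neg (lt_irrefl _)]
  refine ⟨?_, hb, fun ζ hζ τ hτ => by rw [hl ζ hζ, cut_apply _ hτ, id], ha, by rwa [hlt],
    fun ζ hζ b hb => by rw [hat ζ hζ b hb, hlt]⟩
  constructor
  · intro ζ hζ ξ hξ hlt'
    have h1 : ζ < θ := hlt'.trans_le hξ
    rw [hb ζ h1]
    rcases (show ξ ≤ θ from hξ).eq_or_lt with rfl | h2
    · rw [hbt]; exact h1.trans hθ
    · rwa [hb ξ h2]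
  · exact hbt
  · intro ζ hζ
    simp only [leftEmb]
    rw [if_neg hζ.not_gt, if_neg hζ.ne']
  · intro ζ hζ
    rcases hζ.eq_or_lt with rfl | h
    · rwa [hlt, hbt]
    · rw [hl ζ h, hb ζ h]; exact isOrdMap_id le_rfl
  · intro ζ hζ
    simp only [leftEmb]
    rw [if_neg hζ.not_gt, if_neg hζ.ne']
  · intro ζ ξ h hξ b hbm
    rw [hb ζ (h.trans_le hξ)]
    rcases hξ.eq_or_lt with rfl | h2
    · rw [hat ζ h b hbm, hbt, M.gapOne.comp ζ ξ θ' h hθ hθ']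
      exact ⟨c, hg, b, hbm, rfl⟩
    · rwa [ha ζ ξ h h2 b hbm, hb ξ h2]
  · intro ζ ξ b hn
    exact if_neg hn
  · intro ζ hζ
    have hζ2 := hζ.trans_le hθ2
    rw [hl ζ hζ, hb ζ hζ, cut_apply _ (splitPoint_lt hζ2), id]
  · intro ζ ξ η h1 h2 h3 b hbm d hd
    have hξ : ξ < θ := h2.trans_le h3
    have hm : cut (M.φ ζ) (d ∘ b) ∈ M.G ζ η := by
      rw [M.gapOne.comp ζ ξ η h1 h2 (h3.trans hθ2)]
      exact ⟨d, hd, b, hbm, rfl⟩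
    rw [hb ζ (h1.trans hξ), ha ζ ξ h1 hξ b hbm]
    rcases h3.eq_or_lt with rfl | h4
    · have hbo := M.gapOne.maps ζ ξ h1 (hξ.le.trans hθ2) b hbm
      rw [hat ζ (h1.trans h2) _ hm, hat ξ h2 d hd]
      funext τ
      rcases lt_or_ge τ (M.φ ζ) with hτ | hτ
      · rw [cut_apply _ hτ, cut_apply _ hτ, Function.comp, Function.comp, cut_apply _ hτ,
          cut_apply _ (hbo.lt τ hτ)]
        rfl
      · rw [cut_of_le _ hτ, cut_of_le _ hτ]
    · rw [ha ζ η (h1.trans h2) h4 _ hm, ha ξ η h2 h4 d hd]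
  · intro ζ ξ h hξ b hbm τ hτ
    rw [hl ζ (h.trans_le hξ), cut_apply _ hτ, id]
    rcases hξ.eq_or_lt with rfl | h2
    · rw [hlt, hat ζ h b hbm, cut_apply _ hτ]; rfl
    · have hbo := M.gapOne.maps ζ ξ h (hξ.trans hθ2) b hbm
      rw [hl ξ h2, ha ζ ξ h h2 b hbm, cut_apply _ (hbo.lt τ hτ), id]

theorem exists_left (hα : α < ω_ 1) : ∃ f ∈ M.F α (α + 1),
    IsLeftBranching M.φ M.G (M.θ α) (M.θ (α + 1)) f := by
  have hθ' := θ_le_top (M := M) (succ_le_omega_one hα)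
  have hlt := θ_lt_succ (M := M) hα
  obtain ⟨c, hc⟩ := hom_nonempty (M := M) hθ' hlt.le
  have hl := isLeftBranching_leftEmb hlt hθ' (mem_of_hom hlt hc)
  obtain ⟨h, -, hF⟩ := M.amalgamation α hα
  exact ⟨_, by rw [hF]; exact Or.inl hl, hl⟩

/-! ### The thinned out sets of conditions -/

variable (M) in
/-- An explicit description of the thinned out part of `P(φ_{θ_α})`: related points have the same
value. -/
structure IsThin (α : Ordinal.{0}) (p : Cond) : Prop where
  finite : p.Finite
  isPt : ∀ e ∈ p, M.IsPt α e.1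
  coherent : ∀ e ∈ p, ∀ e' ∈ p, M.Rel α e.1 e'.1 → e.2 = e'.2

theorem IsThin.isCond (hp : M.IsThin α p) : M.IsCond (M.θ α) p :=
  ⟨hp.finite, fun e he => (hp.isPt e he).1, fun e he => (hp.isPt e he).2,
    fun e he e' he' h => hp.coherent e he e' he' (Or.inl h)⟩

theorem IsThin.mono (hp : M.IsThin α p) (h : q ⊆ p) : M.IsThin α q :=
  ⟨hp.finite.subset h, fun e he => hp.isPt e (h he),
    fun e he e' he' => hp.coherent e (h he) e' (h he')⟩

/-- A condition whose points have the nodes and values of points of a thin condition is thin. -/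
theorem IsThin.of_key (hα : α ≤ ω_ 1) (hp : M.IsThin α p) (hq : q.Finite)
    (hpt : ∀ e ∈ q, M.IsPt α e.1) (h : ∀ e ∈ q, ∃ d ∈ p, M.key d.1 = M.key e.1 ∧ d.2 = e.2) :
    M.IsThin α q := by
  refine ⟨hq, hpt, fun e he e' he' hr => ?_⟩
  obtain ⟨d, hd, h1, h2⟩ := h e he
  obtain ⟨d', hd', h1', h2'⟩ := h e' he'
  rw [← h2, ← h2']
  exact hp.coherent d hd d' hd' ((Rel.of_key h1).trans hα (hr.trans hα (Rel.of_key h1'.symm)))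

theorem isThin_tensorPush (hβ : β ≤ ω_ 1) (hα : α < β) (hf : f ∈ M.F α β) (hp : M.IsThin α p) :
    M.IsThin β (tensorPush (f.lvl (M.θ α)) f.base p) where
  finite := hp.finite.image _
  isPt := by
    rintro _ ⟨e, he, rfl⟩
    exact isPt_act hβ hα hf (hp.isPt e he)
  coherent := by
    rintro _ ⟨e, he, rfl⟩ _ ⟨e', he', rfl⟩ h
    exact hp.coherent e he e' he' ((rel_act hβ hα hf hf (hp.isPt e he) (hp.isPt e' he')).1 h)

theorem isThin_tensorPull (hβ : β ≤ ω_ 1) (hα : α < β) (hf : f ∈ M.F α β) (hp : M.IsThin β p) :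
    M.IsThin α (tensorPull (M.φ (M.θ α)) (M.θ α) (f.lvl (M.θ α)) f.base p) where
  finite := by
    have hfe := M.emb _ _ hα hβ f hf
    refine Finite.of_finite_image (f := tensor (f.lvl (M.θ α)) f.base)
      (hp.finite.subset ?_) ?_
    · rintro _ ⟨e, he, rfl⟩
      exact he.2.2
    · intro e he e' he' h
      rw [tensor_eq, tensor_eq] at h
      exact Prod.ext (act_inj hfe ⟨he.1, lt_omega_mul.1 he.2.1⟩ ⟨he'.1, lt_omega_mul.1 he'.2.1⟩
        (Prod.ext_iff.1 h).1) (Prod.ext_iff.1 h).2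
  isPt e he := ⟨he.1, lt_omega_mul.1 he.2.1⟩
  coherent e he e' he' h :=
    hp.coherent (tensor (f.lvl (M.θ α)) f.base e) he.2.2
      (tensor (f.lvl (M.θ α)) f.base e') he'.2.2 ((rel_act hβ hα hf hf ⟨he.1, lt_omega_mul.1 he.2.1⟩
      ⟨he'.1, lt_omega_mul.1 he'.2.1⟩).2 h)

theorem exists_act_eq (hβ : β ≤ ω_ 1) (hl : Order.IsSuccLimit β) (hx : M.IsPt β x) :
    ∃ α < β, ∃ f ∈ M.F α β, ∃ y, M.IsPt α y ∧ M.act f α y = x := by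
  obtain ⟨α₁, h1, f₁, hf₁, ζ, hζ, hζe, τ, hτ, hτe⟩ :=
    M.cover_lvl β hβ hl _ le_rfl x.1 hx.1
  obtain ⟨α₂, h2, f₂, hf₂, δ, hδ, hδe⟩ := M.cover_base β hβ hl _ hx.2
  have he₁ := M.emb _ _ h1 hβ f₁ hf₁
  obtain rfl : ζ = M.θ α₁ :=
    he₁.base_strictMono.injOn hζ (le_refl (M.θ α₁)) (hζe.trans he₁.base_top.symm)
  obtain ⟨γ, h3, h4, h5, g, hg, j, hj, i, hi, rfl, rfl⟩ :=
    M.amalg β hβ hl α₁ h1 α₂ h2 f₁ hf₁ f₂ hf₂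
  have hγ := h5.le.trans hβ
  have hje := M.emb _ _ h3 hγ j hj
  have hie := M.emb _ _ h4 hγ i hi
  refine ⟨γ, h5, g, hg, (j.lvl (M.θ α₁) τ, ω * i.base δ + x.2 % ω), ⟨?_, ?_⟩, ?_⟩
  · have := (hje.lvl_map _ le_rfl).lt τ hτ
    rwa [hje.base_top] at this
  · rw [omega_mul_add_div]
    exact hie.base_lt hδ
  · rw [comp_lvl le_rfl hτ, hje.base_top] at hτe
    rw [comp_base hδ.le] at hδe
    refine Prod.ext hτe (eq_of_div_mod ?_ ?_)
    · rw [act_snd_div, omega_mul_add_div, hδe]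
    · rw [act_snd_mod, omega_mul_add_mod]

theorem θ_pos_of_le (hα : α ≤ ω_ 1) : 0 < M.θ α := by
  rcases hα.eq_or_lt with rfl | h
  · rw [M.θ_top]; exact omega_pos 2
  · exact M.θ_pos α h

theorem zero_div_omega : (0 : Ordinal.{0}) / ω = 0 :=
  Ordinal.div_eq_zero_of_lt omega0_pos

theorem exists_act_eq_finite (hβ : β ≤ ω_ 1) (hl : Order.IsSuccLimit β)
    {s : Set (Ordinal.{0} × Ordinal.{0})} (hs : s.Finite) (hpt : ∀ x ∈ s, M.IsPt β x) :
    ∃ α < β, ∃ f ∈ M.F α β, ∀ x ∈ s, ∃ y, M.IsPt α y ∧ M.act f α y = x := by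
  induction s, hs using Set.Finite.induction_on with
  | empty =>
    obtain ⟨α, hα, f, hf, -⟩ := exists_act_eq (M := M) (x := (0, 0)) hβ hl
      ⟨φ_pos (θ_le_top hβ), by rw [zero_div_omega]; exact θ_pos_of_le hβ⟩
    exact ⟨α, hα, f, hf, by simp⟩
  | @insert x s _ _ ih =>
    obtain ⟨α₁, h1, f₁, hf₁, hs⟩ := ih fun x hx => hpt x (mem_insert_of_mem _ hx)
    obtain ⟨α₂, h2, f₂, hf₂, y, hy, hyx⟩ := exists_act_eq hβ hl (hpt x (mem_insert _ _))
    obtain ⟨γ, h3, h4, h5, g, hg, j, hj, i, hi, rfl, rfl⟩ :=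
      M.amalg β hβ hl α₁ h1 α₂ h2 f₁ hf₁ f₂ hf₂
    have hγ := h5.le.trans hβ
    refine ⟨γ, h5, g, hg, ?_⟩
    rintro x' (rfl | hx')
    · exact ⟨_, isPt_act hγ h4 hi hy, by rw [← act_comp hβ h4 h5 hi hy, hyx]⟩
    · obtain ⟨y', hy', hyx'⟩ := hs x' hx'
      exact ⟨_, isPt_act hγ h3 hj hy', by rw [← act_comp hβ h3 h5 hj hy', hyx']⟩

/-- At a limit level, a thin condition and an additional ordinal `δ` are in the range of an
embedding; this embedding can be chosen to come from a successor level. -/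
theorem IsThin.exists_tensorPush (hβ : β ≤ ω_ 1) (hl : Order.IsSuccLimit β) (hp : M.IsThin β p)
    (hδ : δ < M.θ β) : ∃ α, α + 1 < β ∧ ∃ f ∈ M.F (α + 1) β, ∃ q, M.IsThin (α + 1) q ∧
      tensorPush (f.lvl (M.θ (α + 1))) f.base q = p ∧ ∃ ν < M.θ (α + 1), f.base ν = δ := by
  have hδω : (ω * δ) / ω = δ := by simp
  obtain ⟨α, hα, f, hf, h⟩ := exists_act_eq_finite (M := M)
    (s := insert (0, ω * δ) (Prod.fst '' p)) hβ hl ((hp.finite.image _).insert _) (by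
      rintro _ (rfl | ⟨e, he, rfl⟩)
      · exact ⟨φ_pos (θ_le_top hβ), by rwa [hδω]⟩
      · exact hp.isPt e he)
  have hα1 : α + 1 < β := hl.succ_lt hα
  obtain ⟨g, hg, j, hj, rfl⟩ := F_decomp hβ (lt_add_one α) hα1 hf
  refine ⟨α, hα1, g, hg, _, isThin_tensorPull hβ hα1 hg hp, ?_, ?_⟩
  · ext e
    constructor
    · rintro ⟨d, hd, rfl⟩
      exact hd.2.2
    · intro he
      obtain ⟨y, hy, hye⟩ := h e.1 (mem_insert_of_mem _ (mem_image_of_mem _ he))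
      rw [act_comp hβ (lt_add_one α) hα1 hj hy] at hye
      have hpt := isPt_act (hα1.le.trans hβ) (lt_add_one α) hj hy
      have heq : tensor (g.lvl (M.θ (α + 1))) g.base (M.act j α y, e.2) = e := Prod.ext hye rfl
      exact ⟨(M.act j α y, e.2), ⟨hpt.1, lt_omega_mul.2 hpt.2, by rwa [heq]⟩, heq⟩
  · obtain ⟨y, hy, hye⟩ := h _ (mem_insert _ _)
    rw [act_comp hβ (lt_add_one α) hα1 hj hy] at hye
    have hpt := isPt_act (hα1.le.trans hβ) (lt_add_one α) hj hy
    refine ⟨_, hpt.2, ?_⟩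
    rw [← act_snd_div (M := M) (α := α + 1), hye, hδω]

/-- If the node of a point of `p` is the image of the node of `y` on level `α`, then one of the
pull-backs of `p` to level `α` gives the node of `y` the same value. Here it is used that the
right-branching embedding maps `G η θ_α` onto `G θ_α θ_{α+1}`. -/
theorem exists_pull (hα : α < ω_ 1) (hp : M.IsCond (M.θ (α + 1)) p) (hh : h ∈ M.F α (α + 1))
    (hr : IsRightBranching M.φ M.G (M.θ α) (M.θ (α + 1)) h) (hf : f ∈ M.F α (α + 1))
    (hy : M.IsPt α y) {e : (Ordinal.{0} × Ordinal.{0}) × Bool} (he : e ∈ p)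
    (hk : M.key e.1 = M.key (M.act f α y)) :
    ∃ a : (Ordinal.{0} × Ordinal.{0}) × Bool, a.2 = e.2 ∧ M.key a.1 = M.key y ∧
      (a ∈ tensorPull (M.φ (M.θ α)) (M.θ α) (h.lvl (M.θ α)) h.base p ∨
        ∃ g ∈ M.G (M.θ α) (M.θ (α + 1)), a ∈ pull (M.φ (M.θ α)) g
          (restrictTo (M.φ (M.θ (α + 1))) (ω * M.θ α) p)) := by
  have hs := succ_le_omega_one hα
  have hθ' := θ_le_top (M := M) hs
  have hθ := θ_le_top (M := M) hα.le
  have hlt := θ_lt_succ (M := M) hα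
  have hγ := hp.fst_lt e he
  obtain ⟨g, hg, hgγ⟩ := exists_hom_pr hθ' hlt.le hγ
  have hgG := mem_of_hom hlt hg
  have hprγ := pr_lt hθ' hlt.le hγ
  rcases key_act_succ hα hf hy with h1 | ⟨h1, h2⟩
  · rw [h1] at hk
    have hμ : e.1.2 / ω < M.θ α := by rw [key_snd hk]; exact hy.2
    refine ⟨((M.pr (M.θ α) e.1.1, e.1.2), e.2), rfl, (key_pr hθ' hlt.le hγ hμ).trans hk,
      Or.inr ⟨g, hgG, hprγ, ?_⟩⟩
    have : shift g ((M.pr (M.θ α) e.1.1, e.1.2), e.2) = e := Prod.ext (Prod.ext hgγ rfl) rfl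
    rw [this]
    exact ⟨he, hγ, lt_omega_mul.2 hμ⟩
  · obtain rfl := right_unique hα hf hh h1 hr
    obtain ⟨η, hη, -, hb, -, -, h5, h6⟩ := hr.branch
    have hbη := right_base_eq hη hb
    have h7 := h6 η (M.θ α) le_rfl hη le_rfl
    rw [hbη, hr.emb.base_top] at h7
    obtain ⟨b, hbm, rfl⟩ := h7.symm ▸ hgG
    have hact : (M.act f α y).1 < M.φ (M.θ (α + 1)) := (isPt_act hs (lt_add_one α) hf hy).1
    have hyη := pr_lt hθ hη.le hy.1
    have e1 : M.pr (M.θ α) e.1.1 = f.lvl η (M.pr η y.1) := by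
      have h8 := pr_eq_of_key_eq hk
      have hμ := hp.snd_lt e he
      have h9 : M.θ α ≤ e.1.2 / ω + 1 := by
        rw [key_snd hk]; exact h2.trans (lt_add_one _).le
      have h10 := Order.add_one_le_of_lt hμ
      rw [← pr_pr hθ' h10 h9 hγ, h8, pr_pr hθ' h10 h9 hact]
      have := hr.emb.pr_lvl hθ hθ' hη.le hy.1
      rwa [hbη] at this
    have e2 : f.lvl (M.θ α) (b (M.pr η y.1)) = e.1.1 := by
      rw [hr.emb.comm η (M.θ α) hη le_rfl b hbm _ hyη, ← e1, hgγ]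
    have hbl := (M.gapOne.maps _ _ hη hθ b hbm).lt _ hyη
    have hpt : M.IsPt α (b (M.pr η y.1), y.2) := ⟨hbl, hy.2⟩
    have e3 : M.act f α (b (M.pr η y.1), y.2) = e.1 :=
      Prod.ext e2 (key_snd hk).symm
    refine ⟨((b (M.pr η y.1), y.2), e.2), rfl, ?_, Or.inl ⟨hbl, lt_omega_mul.2 hy.2, ?_⟩⟩
    · rw [← key_act_iff hs (lt_add_one α) hf hpt hy, e3, hk]
    · rw [tensor_eq, e3]
      exact he

theorem isThin_zero (hp : M.IsCond (M.θ 0) p) : M.IsThin 0 p := by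
  refine ⟨hp.finite, fun e he => hp.isPt he, fun e he e' he' h => ?_⟩
  rcases h with h | ⟨α, hα, -⟩
  · exact hp.coherent e he e' he' h
  · exact absurd hα not_lt_bot

theorem InThinP.isThin (hβ : β ≤ ω_ 1) (hp : M.InThinP β p) : M.IsThin β p := by
  induction hp with
  | zero p inP =>
    exact isThin_zero (inP.isCond (θ_le_top hβ))
  | succ α p r h inP mem right inv common le_right le_left _ ih =>
    have hα : α < ω_ 1 := (lt_add_one α).trans_le hβ
    have hc := inP.isCond (θ_le_top hβ)
    refine ⟨hc.finite, fun e he => hc.isPt he, fun e he e' he' hr => ?_⟩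
    rcases rel_succ hα hr with hk | ⟨f, hf, g, hg, z, w, hz, hw, hzw, h1, h2⟩
    · exact hc.coherent e he e' he' hk
    have aux : ∀ a, (a ∈ tensorPull (M.φ (M.θ α)) (M.θ α) (h.lvl (M.θ α)) h.base p ∨
        ∃ g ∈ M.G (M.θ α) (M.θ (α + 1)), a ∈ pull (M.φ (M.θ α)) g
          (restrictTo (M.φ (M.θ (α + 1))) (ω * M.θ α) p)) → a ∈ r := by
      rintro a (ha | ⟨g, hg, ha⟩)
      · exact le_right ha
      · exact le_left g hg ha
    obtain ⟨a, ha1, ha2, ha3⟩ := exists_pull hα hc mem right hf hz he h1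
    obtain ⟨a', ha1', ha2', ha3'⟩ := exists_pull hα hc mem right hg hw he' h2
    rw [← ha1, ← ha1']
    exact (ih hα.le).coherent a (aux a ha3) a' (aux a' ha3')
      ((Rel.of_key ha2).trans hα.le (hzw.trans hα.le (Rel.of_key ha2'.symm)))
  | limit β α f p isLimit lt mem thin ih =>
    exact isThin_tensorPush hβ lt mem (ih (lt.le.trans hβ))

theorem IsThin.inThinP (hβ : β ≤ ω_ 1) (hp : M.IsThin β p) : M.InThinP β p := by
  induction β using Ordinal.limitRecOn generalizing p with
  | zero => exact .zero p (hp.isCond.inP (θ_le_top hβ))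
  | add_one α ih =>
    have hα : α < ω_ 1 := (lt_add_one α).trans_le hβ
    have hθ' := θ_le_top (M := M) hβ
    have hlt := θ_lt_succ (M := M) hα
    obtain ⟨h, hh, hr⟩ := exists_right (M := M) hα
    obtain ⟨l, hl, hll⟩ := exists_left (M := M) hα
    have hpull := isThin_tensorPull hβ (lt_add_one α) hh hp
    have hproj := hp.isCond.proj hθ' hlt.le
    -- Every point of the two pull-backs comes from a point of `p` by an embedding.
    have hlift : ∀ a ∈ tensorPull (M.φ (M.θ α)) (M.θ α) (h.lvl (M.θ α)) h.base p ∪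
        M.proj (M.θ α) p, M.IsPt α a.1 ∧ ∃ e ∈ p, e.2 = a.2 ∧ ∃ f ∈ M.F α (α + 1),
          M.key e.1 = M.key (M.act f α a.1) := by
      rintro a (ha | ha)
      · exact ⟨hpull.isPt a ha, _, ha.2.2, rfl, h, hh, rfl⟩
      · refine ⟨hproj.isPt ha, ?_⟩
        have hpt := hproj.isPt ha
        obtain ⟨e, ⟨he, hμ⟩, rfl⟩ := ha
        refine ⟨e, he, rfl, l, hl, ?_⟩
        rw [key_act_left hα hll hpt]
        exact (key_pr hθ' hlt.le (hp.isPt e he).1 hμ).symm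
    have hthin : M.IsThin α (tensorPull (M.φ (M.θ α)) (M.θ α) (h.lvl (M.θ α)) h.base p ∪
        M.proj (M.θ α) p) := by
      refine ⟨hpull.finite.union hproj.finite, fun a ha => (hlift a ha).1,
        fun a ha a' ha' hrel => ?_⟩
      obtain ⟨hpt, e, he, h1, f, hf, hk⟩ := hlift a ha
      obtain ⟨hpt', e', he', h1', f', hf', hk'⟩ := hlift a' ha'
      rw [← h1, ← h1']
      exact hp.coherent e he e' he' ((Rel.of_key hk).trans hβ
        (((rel_act hβ (lt_add_one α) hf hf' hpt hpt').2 hrel).trans hβ (Rel.of_key hk'.symm)))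
    exact .succ α p _ h (hp.isCond.inP hθ') hh hr (ih hα.le hpull) (ih hα.le hthin)
      subset_union_left fun g hg =>
        (pull_subset_proj hθ' (hom_of_mem hlt hg)).trans subset_union_right
  | limit β hl ih =>
    obtain ⟨α, hα, f, hf, q, hq, rfl, -⟩ := hp.exists_tensorPush hβ hl (θ_pos_of_le hβ)
    exact .limit β _ f q hl hα hf (ih _ hα (hα.le.trans hβ) hq)

/-! ### The forcings `ℙ_{ω₃}` and `ℚ_{ω₂}` -/

theorem isThin_proj (hα : α ≤ ω_ 1) (hρ : ρ ≤ M.θ α) (hp : M.IsThin α p) :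
    M.IsThin α (M.proj ρ p) := by
  have hθ := θ_le_top (M := M) hα
  have hc := hp.isCond.proj hθ hρ
  refine hp.of_key hα hc.finite (fun e he => (hc.of_le hθ hρ).isPt he) ?_
  rintro _ ⟨e, ⟨he, hμ⟩, rfl⟩
  exact ⟨e, he, (key_pr hθ hρ (hp.isPt e he).1 hμ).symm, rfl⟩

theorem InThinQ.exists_isThin {s : Rep} (hβ : β ≤ ω_ 1) (hs : M.InThinQ β ν s) :
    ∃ p, M.IsThin β p ∧ M.rep p = s := by
  induction hs with
  | zero ν p lt inP dom =>
    have hθ := θ_le_top (M := M) hβ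
    have hp := inP.isCond le_rfl
    have hν := lt.trans_le hθ
    refine ⟨M.proj ν p, isThin_zero ((hp.proj le_rfl hν.le).of_le hθ lt.le), ?_⟩
    rw [rep_proj hp hν]
    exact Subset.antisymm (sep_subset _ _)
      fun x hx => ⟨hx, Order.lt_add_one_iff.1 (dom x hx)⟩
  | succ α ν p lt thin dom =>
    have hθ := θ_le_top (M := M) hβ
    have ht := thin.isThin hβ
    have hp := ht.isCond.of_le le_rfl hθ
    refine ⟨M.proj ν p, isThin_proj hβ lt.le ht, ?_⟩
    rw [rep_proj hp (lt.trans_le hθ)]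
    ext x
    exact ⟨fun h => ⟨h.1, h.2.trans_lt lt⟩, fun h => ⟨h.1, Order.lt_add_one_iff.1 (dom x h)⟩⟩
  | limit β α ν f q isLimit lt mem lt_θ thin ih =>
    obtain ⟨p, hp, rfl⟩ := ih (lt.le.trans hβ)
    exact ⟨_, isThin_tensorPush hβ lt mem hp, rep_tensorPush hβ lt mem hp.isCond⟩

theorem isThin_top_isCond (hp : M.IsThin (ω_ 1) p) : M.IsCond (ω_ 2) p := by
  have := hp.isCond
  rwa [M.θ_top] at this

theorem rep_mem_thinQ (hp : M.IsThin (ω_ 1) p) : M.rep p ∈ M.thinQ := by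
  have hc := isThin_top_isCond hp
  obtain ⟨hb, hbl⟩ := bottom_spec hc
  obtain ⟨α, hα, f, hf, q, hq, hqp, ν, hν, hfν⟩ := hp.exists_tensorPush le_rfl
    (isSuccLimit_omega 1) (δ := M.bottom p) (by rwa [M.θ_top])
  have hfe := M.emb _ _ hα le_rfl f hf
  have hθ := θ_le_top (M := M) hα.le
  have hqc := hq.isCond.of_le le_rfl hθ
  -- The support of `q` is bounded by `ν` since `f ν` bounds the support of `p`.
  have hdom : ∀ x ∈ M.rep q, x.1 ≤ ν := by
    rintro ⟨ζ, c⟩ hx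
    obtain ⟨hs, -⟩ := (mem_rep hqc).1 hx
    rcases (mem_supp_iff hqc).1 hs with rfl | ⟨δ, hδ, rfl, hsm⟩
    · exact bot_le
    · have hδθ : δ < M.θ (α + 1) := by
        by_contra! hle
        have := hq.isCond.of_le hδ.le hle
        exact hsm ((this.lifts hδ.le).smooth hqc hδ)
      rw [← smooth_tensorPush_base le_rfl hα hf hq.isCond hδθ, hqp] at hsm
      have hfδ : f.base δ < ω_ 2 := by
        have := hfe.base_lt hδθ
        rwa [M.θ_top] at this
      have := supp_le_of_lifts hc hbl ((mem_supp_succ hc hfδ).2 hsm)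
      rw [← hfν, Order.add_one_le_iff, hfe.base_lt_iff hδθ.le hν.le] at this
      exact Order.add_one_le_of_lt this
  have heq : {x ∈ M.rep q | x.1 < M.θ (α + 1)} = M.rep q :=
    Subset.antisymm (sep_subset _ _) fun x hx => ⟨hx, (hdom x hx).trans_lt hν⟩
  refine ⟨M.bottom p, hb, ?_⟩
  rw [← hqp, rep_tensorPush le_rfl hα hf hq.isCond, hqp, ← hfν, ← heq]
  exact .limit _ _ ν f _ (isSuccLimit_omega 1) hα hf hν
    (.succ α ν q hν (hq.inThinP hα.le) fun x hx => Order.lt_add_one_iff.2 (hdom x hx.1))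

theorem rep_le_refl (s : Rep) : s.Le s := fun x hx => ⟨x.2, hx, Subset.rfl⟩

theorem isThin_of_rep_mem (hp : M.IsCond (ω_ 2) p) (h : M.rep p ∈ M.thinQ) :
    M.IsThin (ω_ 1) p := by
  obtain ⟨ν, -, hν⟩ := h
  obtain ⟨q, hq, he⟩ := hν.exists_isThin le_rfl
  have hqc := isThin_top_isCond hq
  refine hq.of_key le_rfl hp.finite (fun e h => ?_) fun e h =>
    exists_key_of_rep_le hp hqc (he ▸ rep_le_refl _) h
  rw [← M.θ_top] at hp
  exact hp.isPt h

theorem PForcing.isCond (p : M.PForcing) : M.IsCond (ω_ 2) p.val := p.inP.isCond le_rfl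

theorem PForcing.isThin (p : M.PForcing) : M.IsThin (ω_ 1) p.val :=
  isThin_of_rep_mem p.isCond p.thin

variable (M) in
/-- A thin condition as an element of `ℙ_{ω₃}`. -/
def PForcing.ofThin (p : Cond) (hp : M.IsThin (ω_ 1) p) : M.PForcing :=
  ⟨p, (isThin_top_isCond hp).inP le_rfl, rep_mem_thinQ hp⟩

theorem repMap_surjective : Function.Surjective M.repMap := by
  rintro ⟨q, ν, hν, hq⟩
  obtain ⟨p, hp, rfl⟩ := hq.exists_isThin le_rfl
  exact ⟨.ofThin M p hp, rfl⟩

end GapTwoMorass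
end MorassForcing

namespace MorassForcing

/-! ### Cohen forcing -/

/-- The forcing of finite partial functions from `I` to `2`, given by their graphs. -/
@[ext]
structure FinPartial (I : Type*) where
  val : Finset (I × Bool)
  functional : ∀ x ∈ val, ∀ y ∈ val, x.1 = y.1 → x.2 = y.2

instance {I : Type*} : PartialOrder (FinPartial I) where
  le s t := t.val ⊆ s.val
  le_refl _ := Finset.Subset.refl _
  le_trans _ _ _ h h' := h'.trans h
  le_antisymm _ _ h h' := FinPartial.ext (Finset.Subset.antisymm h' h)

namespace FinPartial

variable {I : Type*}

open Classical in
/-- Two finite partial functions that agree on their common domain are compatible. -/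
theorem compatible_of_agree {s t : FinPartial I}
    (h : ∀ x ∈ s.val, ∀ y ∈ t.val, x.1 = y.1 → x.2 = y.2) : Compatible s t := by
  refine ⟨⟨s.val ∪ t.val, ?_⟩, Finset.subset_union_left, Finset.subset_union_right⟩
  intro x hx y hy hxy
  rcases Finset.mem_union.1 hx with hx | hx <;> rcases Finset.mem_union.1 hy with hy | hy
  · exact s.functional x hx y hy hxy
  · exact h x hx y hy hxy
  · exact (h y hy x hx hxy.symm).symm
  · exact t.functional x hx y hy hxy

/-- The set of all total functions that extend `s`. -/
def cylinder (s : FinPartial I) : Set (I → Bool) := {w | ∀ x ∈ s.val, w x.1 = x.2}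

open Classical in
theorem cylinder_eq_pi (s : FinPartial I) : s.cylinder =
    (↑(s.val.image Prod.fst) : Set I).pi fun i => {b | ∀ x ∈ s.val, x.1 = i → b = x.2} := by
  ext w
  simp only [cylinder, mem_ofPred_eq, Set.mem_pi, Finset.coe_image]
  constructor
  · rintro h _ - x hx rfl
    exact h x hx
  · intro h x hx
    exact h x.1 ⟨x, hx, rfl⟩ x hx rfl

open MeasureTheory in
/-- Cohen forcing is ccc: incompatible conditions have disjoint cylinders, and cylinders have
positive measure for the product measure on `2^I`. -/
theorem ccc : CCC (FinPartial I) := by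
  classical
  intro X hX
  let m : I → Measure Bool := fun _ => (PMF.uniformOfFintype Bool).toMeasure
  have hfin : ∀ s : FinPartial I, ∀ i ∈ s.val.image Prod.fst,
      MeasurableSet {b : Bool | ∀ x ∈ s.val, x.1 = i → b = x.2} := fun _ _ _ =>
    (Set.toFinite _).measurableSet
  have hmeas : ∀ s : X, MeasurableSet s.1.cylinder := fun s => by
    rw [cylinder_eq_pi]
    exact MeasurableSet.pi (Finset.countable_toSet _) (hfin s.1)
  have hpos : ∀ s : X, 0 < Measure.infinitePi m s.1.cylinder := fun s => by
    rw [cylinder_eq_pi, Measure.infinitePi_pi _ (hfin s.1), pos_iff_ne_zero,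
      Finset.prod_ne_zero_iff]
    intro i hi
    obtain ⟨x, hx, rfl⟩ := Finset.mem_image.1 hi
    have hsub : {x.2} ⊆ {b : Bool | ∀ y ∈ s.1.val, y.1 = x.1 → b = y.2} := by
      rintro _ rfl y hy hyx
      exact (s.1.functional y hy x hx hyx).symm
    refine (lt_of_lt_of_le ?_ (measure_mono hsub)).ne'
    rw [PMF.toMeasure_apply_singleton _ _ (Set.toFinite _).measurableSet]
    simp
  have hdisj : Pairwise (Function.onFun Disjoint fun s : X => s.1.cylinder) := by
    intro s t hst
    refine Set.disjoint_left.2 fun w hs ht => ?_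
    refine hX s.1 s.2 t.1 t.2 (fun h => hst (Subtype.ext h)) (compatible_of_agree ?_)
    intro x hx y hy hxy
    rw [← hs x hx, ← ht y hy, hxy]
  have := Measure.countable_meas_pos_of_disjoint_iUnion (μ := Measure.infinitePi m) hmeas hdisj
  have huniv : {s : X | 0 < Measure.infinitePi m s.1.cylinder} = Set.univ :=
    eq_univ_of_forall hpos
  rw [huniv] at this
  exact countable_coe_iff.1 (countable_univ_iff.1 this)

theorem mk_eq [Infinite I] : #(FinPartial I) = #I := by
  refine le_antisymm ?_ ?_
  · have h : Function.Injective (FinPartial.val : FinPartial I → Finset (I × Bool)) :=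
      fun s t h => FinPartial.ext h
    refine (Cardinal.mk_le_of_injective h).trans ?_
    rw [Cardinal.mk_finset_of_infinite, Cardinal.mk_prod]
    simp only [Cardinal.lift_id', Cardinal.mk_bool, Cardinal.lift_ofNat]
    exact (Cardinal.mul_eq_left (Cardinal.aleph0_le_mk I)
      ((Cardinal.natCast_le_aleph0 (n := 2)).trans (Cardinal.aleph0_le_mk I)) two_ne_zero).le
  · refine Cardinal.mk_le_of_injective
      (f := fun i : I => (⟨{(i, true)}, by simp⟩ : FinPartial I)) ?_
    intro i j h
    have := congrArg FinPartial.val h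
    simpa using this

end FinPartial

namespace GapTwoMorass

variable {M : GapTwoMorass} {α β : Ordinal.{0}} {f g : Emb} {x y : Ordinal.{0} × Ordinal.{0}}

/-! ### The number of classes of points -/

theorem F_nonempty (hβ : β ≤ ω_ 1) (hα : α < β) : (M.F α β).Nonempty := by
  induction β using Ordinal.limitRecOn generalizing α with
  | zero => exact absurd hα not_lt_bot
  | add_one β ih =>
    have hβ1 : β < ω_ 1 := (lt_add_one β).trans_le hβ
    obtain ⟨h, hh, -⟩ := exists_right (M := M) hβ1
    rcases (Order.lt_add_one_iff.1 hα).eq_or_lt with rfl | hlt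
    · exact ⟨h, hh⟩
    · obtain ⟨f, hf⟩ := ih hβ1.le hlt
      exact ⟨_, F_comp hβ hlt (lt_add_one β) hh hf⟩
  | limit β hl ih =>
    obtain ⟨γ, hγ, f, hf, -⟩ := M.cover_base β hβ hl 0 (θ_pos_of_le hβ)
    rcases lt_trichotomy α γ with hlt | rfl | hlt
    · obtain ⟨g, hg⟩ := ih γ hγ (hγ.le.trans hβ) hlt
      exact ⟨_, F_comp hβ hlt hγ hf hg⟩
    · exact ⟨f, hf⟩
    · obtain ⟨g, hg, -⟩ := F_decomp hβ hlt hα hf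
      exact ⟨g, hg⟩

variable (M) in
/-- `x` is a point of level `α + 1` whose node is not in the range of an embedding from level
`α`. -/
def IsNew (α : Ordinal.{0}) (x : Ordinal.{0} × Ordinal.{0}) : Prop :=
  M.IsPt (α + 1) x ∧ ∀ f ∈ M.F α (α + 1), ∀ y, M.IsPt α y → M.key x ≠ M.key (M.act f α y)

/-- New points exist: the map `h_η ∈ G η θ_α` of the right-branching embedding is not onto, and the
points of height `θ_α` over the missing ordinals are new. -/
theorem exists_isNew (hα : α < ω_ 1) : ∃ x, M.IsNew α x := by
  have hs := succ_le_omega_one hα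
  have hθ' := θ_le_top (M := M) hs
  have hθ := θ_le_top (M := M) hα.le
  have hlt := θ_lt_succ (M := M) hα
  obtain ⟨h, hh, hr⟩ := exists_right (M := M) hα
  obtain ⟨η, hη, -, hb, -, -, h5, -⟩ := hr.branch
  have hbη := right_base_eq hη hb
  have h5' := hom_of_mem hη h5
  have hη1 := Order.add_one_le_of_lt hη
  have hη2 : η < ω_ 2 := hη.trans_le hθ
  have hmiss : ∃ ν < M.φ (M.θ α), ∀ s < M.φ η, h.lvl η s ≠ ν := by
    obtain ⟨c, hc⟩ := hom_nonempty (M := M) hθ hη1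
    obtain ⟨τ, hτ, hle⟩ := exists_splitMap_ne (M := M) hη2
    have hcm := isOrdMap_of_hom hθ hc
    have hm := isOrdMap_of_hom (hη1.trans hθ) (splitMap_mem (M := M) hη2)
    have hτ' := hτ.trans_le (φ_mono (hη1.trans hθ) (lt_add_one η).le)
    by_contra! hno
    obtain ⟨s, hs, he⟩ := hno _ (hcm.lt τ hτ')
    obtain ⟨s', hs', he'⟩ := hno _ (hcm.lt _ (hm.lt τ hτ))
    -- Both values have the predecessor `τ` on level `η`.
    have e1 : s = τ := by
      rw [← pr_map hθ h5' hs, he, pr_hom hθ hc (lt_add_one η).le hτ', pr_of_lt hη2.le hτ]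
    have e2 : s' = τ := by
      rw [← pr_map hθ h5' hs', he', pr_hom hθ hc (lt_add_one η).le (hm.lt τ hτ),
        pr_map (hη1.trans hθ) (splitMap_mem hη2) hτ]
    rw [e1] at he
    rw [e2, he] at he'
    have := hcm.inj hτ' (hm.lt τ hτ) he'
    rw [← this] at hle
    exact absurd hτ hle.not_gt
  obtain ⟨ν, hν, hmiss⟩ := hmiss
  have hdiv : (ω * M.θ α) / ω = M.θ α := by simp
  refine ⟨(ν, ω * M.θ α), ⟨hν.trans_le (φ_mono hθ' hlt.le), by rwa [hdiv]⟩, ?_⟩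
  intro f hf y hy hk
  rcases key_act_succ hα hf hy with h1 | ⟨h1, h2⟩
  · rw [h1] at hk
    have h3 := hy.2
    rw [← key_snd hk, hdiv] at h3
    exact lt_irrefl _ h3
  · obtain rfl := right_unique hα hf hh h1 hr
    have h4 := pr_eq_of_key_eq hk
    simp only [hdiv] at h4
    have hθ1 := Order.add_one_le_of_lt hlt
    have hact := (isPt_act hs (lt_add_one α) hf hy).1
    have h6 := congrArg (M.pr (M.θ α)) h4
    rw [pr_pr hθ' hθ1 (lt_add_one _).le (hν.trans_le (φ_mono hθ' hlt.le)),
      pr_pr hθ' hθ1 (lt_add_one _).le hact, pr_of_lt hθ hν] at h6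
    have h7 := hr.emb.pr_lvl hθ hθ' hη.le hy.1
    rw [hbη] at h7
    exact hmiss _ (pr_lt hθ hη.le hy.1) (h6.trans h7).symm

theorem IsNew.not_rel (hα : α < β) (hβ : β < ω_ 1) (hx : M.IsNew α x) (hy : M.IsNew β y)
    (hf : f ∈ M.F (α + 1) (ω_ 1)) (hg : g ∈ M.F (β + 1) (ω_ 1)) :
    ¬ M.Rel (ω_ 1) (M.act f (α + 1) x) (M.act g (β + 1) y) := by
  intro hr
  have hs := succ_le_omega_one hβ
  have hβ' : β + 1 < ω_ 1 := (isSuccLimit_omega 1).succ_lt hβ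
  have hαβ : α + 1 < β + 1 := (Order.add_one_le_of_lt hα).trans_lt (lt_add_one β)
  obtain ⟨k, hk, j, hj, rfl⟩ := F_decomp le_rfl hαβ hβ' hf
  rw [act_comp le_rfl hαβ hβ' hj hx.1, rel_act le_rfl hβ' hk hg (isPt_act hs hαβ hj hx.1) hy.1]
    at hr
  rcases rel_succ hβ hr with h | ⟨-, -, g', hg', -, w, -, hw, -, -, h2⟩
  · rcases (Order.add_one_le_of_lt hα).eq_or_lt with rfl | hlt
    · exact hy.2 j hj x hx.1 h.symm
    · obtain ⟨i, hi, l, hl, rfl⟩ := F_decomp hs hlt (lt_add_one β) hj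
      rw [act_comp hs hlt (lt_add_one β) hl hx.1] at h
      exact hy.2 i hi _ (isPt_act hβ.le hlt hl hx.1) h.symm
  · exact hy.2 g' hg' w hw h2

theorem countable_Iio_of_lt (h : α < ω_ 1) : (Iio α).Countable := by
  rw [← Cardinal.le_aleph0_iff_set_countable, Cardinal.mk_Iio_ordinal, Cardinal.lift_le_aleph0,
    ← Order.lt_succ_iff, Cardinal.succ_aleph0, ← Cardinal.lt_ord,
    Cardinal.ord_aleph]
  exact h

theorem countable_isPt (hα : α < ω_ 1) : {x | M.IsPt α x}.Countable := by
  have h1 := countable_Iio_of_lt (M.φ_lt _ (M.θ_lt α hα))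
  have h2 := countable_Iio_of_lt (M.θ_lt α hα)
  have h3 := countable_Iio_of_lt (α := ω) (by
    rw [← Ordinal.omega_zero]; exact omega_lt_omega.2 zero_lt_one)
  refine ((h1.prod (h2.prod h3)).image fun t => (t.1, ω * t.2.1 + t.2.2)).mono ?_
  intro x hx
  exact ⟨(x.1, x.2 / ω, x.2 % ω), ⟨hx.1, hx.2, Ordinal.mod_lt _ omega0_ne_zero⟩,
    Prod.ext rfl (Ordinal.div_add_mod _ _)⟩

variable (M) in
/-- The setoid of points of the top level given by `Rel`. -/
def relSetoid : Setoid (Ordinal.{0} × Ordinal.{0}) where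
  r := M.Rel (ω_ 1)
  iseqv := ⟨fun _ => Or.inl rfl, Rel.symm, Rel.trans le_rfl⟩

variable (M) in
/-- The set of classes of points of the top level. -/
def classes : Set (Quotient M.relSetoid) := Quotient.mk M.relSetoid '' {x | M.IsPt (ω_ 1) x}

theorem mk_Iio_omega_one : #(Iio (ω_ 1 : Ordinal.{0})) = ℵ_ 1 := by
  rw [Cardinal.mk_Iio_ordinal, card_omega, Cardinal.lift_aleph, Ordinal.lift_one]

theorem mk_classes_le : #M.classes ≤ ℵ_ 1 := by
  have hsub : M.classes ⊆ ⋃ α ∈ Iio (ω_ 1), {c | ∃ f ∈ M.F α (ω_ 1), ∃ y, M.IsPt α y ∧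
      Quotient.mk M.relSetoid (M.act f α y) = c} := by
    rintro _ ⟨x, hx, rfl⟩
    obtain ⟨α, hα, f, hf, y, hy, rfl⟩ := exists_act_eq le_rfl (isSuccLimit_omega 1) hx
    exact mem_biUnion hα ⟨f, hf, y, hy, rfl⟩
  refine (Cardinal.mk_le_mk_of_subset hsub).trans ((Cardinal.mk_biUnion_le _ _).trans ?_)
  rw [mk_Iio_omega_one]
  refine (mul_le_mul_right (ciSup_le' fun α => ?_) _).trans
    (Cardinal.mul_eq_left (Cardinal.aleph0_le_aleph 1) (Cardinal.aleph0_le_aleph 1)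
      Cardinal.aleph0_ne_zero).le
  rw [Cardinal.le_aleph0_iff_set_countable]
  obtain ⟨f₀, hf₀⟩ := F_nonempty (M := M) le_rfl α.2
  refine ((countable_isPt (M := M) α.2).image
    fun y => Quotient.mk M.relSetoid (M.act f₀ α y)).mono ?_
  rintro _ ⟨f, hf, y, hy, rfl⟩
  exact ⟨y, hy, Quotient.sound ((rel_act le_rfl α.2 hf₀ hf hy hy).2 (Or.inl rfl))⟩

theorem le_mk_classes : ℵ_ 1 ≤ #M.classes := by
  have hex : ∀ α : Iio (ω_ 1 : Ordinal.{0}), ∃ x f, M.IsNew α.1 x ∧ f ∈ M.F (α.1 + 1) (ω_ 1) :=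
    fun α => by
      obtain ⟨x, hx⟩ := exists_isNew (M := M) α.2
      obtain ⟨f, hf⟩ := F_nonempty (M := M) le_rfl ((isSuccLimit_omega 1).succ_lt α.2)
      exact ⟨x, f, hx, hf⟩
  choose x f hx hf using hex
  rw [← mk_Iio_omega_one]
  refine Cardinal.mk_le_of_injective (f := fun α => (⟨Quotient.mk M.relSetoid
    (M.act (f α) (α.1 + 1) (x α)), _, isPt_act le_rfl ((isSuccLimit_omega 1).succ_lt α.2) (hf α)
      (hx α).1, rfl⟩ : M.classes)) ?_
  intro α β h
  have hr : M.Rel (ω_ 1) _ _ := Quotient.exact (Subtype.ext_iff.1 h)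
  rcases lt_trichotomy α.1 β.1 with hlt | heq | hlt
  · exact absurd hr ((hx α).not_rel hlt β.2 (hx β) (hf α) (hf β))
  · exact Subtype.ext heq
  · exact absurd (Rel.symm hr) ((hx β).not_rel hlt α.2 (hx α) (hf β) (hf α))

/-- The classes of points can be indexed by a type of size `ℵ₁`, and every class has a
representative. -/
theorem exists_index {I : Type} (hI : #I = ℵ_ 1) :
    ∃ (cls : Ordinal.{0} × Ordinal.{0} → I) (pt : I → Ordinal.{0} × Ordinal.{0}),
      (∀ x y, M.IsPt (ω_ 1) x → M.IsPt (ω_ 1) y → (cls x = cls y ↔ M.Rel (ω_ 1) x y)) ∧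
      ∀ i, M.IsPt (ω_ 1) (pt i) ∧ cls (pt i) = i := by
  classical
  have hc : Cardinal.lift.{0, 1} #M.classes = Cardinal.lift.{1, 0} #I := by
    rw [hI, le_antisymm mk_classes_le le_mk_classes]
    simp
  obtain ⟨e⟩ := Cardinal.lift_mk_eq'.1 hc
  have hne : Nonempty I := by
    rw [← Cardinal.mk_ne_zero_iff, hI]
    exact (Cardinal.aleph_pos 1).ne'
  have hrep : ∀ i, ∃ x, M.IsPt (ω_ 1) x ∧ Quotient.mk M.relSetoid x = (e.symm i).1 :=
    fun i => (e.symm i).2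
  choose pt hpt hmk using hrep
  let cls : Ordinal.{0} × Ordinal.{0} → I := fun x =>
    if h : M.IsPt (ω_ 1) x then e ⟨Quotient.mk M.relSetoid x, x, h, rfl⟩ else hne.some
  have hcls : ∀ x (h : M.IsPt (ω_ 1) x), cls x = e ⟨Quotient.mk M.relSetoid x, x, h, rfl⟩ :=
    fun x h => dif_pos h
  refine ⟨cls, pt, fun x y hx hy => ?_, fun i => ⟨hpt i, ?_⟩⟩
  · rw [hcls x hx, hcls y hy, e.injective.eq_iff]
    exact Subtype.ext_iff.trans (Quotient.eq (r := M.relSetoid))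
  · rw [hcls _ (hpt i), ← e.symm.injective.eq_iff, e.symm_apply_apply]
    exact Subtype.ext (hmk i)

/-! ### The dense embeddings -/

/-- Conditions in `ℙ_{ω₃}` that give the same values to all classes are compatible. -/
theorem PForcing.compatible_of_agree {p q : M.PForcing}
    (h : ∀ e ∈ p.val, ∀ e' ∈ q.val, M.Rel (ω_ 1) e.1 e'.1 → e.2 = e'.2) : Compatible p q := by
  have hp := p.isThin
  have hq := q.isThin
  refine ⟨.ofThin M (p.val ∪ q.val) ⟨hp.finite.union hq.finite, ?_, ?_⟩,
    subset_union_left, subset_union_right⟩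
  · rintro e (he | he)
    · exact hp.isPt e he
    · exact hq.isPt e he
  · rintro e (he | he) e' (he' | he') hr
    · exact hp.coherent e he e' he' hr
    · exact h e he e' he' hr
    · exact (h e' he' e he hr.symm).symm
    · exact hq.coherent e he e' he' hr

theorem repMap_mono {p q : M.PForcing} (h : q ≤ p) : M.repMap q ≤ M.repMap p :=
  rep_le_of_subset p.isCond q.isCond h

theorem Compatible.map {A B : Type*} [Preorder A] [Preorder B] {σ : A → B} (hσ : Monotone σ)
    {a b : A} (h : Compatible a b) : Compatible (σ a) (σ b) := by
  obtain ⟨c, h1, h2⟩ := h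
  exact ⟨σ c, hσ h1, hσ h2⟩

/-- For a monotone surjection, it suffices to reflect compatibility. -/
theorem isDenseEmbedding_of_surjective {A B : Type*} [Preorder A] [Preorder B] {σ : A → B}
    (hσ : Monotone σ) (hs : Function.Surjective σ)
    (hc : ∀ a b, Compatible (σ a) (σ b) → Compatible a b) : IsDenseEmbedding σ where
  mono _ _ h := hσ h
  incompatible_iff a b := not_congr ⟨fun h => Compatible.map hσ h, hc a b⟩
  dense q := by
    obtain ⟨a, rfl⟩ := hs q
    exact ⟨a, le_rfl⟩

section ClassMap

variable {I : Type} {cls : Ordinal.{0} × Ordinal.{0} → I} {pt : I → Ordinal.{0} × Ordinal.{0}}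

open Classical in
/-- The finite partial function on classes that is induced by a condition in `ℙ_{ω₃}`. -/
noncomputable def classMap
    (hcls : ∀ x y, M.IsPt (ω_ 1) x → M.IsPt (ω_ 1) y → (cls x = cls y ↔ M.Rel (ω_ 1) x y))
    (p : M.PForcing) : FinPartial I where
  val := p.isThin.finite.toFinset.image fun e => (cls e.1, e.2)
  functional := by
    have hp := p.isThin
    intro x hx y hy hxy
    obtain ⟨e, he, rfl⟩ := Finset.mem_image.1 hx
    obtain ⟨e', he', rfl⟩ := Finset.mem_image.1 hy
    rw [Finite.mem_toFinset] at he he'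
    exact hp.coherent e he e' he' ((hcls _ _ (hp.isPt e he) (hp.isPt e' he')).1 hxy)

variable (hcls : ∀ x y, M.IsPt (ω_ 1) x → M.IsPt (ω_ 1) y → (cls x = cls y ↔ M.Rel (ω_ 1) x y))

theorem mem_classMap {p : M.PForcing} {t : I × Bool} :
    t ∈ (classMap hcls p).val ↔ ∃ e ∈ p.val, cls e.1 = t.1 ∧ e.2 = t.2 := by
  classical
  simp only [classMap, Finset.mem_image, Finite.mem_toFinset]
  exact exists_congr fun e => and_congr_right fun _ => Prod.ext_iff

theorem classMap_mono : Monotone (classMap hcls : M.PForcing → FinPartial I) := by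
  intro p q h t ht
  obtain ⟨e, he, h'⟩ := (mem_classMap hcls).1 ht
  exact (mem_classMap hcls).2 ⟨e, h he, h'⟩

theorem classMap_le_of_repMap_le {p q : M.PForcing} (h : M.repMap q ≤ M.repMap p) :
    classMap hcls q ≤ classMap hcls p := by
  intro t ht
  obtain ⟨e, he, h1, h2⟩ := (mem_classMap hcls).1 ht
  obtain ⟨d, hd, h3, h4⟩ := exists_key_of_rep_le p.isCond q.isCond h he
  refine (mem_classMap hcls).2 ⟨d, hd, ?_, h4.trans h2⟩
  rw [← h1, hcls _ _ (q.isThin.isPt d hd) (p.isThin.isPt e he)]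
  exact Rel.of_key h3

theorem compatible_of_classMap {p q : M.PForcing}
    (h : Compatible (classMap hcls p) (classMap hcls q)) : Compatible p q := by
  obtain ⟨r, h1, h2⟩ := h
  refine PForcing.compatible_of_agree fun e he e' he' hr => ?_
  exact r.functional (cls e.1, e.2) (h1 ((mem_classMap hcls).2 ⟨e, he, rfl, rfl⟩))
    (cls e'.1, e'.2) (h2 ((mem_classMap hcls).2 ⟨e', he', rfl, rfl⟩))
    ((hcls _ _ (p.isThin.isPt e he) (q.isThin.isPt e' he')).2 hr)

/-- The canonical condition that induces a given finite partial function on classes. -/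
theorem exists_section (hpt : ∀ i, M.IsPt (ω_ 1) (pt i) ∧ cls (pt i) = i) (s : FinPartial I) :
    ∃ p : M.PForcing, p.val = (fun t : I × Bool => (pt t.1, t.2)) '' s.val ∧
      classMap hcls p = s := by
  have hthin : M.IsThin (ω_ 1) ((fun t : I × Bool => (pt t.1, t.2)) '' s.val) := by
    refine ⟨s.val.finite_toSet.image _, ?_, ?_⟩
    · rintro _ ⟨t, -, rfl⟩
      exact (hpt t.1).1
    · rintro _ ⟨t, ht, rfl⟩ _ ⟨t', ht', rfl⟩ hr
      rw [← hcls _ _ (hpt t.1).1 (hpt t'.1).1, (hpt t.1).2, (hpt t'.1).2] at hr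
      exact s.functional t ht t' ht' hr
  refine ⟨.ofThin M _ hthin, rfl, FinPartial.ext (Finset.ext fun t => ?_)⟩
  rw [mem_classMap]
  constructor
  · rintro ⟨_, ⟨t', ht', rfl⟩, h1, h2⟩
    rw [(hpt t'.1).2] at h1
    have : t' = t := Prod.ext h1 h2
    exact this ▸ ht'
  · intro ht
    exact ⟨_, ⟨t, ht, rfl⟩, (hpt t.1).2, rfl⟩

/-- The restriction of `classMap` to the conditions on representatives is an isomorphism. -/
theorem isDenseEmbedding_classMap_section
    (hpt : ∀ i, M.IsPt (ω_ 1) (pt i) ∧ cls (pt i) = i) :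
    Function.Bijective (fun p : {p : M.PForcing | ∀ e ∈ p.val, pt (cls e.1) = e.1} =>
        classMap hcls p.1) ∧
      IsDenseEmbedding (fun p : {p : M.PForcing | ∀ e ∈ p.val, pt (cls e.1) = e.1} =>
        classMap hcls p.1) := by
  have hsurj : Function.Surjective
      (fun p : {p : M.PForcing | ∀ e ∈ p.val, pt (cls e.1) = e.1} => classMap hcls p.1) := by
    intro s
    obtain ⟨p, hp, hs⟩ := exists_section hcls hpt s
    refine ⟨⟨p, ?_⟩, hs⟩
    intro e he
    rw [hp] at he
    obtain ⟨t, -, rfl⟩ := he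
    exact congrArg pt (hpt t.1).2
  have hle : ∀ p q : {p : M.PForcing | ∀ e ∈ p.val, pt (cls e.1) = e.1},
      classMap hcls p.1 ≤ classMap hcls q.1 → p ≤ q := by
    intro p q h e he
    obtain ⟨d, hd, h1, h2⟩ :=
      (mem_classMap hcls).1 (h ((mem_classMap hcls (t := (cls e.1, e.2))).2 ⟨e, he, rfl, rfl⟩))
    have : d = e := Prod.ext (by rw [← p.2 d hd, ← q.2 e he, h1]) h2
    exact this ▸ hd
  refine ⟨⟨fun p q h => ?_, hsurj⟩, isDenseEmbedding_of_surjective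
    (fun p q h => classMap_mono hcls h) hsurj ?_⟩
  · exact le_antisymm (hle p q (le_of_eq h)) (hle q p (le_of_eq h.symm))
  · rintro p q ⟨s, h1, h2⟩
    obtain ⟨r, rfl⟩ := hsurj s
    exact ⟨r, hle r p h1, hle r q h2⟩

end ClassMap

end GapTwoMorass
end MorassForcing

open MorassForcing MorassForcing.GapTwoMorass in
theorem lemma4p8 (M : MorassForcing.GapTwoMorass) :
    MorassForcing.IsDenseEmbedding M.repMap ∧
    ∃ (R : Type) (_ : PartialOrder R),
      Cardinal.mk R = Cardinal.aleph 1 ∧ MorassForcing.CCC R ∧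
      ∃ j : M.QForcing → R, MorassForcing.IsDenseEmbedding j ∧
        MorassForcing.IsDenseEmbedding (fun p : M.PForcing => j (M.repMap p)) ∧
        ∃ S : Set M.PForcing, Cardinal.mk S = Cardinal.aleph 1 ∧
          MorassForcing.IsDenseEmbedding (fun p : S => j (M.repMap p)) := by
  obtain ⟨I, hI⟩ : ∃ I : Type, Cardinal.mk I = Cardinal.aleph 1 := ⟨_, Cardinal.mk_out _⟩
  obtain ⟨cls, pt, hcls, hpt⟩ := exists_index (M := M) hI
  have hinf : Infinite I := by
    rw [Cardinal.infinite_iff, hI]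
    exact Cardinal.aleph0_le_aleph 1
  have hcard : Cardinal.mk (FinPartial I) = Cardinal.aleph 1 := by rw [FinPartial.mk_eq, hI]
  -- A condition in `ℚ_{ω₂}` is mapped to the finite partial function induced by any condition
  -- in `ℙ_{ω₃}` that it represents.
  choose pre hpre using repMap_surjective (M := M)
  let j : M.QForcing → FinPartial I := fun q => classMap hcls (pre q)
  have hj : ∀ p, j (M.repMap p) = classMap hcls p := fun p =>
    le_antisymm (classMap_le_of_repMap_le hcls (hpre _).le)
      (classMap_le_of_repMap_le hcls (hpre _).ge)
  have hjmono : Monotone j := fun q q' h =>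
    classMap_le_of_repMap_le hcls (by rw [hpre, hpre]; exact h)
  have hclass : Function.Surjective (classMap hcls : M.PForcing → FinPartial I) := fun s => by
    obtain ⟨p, -, hp⟩ := exists_section hcls hpt s
    exact ⟨p, hp⟩
  have hrep : ∀ p q : M.PForcing, Compatible (M.repMap p) (M.repMap q) → Compatible p q :=
    fun p q h => by
      have := Compatible.map hjmono h
      rw [hj, hj] at this
      exact compatible_of_classMap hcls this
  obtain ⟨hbij, hdense⟩ := isDenseEmbedding_classMap_section hcls hpt
  refine ⟨isDenseEmbedding_of_surjective (fun _ _ h => repMap_mono h) repMap_surjective hrep,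
    FinPartial I, inferInstance, hcard, FinPartial.ccc, j, ?_, ?_,
    {p | ∀ e ∈ p.val, pt (cls e.1) = e.1}, ?_, ?_⟩
  · refine isDenseEmbedding_of_surjective hjmono (fun s => ?_) fun q q' h => ?_
    · obtain ⟨p, rfl⟩ := hclass s
      exact ⟨M.repMap p, hj p⟩
    · have := Compatible.map (fun _ _ h => repMap_mono h) (compatible_of_classMap hcls h)
      rwa [hpre, hpre] at this
  · simp only [hj]
    exact isDenseEmbedding_of_surjective (classMap_mono hcls) hclass
      fun p q h => compatible_of_classMap hcls h
  · have := Cardinal.lift_mk_eq'.2 ⟨Equiv.ofBijective _ hbij⟩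
    rw [hcard] at this
    simpa using this
  · simp only [hj]
    exact hdense
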